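/- Let $q$ be a prime power, $0\le k\le n$, and let $\begin{bmatrix} n\\k\end{bmatrix}_q=\prod_{i=0}^{k-1}\frac{q^{n-i}-1}{q^{k-i}-1}$ (and $0$ if $k>n$) be the $q$-ary Gaussian coefficient. Identify the elements of $\mathbb F_q$ with the digits $0,\dots,q-1$ by a bijection sending $0\mapsto 0$ and $1\mapsto 1$. For a $k$-dimensional subspace $X$ of $\mathbb F_q^n$ let $\mathrm{RE}(X)=(X_n,\dots,X_1)$ be the $k\times n$ matrix in reduced row echelon form whose rows form a basis of $X$ ($X_j$ being the columns, numbered from right to left), and let $v_j=1$ if column $j$ contains the leading coefficient of some row and $v_j=0$ otherwise. The extended representation $\mathrm{EXT}(X)$ is the $(k+1)\times n$ matrix with columns $\binom{v_j}{X_j}$, $j=n,\dots,1$. Put $w_j=v_1+\dots+v_j$, let $\{X_j\}$ be the integer with base-$q$ digits $X_j$ (most significant digit on top), and let $$I_{\mathrm{EXT}}(X)=\sum_{j=1}^{n}\Bigl(v_j q^{k-w_{j-1}}+(1-v_j)\frac{\{X_j\}}{q^{w_{j-1}}}\Bigr)\begin{bmatrix} n-j\\k-w_{j-1}\end{bmatrix}_q$$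 be the (lexicographic) index of $X$. Encoding Algorithm A takes an integer $0\le i<\begin{bmatrix} n\\k\end{bmatrix}_q$, sets $i_0=i$, $w_0=0$, and for $j=1,\dots,n$, with $G_j=\begin{bmatrix} n-j\\k-w_{j-1}\end{bmatrix}_q$, does the following: if $w_{j-1}=k$, it sets $v_j=0$, $\{X_j\}=0$, $w_j=w_{j-1}$, $i_j=i_{j-1}$; otherwise, if $i_{j-1}\ge q^{k-w_{j-1}}G_j$, it sets $v_j=1$, $\{X_j\}=q^{w_{j-1}}$, $w_j=w_{j-1}+1$, $i_j=i_{j-1}-q^{k-w_{j-1}}G_j$; otherwise, it sets $v_j=0$, $\{X_j\}=\lfloor i_{j-1}/G_j\rfloor\, q^{w_{j-1}}$, $w_j=w_{j-1}$, $i_j=i_{j-1}-\lfloor i_{j-1}/G_j\rfloor G_j$. Its output is the $(k+1)\times n$ matrix with columns $\binom{v_j}{X_j}$, $j=n,\dots,1$, where $X_j$ is the column of the $k$ base-$q$ digits of $\{X_j\}$. Digit operations are counted for programs on a random access machine whose registers and memory cells hold nonnegative integers written in base $q$. Its instructions are: constants, copying, addition, truncated subtraction, multiplication, integer division, multiplication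 or integer division by a power $q^m$ (a shift), indirect reading and writing of memory cells, and if- and while-statements with tests $a<b$. Each is charged the number of base-$q$ digits of the integers and addresses that it handles (a left shift by $m$ is charged $m$ more), except that multiplication and division of integers with $a$ and $b$ digits are charged $a\cdot b$, the count of the school method; any faster multiplication has to be programmed. **Theorem.** There are an absolute constant $C$ and two programs of this kind, not depending on $q,n,k$, such that for all prime powers $q$ and all integers $n\ge 3$ and $0<k<n$: 1. (decoding) started with $q,n,k$ in registers and $\mathrm{EXT}(X)$ in the memory, for any $k$-dimensional subspace $X$ of $\mathbb F_q^n$, the first program halts with $I_{\mathrm{EXT}}(X)$ as its output after at most $C\, n\,k(n-k)\log n\,\log\log n$ digit operations; 2. (encoding) started with $q,n,k$ and any integer $0\le i<\begin{bmatrix} n\\k\end{bmatrix}_q$ in registers, the second program halts with the output matrix of Encoding Algorithm A on input $i$ in the memory after at most $C\, n\,k(n-k)\log n\,\log\log n$ digit operations. -/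

import Mathlib

namespace GrassmannCoding

/-! ### Reduced row echelon form, identifying vector, extended representation -/

section Representation

variable {F : Type*} [Field F] {n k : ℕ}

/-- `A` is a matrix in reduced row echelon form whose rows form a basis of `X`. -/
structure IsRREFOf (X : Submodule F (Fin n → F)) (A : Matrix (Fin k) (Fin n) F) : Prop where
  linearIndependent : LinearIndependent F (fun r => A r)
  span_eq : Submodule.span F (Set.range fun r => A r) = X
  isReducedRowEchelon : A.IsReducedRowEchelon

/-- Every `k`-dimensional subspace has a reduced row echelon form. -/
theorem exists_isRREFOf (X : Submodule F (Fin n → F)) (hX : Module.finrank F X = k) :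
    ∃ A : Matrix (Fin k) (Fin n) F, IsRREFOf X A := by
  classical
  -- the set of leading positions of vectors of `X`
  let S : Set (Fin n) := {c | ∃ x ∈ X, x c ≠ 0 ∧ ∀ c' < c, x c' = 0}
  have lead : ∀ x ∈ X, x ≠ 0 → ∃ c ∈ S, x c ≠ 0 ∧ ∀ c' < c, x c' = 0 := by
    intro x hx h0
    have hne : (Finset.univ.filter fun c => x c ≠ 0).Nonempty := by
      by_contra h
      apply h0
      ext c
      by_contra hc
      exact h ⟨c, by simpa using hc⟩
    have hm := Finset.min'_mem _ hne
    have hmin : ∀ c' < Finset.min' _ hne, x c' = 0 := by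
      intro c' hc'
      by_contra h
      exact absurd (Finset.min'_le _ c' (by simpa using h)) (not_le.mpr hc')
    have h1 : x (Finset.min' _ hne) ≠ 0 := by simpa using hm
    exact ⟨_, ⟨x, hx, h1, hmin⟩, h1, hmin⟩
  let f : X →ₗ[F] (S → F) :=
    { toFun := fun x c => (x : Fin n → F) c
      map_add' := fun _ _ => rfl
      map_smul' := fun _ _ => rfl }
  have hf : Function.Injective f := by
    rw [← LinearMap.ker_eq_bot, LinearMap.ker_eq_bot']
    intro x hx
    by_contra h
    obtain ⟨c, hc, h1, -⟩ := lead x x.2 (by simpa using h)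
    exact h1 (congrFun hx ⟨c, hc⟩)
  -- vectors with pairwise different leading positions are independent
  choose y hyX hy0 hyl using fun c : S => c.2
  have hli : LinearIndependent F (fun c : S => (⟨y c, hyX c⟩ : X)) := by
    rw [Fintype.linearIndependent_iff]
    intro g hg
    by_contra hne
    push Not at hne
    have hne' : (Finset.univ.filter fun c : S => g c ≠ 0).Nonempty := by
      obtain ⟨c, hc⟩ := hne
      exact ⟨c, by simpa using hc⟩
    set m := Finset.min' _ hne' with hm
    have hmg : g m ≠ 0 := by simpa using Finset.min'_mem _ hne'
    have h2 : ∑ c : S, g c * y c m = 0 := by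
      have h3 := congrFun (congrArg Subtype.val hg) m
      simpa [Finset.sum_apply] using h3
    rw [Finset.sum_eq_single m] at h2
    · exact (mul_ne_zero hmg (hy0 m)) h2
    · intro c _ hcm
      rcases lt_or_gt_of_ne hcm with h | h
      · have : g c = 0 := by
          by_contra h'
          exact absurd (Finset.min'_le _ c (by simpa using h')) (not_le.mpr h)
        simp [this]
      · rw [hyl c m h, mul_zero]
    · simp
  have hcard : Fintype.card S = k := by
    apply le_antisymm
    · rw [← hX]
      exact hli.fintype_card_le_finrank
    · have := LinearMap.finrank_le_finrank_of_injective hf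
      rw [hX] at this
      simpa using this
  have hbij : Function.Bijective f :=
    ⟨hf, (LinearMap.injective_iff_surjective_of_finrank_eq_finrank
      (by rw [hX]; simp [hcard])).1 hf⟩
  let e : X ≃ₗ[F] (S → F) := LinearEquiv.ofBijective f hbij
  let o : Fin k ≃o S := Fintype.orderIsoFinOfCardEq S hcard
  let b : Module.Basis (Fin k) F X := (Module.Basis.ofEquivFun e).reindex o.symm.toEquiv
  let A : Matrix (Fin k) (Fin n) F := fun r => (b r : Fin n → F)
  have hA : ∀ r (c : S), A r c = if o r = c then 1 else 0 := by
    intro r c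
    have h1 : e (b r) = Pi.single (o r) 1 := by
      simp [b]
    have h2 : A r c = e (b r) c := rfl
    rw [h2, h1, Pi.single_apply]
    simp only [eq_comm]
  have hlead : ∀ r c, A.IsLeadingEntry r c → c = o r := by
    intro r c hc
    have hcS : c ∈ S := ⟨A r, (b r).2, hc.2, hc.1⟩
    by_contra h
    apply hc.2
    have := hA r ⟨c, hcS⟩
    simp only at this
    rw [this, if_neg]
    intro h'
    exact h (by rw [h'])
  have hne : ∀ r, A r ≠ 0 := fun r h0 => b.ne_zero r (Subtype.ext h0)
  refine ⟨A, ?_, ?_, ?_, ?_, ?_⟩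
  · exact b.linearIndependent.map' X.subtype (Submodule.ker_subtype X)
  · have h1 : (Set.range fun r => A r) = X.subtype '' Set.range b := by
      rw [← Set.range_comp]; rfl
    rw [h1, Submodule.span_image, b.span_eq, Submodule.map_top, Submodule.range_subtype]
  · intro r s hrs d hd
    by_contra hds
    obtain ⟨c, hc⟩ := Matrix.row_ne_zero_iff_exists_isLeadingEntry.1 (hne r)
    obtain ⟨c', hc'⟩ := Matrix.row_ne_zero_iff_exists_isLeadingEntry.1 (hne s)
    have h1 : d ≤ c := not_lt.1 fun h => hc.2 (hd c h)
    have h2 : c' ≤ d := not_lt.1 fun h => hds (hc'.1 d h)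
    have h3 : (o r : Fin n) < o s := o.strictMono hrs
    rw [← hlead r c hc, ← hlead s c' hc'] at h3
    exact absurd (h2.trans h1) (not_le.2 h3)
  · intro r c hc
    rw [hlead r c hc, hA, if_pos rfl]
  · intro s r c hsr hc
    rw [hlead r c hc, hA, if_neg]
    intro h
    exact hsr.ne (o.injective h)

/-- `RE(X)`, the matrix in reduced row echelon form of the `k`-dimensional subspace `X`. -/
noncomputable def RE (X : Submodule F (Fin n → F)) (hX : Module.finrank F X = k) :
    Matrix (Fin k) (Fin n) F :=
  (exists_isRREFOf X hX).choose

theorem RE_spec (X : Submodule F (Fin n → F)) (hX : Module.finrank F X = k) :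
    IsRREFOf X (RE X hX) :=
  (exists_isRREFOf X hX).choose_spec

open Classical in
/-- `EXT(X)`: the `(k+1) × n` array whose top row is the identifying vector `v(X)` and whose
other rows are those of `RE(X)`, the entries being written as `q`-ary digits by means of the
bijection `φ`. Columns are in displayed order, so the column with number `j` is at `n - j`. -/
noncomputable def EXT {q : ℕ} (φ : F ≃ Fin q) (X : Submodule F (Fin n → F))
    (hX : Module.finrank F X = k) : Matrix (Fin (k + 1)) (Fin n) ℕ :=
  fun r c => Fin.cases (if ∃ s, (RE X hX).IsLeadingEntry s c then 1 else 0)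
    (fun s => (φ (RE X hX s c) : ℕ)) r

end Representation

/-! ### Gaussian coefficients, the index, and the encoding algorithm -/

/-- The `q`-ary Gaussian coefficient. -/
def gauss (q n k : ℕ) : ℚ :=
  if k ≤ n then ∏ i ∈ Finset.range k, ((q : ℚ) ^ (n - i) - 1) / ((q : ℚ) ^ (k - i) - 1) else 0

section Index

variable {n k : ℕ}

/-- Entry in row `r` of the column with number `j`, the columns being numbered `n, …, 2, 1` from
left to right. -/
def col (E : Matrix (Fin (k + 1)) (Fin n) ℕ) (j : ℕ) (r : Fin (k + 1)) : ℕ :=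
  if h : 1 ≤ j ∧ j ≤ n then E r ⟨n - j, by omega⟩ else 0

/-- `v_j`, the top entry of column `j`. -/
def vEntry (E : Matrix (Fin (k + 1)) (Fin n) ℕ) (j : ℕ) : ℕ := col E j 0

/-- `w_j = v_1 + ⋯ + v_j`. -/
def weight (E : Matrix (Fin (k + 1)) (Fin n) ℕ) (j : ℕ) : ℕ := ∑ l ∈ Finset.Icc 1 j, vEntry E l

/-- `{X_j}`: the remaining `k` entries of column `j` read as a number in base `q`, with the most
significant digit on top. -/
def colValue (q : ℕ) (E : Matrix (Fin (k + 1)) (Fin n) ℕ) (j : ℕ) : ℕ :=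
  ∑ r : Fin k, col E j r.succ * q ^ (k - 1 - (r : ℕ))

/-- The index of the subspace with extended representation `E`. -/
def indexExt (q : ℕ) (E : Matrix (Fin (k + 1)) (Fin n) ℕ) : ℚ :=
  ∑ j ∈ Finset.Icc 1 n,
    ((vEntry E j : ℚ) * (q : ℚ) ^ (k - weight E (j - 1))
      + (1 - (vEntry E j : ℚ)) * ((colValue q E j : ℚ) / (q : ℚ) ^ weight E (j - 1)))
    * gauss q (n - j) (k - weight E (j - 1))

end Index

/-- The values that Encoding Algorithm A has after its `j`-th round: `v_j`, the integer `{X_j}`,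
the weight `w_j` and the rest `i_j`. -/
structure AlgAState where
  v : ℕ
  x : ℕ
  w : ℕ
  i : ℚ

/-- Round number `j` of Encoding Algorithm A. -/
def algARound (q n k j : ℕ) (s : AlgAState) : AlgAState :=
  if s.w = k then
    { v := 0, x := 0, w := s.w, i := s.i }
  else if (q : ℚ) ^ (k - s.w) * gauss q (n - j) (k - s.w) ≤ s.i then
    { v := 1, x := q ^ s.w, w := s.w + 1,
      i := s.i - (q : ℚ) ^ (k - s.w) * gauss q (n - j) (k - s.w) }
  else
    { v := 0, x := ⌊s.i / gauss q (n - j) (k - s.w)⌋₊ * q ^ s.w, w := s.w,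
      i := s.i - (⌊s.i / gauss q (n - j) (k - s.w)⌋₊ : ℚ) * gauss q (n - j) (k - s.w) }

/-- The state of Encoding Algorithm A after `j` rounds on input `i`. -/
def algA (q n k i : ℕ) : ℕ → AlgAState
  | 0 => { v := 0, x := 0, w := 0, i := i }
  | j + 1 => algARound q n k (j + 1) (algA q n k i j)

/-- The output matrix of Encoding Algorithm A: column number `j` has `v_j` on top, and below it
the `k` base-`q` digits of the integer `{X_j}`, most significant digit first. -/
def algAOutput (q n k i : ℕ) : Matrix (Fin (k + 1)) (Fin n) ℕ :=
  fun r c => Fin.cases (algA q n k i (n - c)).v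
    (fun s => (algA q n k i (n - c)).x / q ^ (k - 1 - (s : ℕ)) % q) r

/-! ### Counting digit operations

Programs act on registers and on an indirectly addressed memory, which all hold nonnegative
integers written in base `q`. Every instruction is charged (up to a constant factor) the number of
operations on single base-`q` digits that it takes when it is done digit by digit: linear in the
lengths of the integers, the addresses and the shifts involved for everything except
multiplication and division, which are charged the product of the lengths (the school methods).
Any faster multiplication has to be programmed. -/

/-- Number of base-`q` digits of `a` (one digit for `0`). -/
def len (q a : ℕ) : ℕ := Nat.log q a + 1

/-- A machine state. -/
structure State where
  reg : ℕ → ℕ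
  mem : ℕ → ℕ

/-- Value `a` is put into register `x`. -/
def State.setReg (s : State) (x a : ℕ) : State := { s with reg := Function.update s.reg x a }

/-- Instructions; the arguments are register numbers, except for the constant `c`. -/
inductive Instr where
  | const (x c : ℕ)
  | copy (x y : ℕ)
  | add (x y z : ℕ)
  | sub (x y z : ℕ)
  | mul (x y z : ℕ)
  | div (x y z : ℕ)
  | shl (x y z : ℕ)
  | shr (x y z : ℕ)
  | load (x y : ℕ)
  | store (x y : ℕ)

/-- Effect of an instruction (`sub` is truncated at `0`, and `div` is integer division). -/
def Instr.effect (q : ℕ) : Instr → State → State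
  | .const x c, s => s.setReg x c
  | .copy x y, s => s.setReg x (s.reg y)
  | .add x y z, s => s.setReg x (s.reg y + s.reg z)
  | .sub x y z, s => s.setReg x (s.reg y - s.reg z)
  | .mul x y z, s => s.setReg x (s.reg y * s.reg z)
  | .div x y z, s => s.setReg x (s.reg y / s.reg z)
  | .shl x y z, s => s.setReg x (s.reg y * q ^ s.reg z)
  | .shr x y z, s => s.setReg x (s.reg y / q ^ s.reg z)
  | .load x y, s => s.setReg x (s.mem (s.reg y))
  | .store x y, s => { s with mem := Function.update s.mem (s.reg x) (s.reg y) }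

/-- Number of digit operations charged for an instruction. -/
def Instr.cost (q : ℕ) : Instr → State → ℕ
  | .const _ c, _ => len q c
  | .copy _ y, s => len q (s.reg y)
  | .add _ y z, s => len q (s.reg y) + len q (s.reg z)
  | .sub _ y z, s => len q (s.reg y) + len q (s.reg z)
  | .mul _ y z, s => len q (s.reg y) * len q (s.reg z)
  | .div _ y z, s => len q (s.reg y) * len q (s.reg z)
  | .shl _ y z, s => len q (s.reg y) + s.reg z + len q (s.reg z)
  | .shr _ y z, s => len q (s.reg y) + len q (s.reg z)
  | .load _ y, s => len q (s.reg y) + len q (s.mem (s.reg y))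
  | .store x y, s => len q (s.reg x) + len q (s.reg y)

/-- Programs; the tests are of the form "register `x` is less than register `y`". -/
inductive Prog where
  | instr (a : Instr)
  | seq (P Q : Prog)
  | ifLt (x y : ℕ) (P Q : Prog)
  | whileLt (x y : ℕ) (P : Prog)

/-- `Runs q P s t c`: started in state `s`, program `P` halts in state `t` after `c` digit
operations on base-`q` digits. -/
inductive Runs (q : ℕ) : Prog → State → State → ℕ → Prop where
  | instr (a : Instr) (s : State) : Runs q (.instr a) s (a.effect q s) (a.cost q s)
  | seq {P Q : Prog} {s t u : State} {c d : ℕ} :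
      Runs q P s t c → Runs q Q t u d → Runs q (.seq P Q) s u (c + d)
  | if_true {x y : ℕ} {P Q : Prog} {s t : State} {c : ℕ} : s.reg x < s.reg y →
      Runs q P s t c →
      Runs q (.ifLt x y P Q) s t (len q (s.reg x) + len q (s.reg y) + c)
  | if_false {x y : ℕ} {P Q : Prog} {s t : State} {c : ℕ} : ¬ s.reg x < s.reg y →
      Runs q Q s t c →
      Runs q (.ifLt x y P Q) s t (len q (s.reg x) + len q (s.reg y) + c)
  | while_true {x y : ℕ} {P : Prog} {s t u : State} {c d : ℕ} : s.reg x < s.reg y →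
      Runs q P s t c → Runs q (.whileLt x y P) t u d →
      Runs q (.whileLt x y P) s u (len q (s.reg x) + len q (s.reg y) + c + d)
  | while_false {x y : ℕ} {P : Prog} {s : State} : ¬ s.reg x < s.reg y →
      Runs q (.whileLt x y P) s s (len q (s.reg x) + len q (s.reg y))

/-- Registers at the start: `q, n, k, i` in registers `0, 1, 2, 3`, and `0` elsewhere. -/
def inputReg (q n k i : ℕ) : ℕ → ℕ
  | 0 => q
  | 1 => n
  | 2 => k
  | 3 => i
  | _ => 0

/-- Memory holding the matrix `E` row by row, and `0` elsewhere. -/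
def matrixMem {n k : ℕ} (E : Matrix (Fin (k + 1)) (Fin n) ℕ) (a : ℕ) : ℕ :=
  if h : a < n * (k + 1) then
    E ⟨a / n, Nat.div_lt_of_lt_mul h⟩
      ⟨a % n, Nat.mod_lt _ (Nat.pos_of_ne_zero fun h0 => by simp [h0] at h)⟩
  else 0

/-- Start of the decoding: the extended representation `E` is in the memory. -/
def decodeInput (q : ℕ) {n k : ℕ} (E : Matrix (Fin (k + 1)) (Fin n) ℕ) : State :=
  { reg := inputReg q n k 0, mem := matrixMem E }

/-- Start of the encoding: the index `i` is in register `3`. -/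
def encodeInput (q n k i : ℕ) : State :=
  { reg := inputReg q n k i, mem := fun _ => 0 }

end GrassmannCoding

open GrassmannCoding

namespace GrassmannCoding

/-! ### Total correctness with a bound on the number of digit operations -/

/-! Long multiplication is avoided altogether. Neighbouring Gaussian coefficients differ by a factor
(q^a - 1)/(q^b - 1) with a, b ≤ n (`gaussNat_succ_mul`, `gaussNat_succ_succ_mul`,
`gaussNat_mul_succ`). Multiplying by q^a - 1 is a shift and a subtraction. Dividing by q^b - 1 is a
geometric series, which the product of the factors 1 + t^(2^s) sums in O(log L) shifts and additions
of numbers with L = O(k(n-k)) digits. As log L = O(log n), all rounds together cost O(n k(n-k) log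
n); the factor log log n is pure slack (`exists_const_mul_log_le`).

Decoding works modulo q^L, where q^b - 1 is a unit and the series is finite and exact
(`modRatio_ends`). The index is evaluated by a Horner scheme: with N columns left that hold m
leading entries, the register represents the partial sum J divided by [N; m] in ℤ/q^L. The next
column changes the denominator by one ratio and adds an integer. For a leading entry, Pascal's rule
turns the term of the index into +1 before the ratio and -1 after it (`DecodeInv.step_zero`,
`DecodeInv.step_one`). At the end the denominator is 1 and J < q^L, so the residue is the index.

Encoding needs integer quotients of i by a Gaussian coefficient G, so it uses a fixed-point number
T/q^P that approximates i/G from above, and sums the series in powers of q^(-b), rounding up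
(`ceilRatio_ends`). An exact change of G leaves T G - i q^P unchanged; each rounding adds at most U
= 4 L q^(2k(n-k)) to it (`approx_of_ratio`). There are at most k + 2n roundings. While the sum stays
below q^P, the floor of T/q^P is that of i/G, because i/G lies at least 1/G below the next integer
(`div_eq_of_approx`). Hence every test and every digit agrees with Algorithm A.

Reading or writing the digits of a column costs O(kn), but only the n - k columns without a leading
entry need it. -/

/-- Started in `s`, the program `P` halts after at most `B` digit operations, and the final state
satisfies `Q`. -/
def Ends (q : ℕ) (P : Prog) (s : State) (B : ℕ) (Q : State → Prop) : Prop :=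
  ∃ t c, Runs q P s t c ∧ c ≤ B ∧ Q t

namespace Ends

variable {q : ℕ} {P R : Prog} {s : State} {B B' : ℕ} {Q : State → Prop}

theorem mono {Q' : State → Prop} (h : Ends q P s B Q) (hB : B ≤ B') (hQ : ∀ t, Q t → Q' t) :
    Ends q P s B' Q' := by
  obtain ⟨t, c, h1, h2, h3⟩ := h
  exact ⟨t, c, h1, h2.trans hB, hQ t h3⟩

theorem instr {a : Instr} (hc : a.cost q s ≤ B) (hQ : Q (a.effect q s)) :
    Ends q (.instr a) s B Q :=
  ⟨_, _, Runs.instr a s, hc, hQ⟩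

theorem seq (h : Ends q P s B (fun t => Ends q R t B' Q)) :
    Ends q (.seq P R) s (B + B') Q := by
  obtain ⟨t, c, h1, h2, u, d, h3, h4, h5⟩ := h
  exact ⟨u, c + d, h1.seq h3, Nat.add_le_add h2 h4, h5⟩

theorem instr_seq {a : Instr} (hc : a.cost q s ≤ B) (h : Ends q P (a.effect q s) B' Q) :
    Ends q (.seq (.instr a) P) s (B + B') Q :=
  seq (instr hc h)

theorem ifLt {x y K : ℕ} (hK : len q (s.reg x) + len q (s.reg y) ≤ K)
    (ht : s.reg x < s.reg y → Ends q P s B Q) (hf : ¬ s.reg x < s.reg y → Ends q R s B Q) :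
    Ends q (.ifLt x y P R) s (K + B) Q := by
  by_cases h : s.reg x < s.reg y
  · obtain ⟨t, c, h1, h2, h3⟩ := ht h
    exact ⟨t, _, Runs.if_true h h1, Nat.add_le_add hK h2, h3⟩
  · obtain ⟨t, c, h1, h2, h3⟩ := hf h
    exact ⟨t, _, Runs.if_false h h1, Nat.add_le_add hK h2, h3⟩

/-- The invariant `I B s` says that `B` digit operations suffice from `s` on. -/
theorem whileLt {x y : ℕ} (I : ℕ → State → Prop)
    (hexit : ∀ B s, I B s → ¬ s.reg x < s.reg y →
      len q (s.reg x) + len q (s.reg y) ≤ B ∧ Q s)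
    (hstep : ∀ B s, I B s → s.reg x < s.reg y → ∃ B₁ B₂,
      len q (s.reg x) + len q (s.reg y) + B₁ + B₂ ≤ B ∧ Ends q P s B₁ (I B₂)) :
    ∀ B s, I B s → Ends q (.whileLt x y P) s B Q := by
  intro B
  induction B using Nat.strong_induction_on with
  | _ B ih =>
    intro s hs
    by_cases h : s.reg x < s.reg y
    · obtain ⟨B₁, B₂, hB, t, c, h1, h2, h3⟩ := hstep B s hs h
      -- Every test costs at least one digit operation, so the budget strictly decreases; this is
      -- what proves termination.
      have hlt : B₂ < B := by
        have : 1 ≤ len q (s.reg x) := by simp [len]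
        omega
      obtain ⟨u, d, h4, h5, h6⟩ := ih B₂ hlt t h3
      exact ⟨u, _, Runs.while_true h h1 h4, by omega, h6⟩
    · obtain ⟨h1, h2⟩ := hexit B s hs h
      exact ⟨s, _, Runs.while_false h, h1, h2⟩

/-- At most `f` rounds, each of at most `K` digit operations including its test. -/
theorem whileLt_fuel {x y K K' : ℕ} (I : ℕ → State → Prop)
    (hlen : ∀ f s, I f s → len q (s.reg x) + len q (s.reg y) ≤ K')
    (hexit : ∀ f s, I f s → ¬ s.reg x < s.reg y → Q s)
    (hstep : ∀ f s, I f s → s.reg x < s.reg y → ∃ g, f = g + 1 ∧ Ends q P s K (I g))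
    (f : ℕ) (s : State) (hs : I f s) (hB : f * (K + K') + K' ≤ B) :
    Ends q (.whileLt x y P) s B Q := by
  refine whileLt (fun B s => ∃ f, I f s ∧ f * (K + K') + K' ≤ B) ?_ ?_ B s ⟨f, hs, hB⟩
  · rintro B s ⟨f, hs, hB⟩ h
    exact ⟨(hlen f s hs).trans (by omega), hexit f s hs h⟩
  · rintro B s ⟨f, hs, hB⟩ h
    obtain ⟨g, rfl, hg⟩ := hstep f s hs h
    refine ⟨K, g * (K + K') + K', ?_, hg.mono le_rfl fun t ht => ⟨g, ht, le_rfl⟩⟩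
    have := hlen _ s hs
    rw [Nat.succ_mul] at hB
    omega

end Ends

/-! ### Straight-line code. -/

/-- A nonempty sequence of instructions. -/
def block : Instr → List Instr → Prog
  | a, [] => .instr a
  | a, b :: l => .seq (.instr a) (block b l)

/-- Effect of a sequence of instructions. -/
def effects (q : ℕ) : List Instr → State → State
  | [], s => s
  | a :: l, s => effects q l (a.effect q s)

/-- Every instruction of the sequence is charged at most `K` digit operations. -/
def CostsLe (q K : ℕ) : List Instr → State → Prop
  | [], _ => True
  | a :: l, s => a.cost q s ≤ K ∧ CostsLe q K l (a.effect q s)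

theorem Ends.block {q K : ℕ} {Q : State → Prop} :
    ∀ {a : Instr} {l : List Instr} {s : State}, CostsLe q K (a :: l) s →
      Q (effects q (a :: l) s) → Ends q (block a l) s ((l.length + 1) * K) Q
  | a, [], s, h, hQ => Ends.instr (by simpa using h.1) hQ
  | a, b :: l, s, h, hQ => by
    refine (Ends.instr_seq h.1 (Ends.block h.2 hQ)).mono ?_ fun _ h => h
    rw [List.length_cons, Nat.succ_mul (l.length + 1)]
    omega

/-! ### Lengths -/

theorem len_le_of_lt_pow {q a B : ℕ} (hB : 0 < B) (h : a < q ^ B) : len q a ≤ B :=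
  Nat.log_lt_of_lt_pow' hB.ne' h

theorem lt_pow_of_le {q a b : ℕ} (hq : 2 ≤ q) (h : a ≤ b) : a < q ^ b :=
  (Nat.lt_pow_self hq).trans_le (Nat.pow_le_pow_right (by omega) h)

theorem len_le_of_le {q a B : ℕ} (hq : 2 ≤ q) (hB : 0 < B) (h : a ≤ B) : len q a ≤ B :=
  len_le_of_lt_pow hB (lt_pow_of_le hq h)

theorem len_zero (q : ℕ) : len q 0 = 1 := by simp [len]

theorem len_one (q : ℕ) : len q 1 = 1 := by simp [len]

/-! ### Registers from 20 on as scratch space of the subroutines. -/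

/-- `t` has the same memory as `s`, and the same contents of the registers below `20`. -/
def SameLow (s t : State) : Prop := t.mem = s.mem ∧ ∀ r < 20, t.reg r = s.reg r

theorem SameLow.trans {s t u : State} (h : SameLow s t) (h' : SameLow t u) : SameLow s u :=
  ⟨h'.1.trans h.1, fun r hr => (h'.2 r hr).trans (h.2 r hr)⟩

theorem SameLow.setReg {s t : State} (h : SameLow s t) {x : ℕ} (hx : 20 ≤ x) (a : ℕ) :
    SameLow s (t.setReg x a) :=
  ⟨h.1, fun r hr => by simp [State.setReg, h.2 r hr, show r ≠ x by omega]⟩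

theorem SameLow.refl (s : State) : SameLow s s := ⟨rfl, fun _ _ => rfl⟩

/-! ### Gaussian coefficients as natural numbers -/

/-- The Gaussian coefficient as a natural number, by the recursion of Pascal's triangle. -/
def gaussNat (q : ℕ) : ℕ → ℕ → ℕ
  | _, 0 => 1
  | 0, _ + 1 => 0
  | N + 1, m + 1 => gaussNat q N m + q ^ (m + 1) * gaussNat q N (m + 1)

@[simp] theorem gaussNat_zero (q N : ℕ) : gaussNat q N 0 = 1 := by
  cases N <;> rfl

theorem gaussNat_succ_succ (q N m : ℕ) :
    gaussNat q (N + 1) (m + 1) = gaussNat q N m + q ^ (m + 1) * gaussNat q N (m + 1) := rfl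

theorem gaussNat_eq_zero (q : ℕ) : ∀ {N m : ℕ}, N < m → gaussNat q N m = 0
  | 0, m + 1, _ => rfl
  | N + 1, m + 1, h => by
    rw [gaussNat_succ_succ, gaussNat_eq_zero q (by omega : N < m),
      gaussNat_eq_zero q (by omega : N < m + 1), mul_zero,
      add_zero]

theorem gaussNat_pos {q : ℕ} : ∀ {N m : ℕ}, m ≤ N → 0 < gaussNat q N m
  | N, 0, _ => by simp
  | N + 1, m + 1, h => by
    rw [gaussNat_succ_succ]
    have := gaussNat_pos (q := q) (by omega : m ≤ N)
    omega

theorem gaussNat_self (q N : ℕ) : gaussNat q N N = 1 := by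
  induction N with
  | zero => rfl
  | succ N ih => rw [gaussNat_succ_succ, ih, gaussNat_eq_zero q (by omega : N < N + 1), mul_zero,
      add_zero]

/-- The product formula with cleared denominators, over ℤ so that the subtractions are genuine; the
ratio identities below follow by comparing two instances and cancelling the product. The boundary m
= N + 1, where both sides vanish, is included because `gaussNat_mul_succ` needs it at m = N. -/
theorem gaussNat_mul_prod (q : ℕ) : ∀ {N m : ℕ}, m ≤ N + 1 →
    (gaussNat q N m : ℤ) * ∏ i ∈ Finset.range m, ((q : ℤ) ^ (i + 1) - 1)
      = ∏ i ∈ Finset.range m, ((q : ℤ) ^ (N - i) - 1)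
  | N, 0, _ => by simp
  | 0, m + 1, h => by
    obtain rfl : m = 0 := by omega
    simp [gaussNat]
  | N + 1, m + 1, h => by
    rw [gaussNat_succ_succ, Finset.prod_range_succ' (fun i => (q : ℤ) ^ (N + 1 - i) - 1)]
    simp only [Nat.add_sub_add_right]
    rw [← gaussNat_mul_prod q (by omega : m ≤ N + 1)]
    by_cases hm : m ≤ N
    · have h2 := gaussNat_mul_prod q (by omega : m + 1 ≤ N + 1)
      have h3 := gaussNat_mul_prod q (by omega : m ≤ N + 1)
      rw [Finset.prod_range_succ (fun i => (q : ℤ) ^ (N - i) - 1), ← h3] at h2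
      push_cast
      rw [add_mul, mul_assoc, mul_assoc, h2, Finset.prod_range_succ]
      have h4 : (q : ℤ) ^ (N + 1) = q ^ (m + 1) * q ^ (N - m) := by
        rw [← pow_add]; congr 1; omega
      rw [h4]
      ring
    · have hm : m = N + 1 := by omega
      subst hm
      simp [gaussNat_eq_zero]

theorem prod_pow_sub_one_pos {q : ℕ} (hq : 2 ≤ q) (m : ℕ) :
    0 < ∏ i ∈ Finset.range m, ((q : ℤ) ^ (i + 1) - 1) := by
  refine Finset.prod_pos fun i _ => ?_
  have : (1 : ℤ) < (q : ℤ) ^ (i + 1) := one_lt_pow₀ (by exact_mod_cast hq) (by omega)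
  omega

theorem gauss_eq_gaussNat {q : ℕ} (hq : 2 ≤ q) (n k : ℕ) : gauss q n k = gaussNat q n k := by
  unfold gauss
  split_ifs with h
  · rw [Finset.prod_div_distrib,
      ← Finset.prod_range_reflect (fun i => ((q : ℚ) ^ (k - i) - 1)),
      div_eq_iff]
    · have h1 := gaussNat_mul_prod q (by omega : k ≤ n + 1)
      have h2 : ∏ j ∈ Finset.range k, ((q : ℚ) ^ (k - (k - 1 - j)) - 1)
          = ∏ i ∈ Finset.range k, ((q : ℚ) ^ (i + 1) - 1) := by
        refine Finset.prod_congr rfl fun i hi => ?_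
        have := Finset.mem_range.1 hi
        congr 2
        omega
      rw [h2]
      exact_mod_cast h1.symm
    · refine Finset.prod_ne_zero_iff.2 fun i hi => ?_
      have := Finset.mem_range.1 hi
      have : (1 : ℚ) < (q : ℚ) ^ (k - (k - 1 - i)) :=
        one_lt_pow₀ (by exact_mod_cast hq) (by omega)
      exact (sub_pos.2 this).ne'
  · simp [gaussNat_eq_zero q (by omega : n < k)]

/-- `[N+1; m+1] (q^(m+1) - 1) = [N; m] (q^(N+1) - 1)`. -/
theorem gaussNat_succ_succ_mul {q : ℕ} (hq : 2 ≤ q) {N m : ℕ} (h : m ≤ N) :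
    (gaussNat q (N + 1) (m + 1) : ℤ) * ((q : ℤ) ^ (m + 1) - 1)
      = gaussNat q N m * ((q : ℤ) ^ (N + 1) - 1) := by
  refine mul_right_cancel₀ (prod_pow_sub_one_pos hq m).ne' ?_
  have h1 := gaussNat_mul_prod q (by omega : m + 1 ≤ N + 1 + 1)
  rw [Finset.prod_range_succ, Finset.prod_range_succ'] at h1
  simp only [Nat.add_sub_add_right, Nat.sub_zero] at h1
  rw [← gaussNat_mul_prod q (by omega : m ≤ N + 1)] at h1
  linear_combination h1

/-- `[N+1; m] (q^(N+1-m) - 1) = [N; m] (q^(N+1) - 1)`. -/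
theorem gaussNat_succ_mul {q : ℕ} (hq : 2 ≤ q) {N m : ℕ} (h : m ≤ N) :
    (gaussNat q (N + 1) m : ℤ) * ((q : ℤ) ^ (N + 1 - m) - 1)
      = gaussNat q N m * ((q : ℤ) ^ (N + 1) - 1) := by
  refine mul_right_cancel₀ (prod_pow_sub_one_pos hq m).ne' ?_
  have h1 := gaussNat_mul_prod q (by omega : m ≤ N + 1 + 1)
  have h2 := gaussNat_mul_prod q (by omega : m ≤ N + 1)
  have h3 := Finset.prod_range_succ (fun i => (q : ℤ) ^ (N + 1 - i) - 1) m
  rw [Finset.prod_range_succ'] at h3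
  simp only [Nat.add_sub_add_right, Nat.sub_zero] at h3
  rw [← h1, ← h2] at h3
  linear_combination -h3

/-- `[N; m+1] (q^(m+1) - 1) = [N; m] (q^(N-m) - 1)`. -/
theorem gaussNat_mul_succ {q : ℕ} (hq : 2 ≤ q) {N m : ℕ} (h : m ≤ N) :
    (gaussNat q N (m + 1) : ℤ) * ((q : ℤ) ^ (m + 1) - 1)
      = gaussNat q N m * ((q : ℤ) ^ (N - m) - 1) := by
  refine mul_right_cancel₀ (prod_pow_sub_one_pos hq m).ne' ?_
  have h1 := gaussNat_mul_prod q (by omega : m + 1 ≤ N + 1)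
  have h2 := gaussNat_mul_prod q (by omega : m ≤ N + 1)
  rw [Finset.prod_range_succ, Finset.prod_range_succ (fun i => (q : ℤ) ^ (N - i) - 1)] at h1
  rw [← h2] at h1
  linear_combination h1

/-- The factor 2 in the exponent is crude but makes the induction work: both terms of Pascal's rule
are at most q^(e-1), where e is the new exponent, and 2 ≤ q absorbs the sum. -/
theorem gaussNat_le_pow {q : ℕ} (hq : 2 ≤ q) :
    ∀ {N m : ℕ}, m ≤ N → gaussNat q N m ≤ q ^ (2 * (m * (N - m)))
  | N, 0, _ => by simp
  | N + 1, m + 1, h => by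
    have h1 := gaussNat_le_pow hq (by omega : m ≤ N)
    rcases Nat.lt_or_ge N (m + 1) with h2 | h2
    · rw [gaussNat_succ_succ, gaussNat_eq_zero q h2]
      have : N = m := by omega
      subst this
      simpa using h1
    · have h3 := gaussNat_le_pow hq h2
      obtain ⟨d, rfl⟩ := Nat.exists_eq_add_of_le h2
      have e1 : m + 1 + d - m = d + 1 := by omega
      have e2 : m + 1 + d - (m + 1) = d := by omega
      have e3 : m + 1 + d + 1 - (m + 1) = d + 1 := by omega
      rw [e1] at h1
      rw [e2] at h3
      rw [gaussNat_succ_succ, e3]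
      have e4 : 2 * ((m + 1) * (d + 1)) = (2 * m * d + 2 * m + 2 * d + 1) + 1 := by ring
      rw [e4, pow_succ]
      have h4 : gaussNat q (m + 1 + d) m ≤ q ^ (2 * m * d + 2 * m + 2 * d + 1) :=
        h1.trans (Nat.pow_le_pow_right (by omega) (by nlinarith))
      have h5 : q ^ (m + 1) * gaussNat q (m + 1 + d) (m + 1)
          ≤ q ^ (2 * m * d + 2 * m + 2 * d + 1) := by
        refine (Nat.mul_le_mul_left _ h3).trans ?_
        rw [← pow_add]
        exact Nat.pow_le_pow_right (by omega) (by nlinarith)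
      calc _ ≤ q ^ (2 * m * d + 2 * m + 2 * d + 1) + q ^ (2 * m * d + 2 * m + 2 * d + 1) :=
            Nat.add_le_add h4 h5
        _ = q ^ (2 * m * d + 2 * m + 2 * d + 1) * 2 := (mul_two _).symm
        _ ≤ _ := Nat.mul_le_mul_left _ hq

/-- The conditions m ≤ k and N - m ≤ n - k hold for the coefficients met by the encoding, so one
bound serves them all. -/
theorem gaussNat_le_pow_of_le {q : ℕ} (hq : 2 ≤ q) {N m n k : ℕ} (hm : m ≤ N) (hk : m ≤ k)
    (hn : N + k ≤ n + m) : gaussNat q N m ≤ q ^ (2 * (k * (n - k))) :=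
  (gaussNat_le_pow hq hm).trans <| Nat.pow_le_pow_right (by omega) <|
    Nat.mul_le_mul_left _ (Nat.mul_le_mul hk (by omega))

/-! ### Multiplication by `(q^a - 1) / (q^b - 1)` -/

/-- Register `20` is multiplied by `(q^a - 1) / (q^b - 1)` modulo `q^L`, where `a`, `b`, `L` and
`q^L` are in registers `21`, `22`, `10` and `11`. The inverse of `1 - q^b` is computed as
`(1 + q^b) (1 + q^(2b)) (1 + q^(4b)) ⋯`. -/
def modRatio : Prog :=
  -- Adding q^L first keeps the truncated subtraction exact; register `20` starts as -x (q^a - 1)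
  -- modulo q^L.
  .seq (block (.shl 23 20 21) [.shr 24 23 10, .shl 24 24 10, .sub 23 23 24, .add 20 20 11,
      .sub 20 20 23, .shr 23 20 10, .shl 23 23 10, .sub 20 20 23, .copy 25 22])
    (.whileLt 25 10 (block (.shl 23 20 25) [.add 20 20 23, .shr 23 20 10, .shl 23 23 10,
      .sub 20 20 23, .add 25 25 25]))

theorem sub_div_mul_self (a b : ℕ) : a - a / b * b = a % b := by
  have := Nat.div_add_mod' a b
  omega

set_option maxHeartbeats 1000000 in
-- The loop keeps y (q^b - 1) ≡ x (q^a - 1)(1 - q^sh). Multiplying y by 1 + q^sh doubles sh, and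
-- once sh ≥ L the power q^sh vanishes modulo q^L. Starting from sh = b ≥ 1, f doublings suffice
-- since L ≤ 2^f.
theorem modRatio_ends {q L x a b f : ℕ} {s : State} (hq : 2 ≤ q)
    (h10 : s.reg 10 = L) (h11 : s.reg 11 = q ^ L) (h20 : s.reg 20 = x) (h21 : s.reg 21 = a)
    (h22 : s.reg 22 = b) (hx : x ≤ q ^ L) (ha : a ≤ L) (hb : 1 ≤ b) (hbL : b ≤ L)
    (hf : L ≤ 2 ^ f) :
    Ends q modRatio s ((f + 2) * (100 * L)) (fun t => SameLow s t ∧ t.reg 20 < q ^ L ∧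
      (t.reg 20 : ℤ) * ((q : ℤ) ^ b - 1) ≡ x * ((q : ℤ) ^ a - 1) [ZMOD (q : ℤ) ^ L]) := by
  have hL : 1 ≤ L := hb.trans hbL
  have hq0 : 0 < q := by omega
  have hpos : 0 < q ^ L := Nat.pow_pos hq0
  have hlen : ∀ v, v < q ^ (4 * L) → len q v ≤ 4 * L := fun v => len_le_of_lt_pow (by omega)
  have hpow : q ^ (4 * L) = q ^ L * q ^ L * q ^ L * q ^ L := by
    rw [← pow_add, ← pow_add, ← pow_add]; congr 1; ring
  have h2L : 2 ≤ q ^ L := hq.trans (Nat.le_self_pow (by omega) q)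
  have h4 : 2 * (q ^ L * q ^ L) < q ^ (4 * L) := by
    rw [hpow, mul_assoc (q ^ L * q ^ L)]
    nlinarith [Nat.mul_le_mul h2L h2L, Nat.mul_pos hpos hpos]
  have h4' : 2 * q ^ L ≤ q ^ L * q ^ L := Nat.mul_le_mul_right _ h2L
  have hsmall : ∀ v, v ≤ 2 * (q ^ L * q ^ L) → len q v ≤ 4 * L := fun v hv => hlen v (by omega)
  have hlenle : ∀ v, v ≤ 4 * L → len q v ≤ 4 * L := fun v => len_le_of_le hq (by omega)
  set Z : ℤ := x * ((q : ℤ) ^ a - 1) with hZ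
  have hmod : ∀ v : ℕ, ((v % q ^ L : ℕ) : ℤ) ≡ v [ZMOD (q : ℤ) ^ L] := fun v => by
    push_cast; exact Int.mod_modEq _ _
  have hdm : ∀ v : ℕ, v / q ^ L * q ^ L ≤ v := fun v => Nat.div_mul_le_self _ _
  have hd : ∀ v : ℕ, v / q ^ L ≤ v := fun v => Nat.div_le_self _ _
  unfold modRatio
  refine Ends.mono (Ends.seq (B := 10 * (10 * L)) (B' := f * (60 * L + 8 * L) + 8 * L)
    (Ends.block (K := 10 * L) ?_ ?_)) (by nlinarith) (fun _ h => h)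
  · have e1 : x * q ^ a ≤ q ^ L * q ^ L :=
      Nat.mul_le_mul hx (Nat.pow_le_pow_right hq0 ha)
    have l1 := hsmall (x * q ^ a) (by omega)
    have l2 := hsmall (x * q ^ a / q ^ L) ((hd _).trans (by omega))
    have l3 := hsmall (x * q ^ a / q ^ L * q ^ L) ((hdm _).trans (by omega))
    have l4 := hsmall x (by omega)
    have l5 := hsmall (q ^ L) (by omega)
    have l6 := hsmall (x + q ^ L) (by omega)
    have l7 := hsmall (x * q ^ a % q ^ L) ((Nat.mod_le _ _).trans (by omega))
    have e2 : x + q ^ L - x * q ^ a % q ^ L ≤ 2 * (q ^ L * q ^ L) :=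
      (Nat.sub_le _ _).trans (by omega)
    have l8 := hsmall (x + q ^ L - x * q ^ a % q ^ L) e2
    have l9 := hsmall ((x + q ^ L - x * q ^ a % q ^ L) / q ^ L) ((hd _).trans e2)
    have l10 := hsmall ((x + q ^ L - x * q ^ a % q ^ L) / q ^ L * q ^ L) ((hdm _).trans e2)
    have l11 := hlenle a (by omega)
    have l12 := hlenle b (by omega)
    have l13 := hlenle L (by omega)
    simp only [CostsLe, Instr.cost, Instr.effect, State.setReg, Function.update_apply,
      ↓reduceIte, Nat.reduceEqDiff, and_true, h10, h11, h20, h21, h22, sub_div_mul_self]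
    omega
  · refine Ends.whileLt_fuel (K := 60 * L) (K' := 8 * L) (fun g t => SameLow s t ∧
      t.reg 20 < q ^ L ∧ ∃ sh, t.reg 25 = sh ∧ L ≤ sh * 2 ^ g ∧ 1 ≤ sh ∧ sh ≤ 2 * L ∧
        (t.reg 20 : ℤ) * ((q : ℤ) ^ b - 1) ≡ Z * (1 - (q : ℤ) ^ sh) [ZMOD (q : ℤ) ^ L])
      ?_ ?_ ?_ f _ ?_ le_rfl
    · rintro g t ⟨hs, hy, sh, h25, h1, h2, h3, h5⟩
      have := hlenle sh (by omega)
      have := hlenle L (by omega)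
      rw [h25, hs.2 10 (by norm_num), h10]
      omega
    · rintro g t ⟨hs, hy, sh, h25, h1, h2, h3, h5⟩ hlt
      rw [h25, hs.2 10 (by norm_num), h10] at hlt
      refine ⟨hs, hy, h5.trans ?_⟩
      have h0 : (q : ℤ) ^ sh ≡ 0 [ZMOD (q : ℤ) ^ L] :=
        (Int.modEq_zero_iff_dvd).2 (pow_dvd_pow _ (by omega))
      simpa using (Int.ModEq.refl Z).mul ((Int.ModEq.refl 1).sub h0)
    · rintro g t ⟨hs, hy, sh, h25, h1, h2, h3, h5⟩ hlt
      rw [h25, hs.2 10 (by norm_num), h10] at hlt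
      have h10' : t.reg 10 = L := (hs.2 10 (by norm_num)).trans h10
      obtain ⟨y, hy20⟩ : ∃ y, t.reg 20 = y := ⟨_, rfl⟩
      rw [hy20] at hy h5
      obtain ⟨g, rfl⟩ : ∃ g', g = g' + 1 := by
        refine Nat.exists_eq_succ_of_ne_zero fun h0 => ?_
        rw [h0, pow_zero, mul_one] at h1
        omega
      refine ⟨g, rfl, Ends.mono (Ends.block (K := 10 * L) ?_ ?_)
        (by simp only [List.length_cons, List.length_nil]; omega) fun _ h => h⟩
      · have e1 : y * q ^ sh ≤ q ^ L * q ^ L :=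
          Nat.mul_le_mul hy.le (Nat.pow_le_pow_right hq0 hlt.le)
        have l1 := hsmall y (by omega)
        have l2 := hsmall (y * q ^ sh) (by omega)
        have l3 := hsmall (y + y * q ^ sh) (by omega)
        have l4 := hsmall ((y + y * q ^ sh) / q ^ L) ((hd _).trans (by omega))
        have l5 := hsmall ((y + y * q ^ sh) / q ^ L * q ^ L) ((hdm _).trans (by omega))
        have l6 := hlenle sh (by omega)
        have l7 := hlenle L (by omega)
        simp only [CostsLe, Instr.cost, Instr.effect, State.setReg, Function.update_apply,
          ↓reduceIte, Nat.reduceEqDiff, and_true, h10', h25, hy20, sub_div_mul_self]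
        omega
      · refine ⟨?_, ?_, sh + sh, ?_, ?_, by omega, by omega, ?_⟩
        · simp only [effects, Instr.effect]
          repeat' first | exact hs | refine SameLow.setReg ?_ (by norm_num) _
        · simp only [effects, Instr.effect, State.setReg, Function.update_apply,
            ↓reduceIte, Nat.reduceEqDiff, h10', h25, hy20, sub_div_mul_self]
          exact Nat.mod_lt _ hpos
        · simp only [effects, Instr.effect, State.setReg, Function.update_apply,
            ↓reduceIte, Nat.reduceEqDiff, h25]
        · rw [pow_succ] at h1; linarith
        · simp only [effects, Instr.effect, State.setReg, Function.update_apply,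
            ↓reduceIte, Nat.reduceEqDiff, h10', h25, hy20, sub_div_mul_self]
          refine ((hmod _).mul_right _).trans ?_
          have h6 := h5.mul_right (1 + (q : ℤ) ^ sh)
          push_cast
          rw [pow_add]
          convert h6 using 1 <;> ring
    · refine ⟨?_, ?_, b, ?_, ?_, hb, by omega, ?_⟩
      · simp only [effects, Instr.effect]
        repeat' first | exact SameLow.refl s | refine SameLow.setReg ?_ (by norm_num) _
      · simp only [effects, Instr.effect, State.setReg, Function.update_apply,
          ↓reduceIte, Nat.reduceEqDiff, h10, h11, h20, h21, sub_div_mul_self]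
        exact Nat.mod_lt _ hpos
      · simp only [effects, Instr.effect, State.setReg, Function.update_apply,
          ↓reduceIte, Nat.reduceEqDiff, h22]
      · nlinarith
      · simp only [effects, Instr.effect, State.setReg, Function.update_apply,
          ↓reduceIte, Nat.reduceEqDiff, h10, h11, h20, h21, sub_div_mul_self]
        have hle : x * q ^ a % q ^ L ≤ x + q ^ L := (Nat.mod_lt _ hpos).le.trans (by omega)
        have h7 : ((x + q ^ L - x * q ^ a % q ^ L : ℕ) : ℤ) ≡ -Z [ZMOD (q : ℤ) ^ L] := by
          rw [Nat.cast_sub hle, hZ]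
          have h8 := hmod (x * q ^ a)
          have h9 : ((x + q ^ L : ℕ) : ℤ) ≡ x [ZMOD (q : ℤ) ^ L] := by
            push_cast; simp [Int.ModEq]
          refine (h9.sub h8).trans ?_
          push_cast
          ring_nf
          rfl
        have h8 := ((hmod _).trans h7).mul_right ((q : ℤ) ^ b - 1)
        convert h8 using 1
        ring

/-- Register `20` is multiplied by `(q^a - 1) / (q^b - 1)`, rounded up, where `a`, `b` and a bound
`L` for the length of the product are in registers `21`, `22` and `10`, and `1` is in
register `12`. -/
def ceilRatio : Prog :=
  .seq (block (.shl 23 20 21) [.sub 20 23 20, .shr 20 20 22, .add 20 20 12, .copy 25 22])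
    (.seq (.whileLt 25 10 (block (.shr 23 20 25) [.add 20 20 23, .add 20 20 12, .add 25 25 25]))
      (.instr (.add 20 20 12)))

/-! ### Error bounds for the rounded-up geometric series, with β = q^b - 1, Q = q^sh, u the integer
part of y/Q. -/

section GeometricSeries

variable {β Q z y u sh : ℤ}

/-- (1 - 1/Q)(1 + 1/Q) = 1 - 1/Q², and y + u + 1 ≥ y (1 + 1/Q): rounding up keeps the lower bound
free of error terms. -/
theorem geom_low (hβ : 0 ≤ β) (hQ : 0 ≤ Q) (h : z * (Q - 1) ≤ y * β * Q)
    (hu : y ≤ (u + 1) * Q) : z * (Q * Q - 1) ≤ (y + u + 1) * β * (Q * Q) := by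
  have e1 := mul_le_mul_of_nonneg_right h (by omega : 0 ≤ Q + 1)
  have e2 := mul_le_mul_of_nonneg_left hu (mul_nonneg hβ hQ)
  linarith

/-- The factor 1 + 1/Q ≤ 2 at most doubles the error 2 sh - 1, and rounding adds one unit: 2(2 sh -
1) + 1 = 2(2 sh) - 1. So the error grows only as fast as sh. -/
theorem geom_up (hβ : 0 ≤ β) (hQ : 1 ≤ Q) (hsh : 1 ≤ sh)
    (h : y * β * Q ≤ z * (Q - 1) + (2 * sh - 1) * β * Q) (hu : u * Q ≤ y) :
    (y + u + 1) * β * (Q * Q) ≤ z * (Q * Q - 1) + (2 * (sh + sh) - 1) * β * (Q * Q) := by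
  have e1 := mul_le_mul_of_nonneg_right h (by omega : 0 ≤ Q + 1)
  have e2 := mul_le_mul_of_nonneg_left hu (mul_nonneg hβ (by omega : 0 ≤ Q))
  have e3 := mul_le_mul_of_nonneg_left hQ
    (mul_nonneg (by omega : 0 ≤ 2 * sh - 1) (mul_nonneg hβ (by omega : 0 ≤ Q)))
  linarith

/-- Serves only to bound the length of the register during the loop. -/
theorem geom_bound (hβ : 1 ≤ β) (hz : 0 ≤ z) (hQ : 0 < Q)
    (h : y * β * Q ≤ z * (Q - 1) + (2 * sh - 1) * β * Q) : y ≤ z + (2 * sh - 1) := by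
  by_contra hlt
  have h1 : z + (2 * sh - 1) + 1 ≤ y := by omega
  have e1 := mul_le_mul_of_nonneg_right h1 (mul_nonneg (by omega : 0 ≤ β) hQ.le)
  have e2 := mul_le_mul_of_nonneg_right hβ (mul_nonneg hz hQ.le)
  have e3 := mul_pos (by omega : 0 < β) hQ
  linarith

/-- The neglected tail z/Q is less than 1 ≤ β, so one more unit restores z as a lower bound; the
units then add up to at most 2 sh ≤ 4 L. -/
theorem geom_final {L : ℤ} (hβ : 1 ≤ β) (hz : 0 ≤ z) (hQ : z < Q) (hL : sh ≤ 2 * L)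
    (h : z * (Q - 1) ≤ y * β * Q)
    (h' : y * β * Q ≤ z * (Q - 1) + (2 * sh - 1) * β * Q) :
    z ≤ (y + 1) * β ∧ (y + 1) * β ≤ z + 4 * L * β := by
  have hQ0 : 0 < Q := by omega
  have e1 := mul_le_mul_of_nonneg_right hβ hQ0.le
  have e2 := mul_le_mul_of_nonneg_right hL (mul_nonneg (by omega : 0 ≤ β) hQ0.le)
  constructor
  · refine le_of_mul_le_mul_right (a := Q) ?_ hQ0
    linarith
  · refine le_of_mul_le_mul_right (a := Q) ?_ hQ0
    linarith

end GeometricSeries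

set_option maxHeartbeats 1000000 in
-- With z = x (q^a - 1), the quotient z/(q^b - 1) is z q^(-b) times the product of the factors 1 +
-- q^(-2^s b). Every stage rounds up, so the result never falls below the quotient. The assumption
-- on x q^a gives z < q^L, which makes the series negligible beyond exponent L.
theorem ceilRatio_ends {q L x a b f : ℕ} {s : State} (hq : 2 ≤ q)
    (h10 : s.reg 10 = L) (h12 : s.reg 12 = 1) (h20 : s.reg 20 = x) (h21 : s.reg 21 = a)
    (h22 : s.reg 22 = b) (hx : x * q ^ a < q ^ L) (ha : a ≤ L) (hb : 1 ≤ b) (hbL : b ≤ L)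
    (hf : L ≤ 2 ^ f) :
    Ends q ceilRatio s ((f + 2) * (100 * L)) (fun t => SameLow s t ∧
      (x : ℤ) * ((q : ℤ) ^ a - 1) ≤ t.reg 20 * ((q : ℤ) ^ b - 1) ∧
      t.reg 20 * ((q : ℤ) ^ b - 1) ≤ x * ((q : ℤ) ^ a - 1) + 4 * L * ((q : ℤ) ^ b - 1)) := by
  have hL : 1 ≤ L := hb.trans hbL
  have hq0 : 0 < q := by omega
  have hpos : 0 < q ^ L := Nat.pow_pos hq0
  have hlenle : ∀ v, v ≤ 4 * L → len q v ≤ 4 * L := fun v => len_le_of_le hq (by omega)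
  have hLL : L + 1 ≤ q ^ L := lt_pow_of_le hq le_rfl
  have h2L : 2 ≤ q ^ L := by omega
  obtain ⟨z, hz⟩ : ∃ z, x * q ^ a - x = z := ⟨_, rfl⟩
  have hqa : 1 ≤ q ^ a := Nat.pow_pos hq0
  have hxa : x ≤ x * q ^ a := Nat.le_mul_of_pos_right x hqa
  have hzZ : (x : ℤ) * ((q : ℤ) ^ a - 1) = z := by
    rw [← hz, Nat.cast_sub hxa]; push_cast; ring
  have hzL : z < q ^ L := by omega
  have hsmall : ∀ v, v ≤ 2 * (q ^ L + 4 * L) → len q v ≤ 8 * L := fun v hv => by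
    refine len_le_of_lt_pow (by omega) ?_
    have h1 : q ^ (8 * L) = q ^ L * q ^ (7 * L) := by rw [← pow_add]; congr 1; omega
    have h2 : 2 ^ 7 ≤ q ^ (7 * L) :=
      (Nat.pow_le_pow_left hq 7).trans (Nat.pow_le_pow_right hq0 (by omega))
    rw [h1]
    nlinarith [Nat.mul_le_mul_left (q ^ L) h2]
  rw [hzZ]
  set β : ℤ := (q : ℤ) ^ b - 1 with hβ
  have hβ1 : 1 ≤ β := by
    have : (1 : ℤ) < (q : ℤ) ^ b := one_lt_pow₀ (by exact_mod_cast hq) (by omega)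
    omega
  unfold ceilRatio
  refine Ends.mono (Ends.seq (B := 5 * (20 * L)) (B' := f * (80 * L + 16 * L) + 16 * L + 10 * L)
    (Ends.block (K := 20 * L) ?_ ?_)) (by nlinarith) (fun _ h => h)
  · have l1 := hsmall x (by omega)
    have l2 := hsmall (x * q ^ a) (by omega)
    have l3 := hsmall z (by omega)
    have l4 := hsmall (z / q ^ b) ((Nat.div_le_self _ _).trans (by omega))
    have l5 := hlenle a (by omega)
    have l6 := hlenle b (by omega)
    simp only [CostsLe, Instr.cost, Instr.effect, State.setReg, Function.update_apply,
      ↓reduceIte, Nat.reduceEqDiff, and_true, h12, h20, h21, h22, hz, len_one]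
    omega
  · refine Ends.seq (Ends.whileLt_fuel (K := 80 * L) (K' := 16 * L) (fun g t => SameLow s t ∧
      t.reg 20 ≤ q ^ L + 4 * L ∧ ∃ sh, t.reg 25 = sh ∧ L ≤ sh * 2 ^ g ∧ 1 ≤ sh ∧ sh ≤ 2 * L ∧
        (z : ℤ) * ((q : ℤ) ^ sh - 1) ≤ t.reg 20 * β * (q : ℤ) ^ sh ∧
        t.reg 20 * β * (q : ℤ) ^ sh
          ≤ z * ((q : ℤ) ^ sh - 1) + (2 * sh - 1) * β * (q : ℤ) ^ sh)
      ?_ ?_ ?_ f _ ?_ le_rfl)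
    · rintro g t ⟨hs, hy, sh, h25, h1, h2, h3, h5⟩
      have := hlenle sh (by omega)
      have := hlenle L (by omega)
      rw [h25, hs.2 10 (by norm_num), h10]
      omega
    · rintro g t ⟨hs, hy, sh, h25, h1, h2, h3, h5, h6⟩ hlt
      rw [h25, hs.2 10 (by norm_num), h10] at hlt
      have h12' : t.reg 12 = 1 := (hs.2 12 (by norm_num)).trans h12
      refine Ends.instr ?_ ⟨?_, ?_⟩
      · have l1 := hsmall (t.reg 20) (by omega)
        simp [Instr.cost, h12', len_one]
        omega
      · exact hs.setReg (by norm_num) _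
      · simp only [Instr.effect, State.setReg, Function.update_self, h12']
        have hQ : (z : ℤ) < (q : ℤ) ^ sh := by
          exact_mod_cast hzL.trans_le (Nat.pow_le_pow_right hq0 (by omega))
        exact_mod_cast geom_final (L := L) hβ1 (by positivity) hQ (by exact_mod_cast h3) h5 h6
    · rintro g t ⟨hs, hy, sh, h25, h1, h2, h3, h5, h6⟩ hlt
      rw [h25, hs.2 10 (by norm_num), h10] at hlt
      have h10' : t.reg 10 = L := (hs.2 10 (by norm_num)).trans h10
      have h12' : t.reg 12 = 1 := (hs.2 12 (by norm_num)).trans h12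
      obtain ⟨y, hy20⟩ : ∃ y, t.reg 20 = y := ⟨_, rfl⟩
      rw [hy20] at hy h5 h6
      obtain ⟨g, rfl⟩ : ∃ g', g = g' + 1 := by
        refine Nat.exists_eq_succ_of_ne_zero fun h0 => ?_
        rw [h0, pow_zero, mul_one] at h1
        omega
      have hQ0 : (0 : ℤ) < (q : ℤ) ^ sh := by positivity
      have hz0 : (0 : ℤ) ≤ z := by positivity
      obtain ⟨u, hu⟩ : ∃ u, y / q ^ sh = u := ⟨_, rfl⟩
      have hu1 : (u : ℤ) * (q : ℤ) ^ sh ≤ y := by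
        rw [← hu]; exact_mod_cast Nat.div_mul_le_self y (q ^ sh)
      have hu2 : (y : ℤ) < (u + 1) * (q : ℤ) ^ sh := by
        rw [← hu]; exact_mod_cast (Nat.div_lt_iff_lt_mul (Nat.pow_pos hq0)).1 (Nat.lt_succ_self _)
      have hsh1 : (1 : ℤ) ≤ sh := by exact_mod_cast h2
      have hQ1 : (1 : ℤ) ≤ (q : ℤ) ^ sh := hQ0
      have low : (z : ℤ) * ((q : ℤ) ^ (sh + sh) - 1)
          ≤ ((y + u + 1 : ℕ) : ℤ) * β * (q : ℤ) ^ (sh + sh) := by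
        rw [pow_add]
        push_cast
        exact geom_low (by omega) hQ0.le h5 hu2.le
      have up : ((y + u + 1 : ℕ) : ℤ) * β * (q : ℤ) ^ (sh + sh)
          ≤ z * ((q : ℤ) ^ (sh + sh) - 1)
            + (2 * ((sh + sh : ℕ) : ℤ) - 1) * β * (q : ℤ) ^ (sh + sh) := by
        rw [pow_add]
        push_cast
        have := geom_up (by omega) hQ1 hsh1 h6 hu1
        linarith
      have huy : u ≤ y := hu ▸ Nat.div_le_self _ _
      refine ⟨g, rfl, Ends.mono (Ends.block (K := 20 * L) ?_ ?_)
        (by simp only [List.length_cons, List.length_nil]; omega) fun _ h => h⟩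
      · have l1 := hsmall y (by omega)
        have l2 := hsmall u (by omega)
        have l3 := hsmall (y + u) (by omega)
        have l6 := hlenle sh (by omega)
        simp only [CostsLe, Instr.cost, Instr.effect, State.setReg, Function.update_apply,
          ↓reduceIte, Nat.reduceEqDiff, and_true, h12', h25, hy20, hu, len_one]
        omega
      · have e20 : (effects q [.shr 23 20 25, .add 20 20 23, .add 20 20 12, .add 25 25 25]
            t).reg 20 = y + u + 1 := by
          simp only [effects, Instr.effect, State.setReg, Function.update_apply,
            ↓reduceIte, Nat.reduceEqDiff, h12', h25, hy20, hu]
        refine ⟨?_, ?_, sh + sh, ?_, ?_, by omega, by omega, ?_, ?_⟩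
        · simp only [effects, Instr.effect]
          repeat' first | exact hs | refine SameLow.setReg ?_ (by norm_num) _
        · rw [e20]
          zify
          have hP : (0 : ℤ) < (q : ℤ) ^ (sh + sh) := by positivity
          have e2 := geom_bound hβ1 (by positivity) hP up
          have e3 : (z : ℤ) < (q : ℤ) ^ L := by exact_mod_cast hzL
          have e4 : (sh : ℤ) < L := by exact_mod_cast hlt
          push_cast at e2
          linarith
        · simp only [effects, Instr.effect, State.setReg, Function.update_apply,
            ↓reduceIte, Nat.reduceEqDiff, h25]
        · rw [pow_succ] at h1; linarith
        · rw [e20]; exact low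
        · rw [e20]; exact up
    · have e20 : (effects q [.shl 23 20 21, .sub 20 23 20, .shr 20 20 22, .add 20 20 12,
          .copy 25 22] s).reg 20 = z / q ^ b + 1 := by
        simp only [effects, Instr.effect, State.setReg, Function.update_apply,
          ↓reduceIte, Nat.reduceEqDiff, h12, h20, h21, h22, hz]
      obtain ⟨u, hu⟩ : ∃ u, z / q ^ b = u := ⟨_, rfl⟩
      have hu1 : (u : ℤ) * (q : ℤ) ^ b ≤ z := by
        rw [← hu]; exact_mod_cast Nat.div_mul_le_self z (q ^ b)
      have hu2 : (z : ℤ) < (u + 1) * (q : ℤ) ^ b := by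
        rw [← hu]; exact_mod_cast (Nat.div_lt_iff_lt_mul (Nat.pow_pos hq0)).1 (Nat.lt_succ_self _)
      have hqb : (0 : ℤ) < (q : ℤ) ^ b := by positivity
      have hb1 : (1 : ℤ) ≤ b := by exact_mod_cast hb
      refine ⟨?_, ?_, b, ?_, ?_, hb, by omega, ?_, ?_⟩
      · simp only [effects, Instr.effect]
        repeat' first | exact SameLow.refl s | refine SameLow.setReg ?_ (by norm_num) _
      · rw [e20, hu]
        have : u ≤ z := hu ▸ Nat.div_le_self _ _
        omega
      · simp only [effects, Instr.effect, State.setReg, Function.update_apply,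
          ↓reduceIte, Nat.reduceEqDiff, h22]
      · nlinarith
      · rw [e20, hu]
        push_cast
        have e1 := mul_le_mul_of_nonneg_left hu2.le (by omega : 0 ≤ β)
        rw [← hβ]
        linarith
      · rw [e20, hu]
        push_cast
        have e1 := mul_le_mul_of_nonneg_left hu1 (by omega : 0 ≤ β)
        have e2 := mul_le_mul_of_nonneg_right (by omega : (1 : ℤ) ≤ 2 * b - 1)
          (mul_nonneg (by omega : 0 ≤ β) hqb.le)
        rw [← hβ]
        linarith

/-! ### The decoding program -/

/-- Register `30` becomes the number with the base-`q` digits that are in the rows `1, …, m` of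
the column at position `N`, where `n`, `N` and `m` are in registers `1`, `5` and `6`. -/
def readDigits : Prog :=
  .seq (block (.copy 30 4) [.add 31 1 5, .copy 32 6])
    (.whileLt 4 32 (block (.load 33 31) [.shl 30 30 12, .add 30 30 33, .add 31 31 1,
      .sub 32 32 12]))

/-- The number with the `m` digits `d 0, …, d (m - 1)` in base `q`, most significant first. -/
def digitsValue (q : ℕ) (d : ℕ → ℕ) (m : ℕ) : ℕ := ∑ r ∈ Finset.range m, d r * q ^ (m - 1 - r)

theorem digitsValue_succ (q : ℕ) (d : ℕ → ℕ) (m : ℕ) :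
    digitsValue q d (m + 1) = digitsValue q d m * q + d m := by
  unfold digitsValue
  rw [Finset.sum_range_succ, Finset.sum_mul]
  congr 1
  · refine Finset.sum_congr rfl fun r hr => ?_
    have := Finset.mem_range.1 hr
    rw [mul_assoc, ← pow_succ]
    congr 2
    omega
  · simp

theorem digitsValue_lt {q : ℕ} {d : ℕ → ℕ} {m : ℕ} (h : ∀ r < m, d r < q) :
    digitsValue q d m < q ^ m := by
  induction m with
  | zero => simp [digitsValue]
  | succ m ih =>
    have h1 := ih fun r hr => h r (by omega)
    have h2 := h m (by omega)
    rw [digitsValue_succ, pow_succ]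
    nlinarith

/-- An address in the array, or any number below `n ^ 2`, has at most `2 n` digits. -/
theorem len_le_of_le_sq {q n a : ℕ} (hq : 2 ≤ q) (hn : 1 ≤ n) (h : a ≤ n * n) :
    len q a ≤ 2 * n := by
  refine len_le_of_lt_pow (by omega) (h.trans_lt ?_)
  rw [two_mul, pow_add]
  have := lt_pow_of_le hq (le_refl n)
  nlinarith

/-- Horner's rule in base q. Only m rows are read: in a column without a leading entry, the rows
below have their leading entries in columns already passed and hold 0 here. -/
theorem readDigits_ends {q n N m : ℕ} {s : State} {d : ℕ → ℕ} (hq : 2 ≤ q) (h1 : s.reg 1 = n)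
    (h4 : s.reg 4 = 0) (h5 : s.reg 5 = N) (h6 : s.reg 6 = m) (h12 : s.reg 12 = 1)
    (hN : N < n) (hm : m < n) (hmem : ∀ r < m, s.mem ((r + 1) * n + N) = d r)
    (hd : ∀ r < m, d r < q) :
    Ends q readDigits s ((m + 1) * (100 * n)) (fun t => SameLow s t ∧
      t.reg 30 = digitsValue q d m) := by
  have hlen : ∀ v, v ≤ n * n → len q v ≤ 2 * n := fun v => len_le_of_le_sq hq (by omega)
  have hn1 : n ≤ n * n := Nat.le_mul_self n
  have hn2 : n + N ≤ n * n := by nlinarith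
  unfold readDigits
  refine Ends.mono (Ends.seq (B := 3 * (4 * n)) (B' := m * (50 * n + 4 * n) + 4 * n)
    (Ends.block (K := 4 * n) ?_ ?_)) (by nlinarith) fun _ h => h
  · have l1 := hlen n hn1
    have l2 := hlen N (by omega)
    have l3 := hlen m (by omega)
    simp only [CostsLe, Instr.cost, Instr.effect, State.setReg, Function.update_apply,
      ↓reduceIte, Nat.reduceEqDiff, and_true, h1, h4, h5, h6, len_zero]
    omega
  · refine Ends.whileLt_fuel (K := 50 * n) (K' := 4 * n) (fun g t => SameLow s t ∧
      t.reg 32 = g ∧ ∃ i, i + g = m ∧ t.reg 30 = digitsValue q d i ∧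
        t.reg 31 = (i + 1) * n + N) ?_ ?_ ?_ m _ ?_ le_rfl
    · rintro g t ⟨hs, h32, i, hi, h30, h31⟩
      have := hlen g (by omega)
      rw [h32, hs.2 4 (by norm_num), h4, len_zero]
      omega
    · rintro g t ⟨hs, h32, i, hi, h30, h31⟩ hlt
      rw [h32, hs.2 4 (by norm_num), h4] at hlt
      obtain rfl : i = m := by omega
      exact ⟨hs, h30⟩
    · rintro g t ⟨hs, h32, i, hi, h30, h31⟩ hlt
      rw [h32, hs.2 4 (by norm_num), h4] at hlt
      obtain ⟨g, rfl⟩ : ∃ g', g = g' + 1 := ⟨g - 1, by omega⟩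
      have h1' : t.reg 1 = n := (hs.2 1 (by norm_num)).trans h1
      have h12' : t.reg 12 = 1 := (hs.2 12 (by norm_num)).trans h12
      have hmem' : t.mem ((i + 1) * n + N) = d i := by rw [hs.1]; exact hmem i (by omega)
      refine ⟨g, rfl, Ends.mono (Ends.block (K := 10 * n) ?_ ?_)
        (by simp only [List.length_cons, List.length_nil]; omega) fun _ h => h⟩
      · have hv := digitsValue_lt (q := q) (d := d) (m := i) fun r hr => hd r (by omega)
        have hpow : ∀ v, v < q ^ (i + 1) → len q v ≤ 2 * n := fun v hv =>
          (len_le_of_lt_pow (by omega) hv).trans (by omega)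
        have hdi := hd i (by omega)
        have l1 := hlen ((i + 1) * n + N) (by nlinarith)
        have l2 := hpow (d i) (hdi.trans_le (Nat.le_self_pow (by omega) q))
        have l3 := hpow (digitsValue q d i) (hv.trans (Nat.pow_lt_pow_right (by omega)
          (by omega)))
        have l4 := hpow (digitsValue q d i * q) (by rw [pow_succ]; nlinarith)
        have l5 := hlen n hn1
        have l6 := hlen (g + 1) (by omega)
        simp only [CostsLe, Instr.cost, Instr.effect, State.setReg, Function.update_apply,
          ↓reduceIte, Nat.reduceEqDiff, and_true, h1', h12', h30, h31, h32, hmem', len_one,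
          pow_one]
        omega
      · refine ⟨?_, ?_, i + 1, by omega, ?_, ?_⟩
        · simp only [effects, Instr.effect]
          repeat' first | exact hs | refine SameLow.setReg ?_ (by norm_num) _
        · simp only [effects, Instr.effect, State.setReg, Function.update_apply,
            ↓reduceIte, Nat.reduceEqDiff, h12', h32]
          omega
        · simp only [effects, Instr.effect, State.setReg, Function.update_apply,
            ↓reduceIte, Nat.reduceEqDiff, h12', h30, h31, hmem', digitsValue_succ, pow_one]
        · simp only [effects, Instr.effect, State.setReg, Function.update_apply,
            ↓reduceIte, Nat.reduceEqDiff, h31, h1']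
          ring
    · refine ⟨?_, ?_, 0, by omega, ?_, ?_⟩
      · simp only [effects, Instr.effect]
        repeat' first | exact SameLow.refl s | refine SameLow.setReg ?_ (by norm_num) _
      · simp only [effects, Instr.effect, State.setReg, Function.update_apply,
          ↓reduceIte, Nat.reduceEqDiff, h6]
      · simp [effects, Instr.effect, State.setReg, h4, digitsValue]
      · simp only [effects, Instr.effect, State.setReg, Function.update_apply,
          ↓reduceIte, Nat.reduceEqDiff, h1, h5]
        ring

/-- Horner step of the decoding at a column without a leading entry. -/
def decodeZero : Prog :=
  -- The exponents N + 1 and N + 1 - m are those of `gaussNat_succ_mul`.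
  .seq (block (.copy 20 3) [.add 21 5 12, .sub 22 21 6]) <|
  .seq modRatio <|
  .seq (.instr (.copy 3 20)) <|
  .seq readDigits <|
  block (.add 20 3 30) [.shr 23 20 10, .shl 23 23 10, .sub 3 20 23]

/-- Horner step of the decoding at a column with a leading entry. -/
def decodeOne : Prog :=
  -- By Pascal's rule the term of this column is [N+1; m] - [N; m-1], which is 1 in units of the old
  -- coefficient minus 1 in units of the new one. The exponents are those of
  -- `gaussNat_succ_succ_mul`.
  .seq (block (.add 20 3 12) [.add 21 5 12, .copy 22 6]) <|
  .seq modRatio <|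
  block (.add 20 20 11) [.sub 20 20 12, .shr 23 20 10, .shl 23 23 10, .sub 3 20 23, .sub 6 6 12]

/-- One round of the decoding. -/
def decodeRound : Prog :=
  .seq (block (.sub 5 5 12) [.load 20 5]) (.ifLt 20 12 decodeZero decodeOne)

/-- The decoding program. -/
def decodeProg : Prog :=
  -- The only multiplication is k (n - k), of two short numbers; three doublings give L = 8 k (n -
  -- k).
  .seq (block (.const 12 1) [.sub 13 1 2, .mul 10 2 13, .add 10 10 10, .add 10 10 10,
      .add 10 10 10, .shl 11 12 10, .copy 5 1, .copy 6 2])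
    (.whileLt 4 5 decodeRound)

/-- The registers between the rounds of the decoding, when `N` columns are left which hold `m`
leading entries. -/
structure DecodeRegs (q n L N m S : ℕ) (t : State) : Prop where
  r1 : t.reg 1 = n
  r3 : t.reg 3 = S
  r4 : t.reg 4 = 0
  r5 : t.reg 5 = N
  r6 : t.reg 6 = m
  r10 : t.reg 10 = L
  r11 : t.reg 11 = q ^ L
  r12 : t.reg 12 = 1

theorem DecodeRegs.of_sameLow {q n L N m S : ℕ} {s t : State} (h : DecodeRegs q n L N m S s)
    (hs : SameLow s t) : DecodeRegs q n L N m S t := by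
  obtain ⟨h1, h3, h4, h5, h6, h10, h11, h12⟩ := h
  constructor <;> rw [hs.2 _ (by norm_num)] <;> assumption

section DecodeRound

variable {q n L N m S f : ℕ} {s : State}

theorem decodeZero_ends {d : ℕ → ℕ} (hq : 2 ≤ q) (hs : DecodeRegs q n L N m S s) (hm : m ≤ N)
    (hN : N < n) (hL : n ≤ L) (hf : L ≤ 2 ^ f) (hS : S < q ^ L)
    (hmem : ∀ r < m, s.mem ((r + 1) * n + N) = d r) (hd : ∀ r < m, d r < q) :
    Ends q decodeZero s ((f + 4) * (100 * L) + (m + 1) * (100 * n)) (fun t =>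
      t.mem = s.mem ∧ ∃ y < q ^ L,
        (y : ℤ) * ((q : ℤ) ^ (N + 1 - m) - 1) ≡ S * ((q : ℤ) ^ (N + 1) - 1) [ZMOD (q : ℤ) ^ L] ∧
        DecodeRegs q n L N m ((y + digitsValue q d m) % q ^ L) t) := by
  have hlenle : ∀ v, v ≤ 2 * L → len q v ≤ 2 * L := fun v => len_le_of_le hq (by omega)
  have hlen : ∀ v, v < q ^ (2 * L) → len q v ≤ 2 * L := fun v => len_le_of_lt_pow (by omega)
  have hq0 : 0 < q := by omega
  have hpos : 0 < q ^ L := Nat.pow_pos hq0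
  have h2L : 2 ≤ q ^ L := hq.trans (Nat.le_self_pow (by omega) q)
  have hpow : 2 * q ^ L ≤ q ^ (2 * L) := by
    rw [two_mul L, pow_add]; exact Nat.mul_le_mul_right _ h2L
  unfold decodeZero
  refine Ends.mono (Ends.seq (B := 3 * (6 * L)) (B' := (f + 2) * (100 * L) + (2 * L +
    ((m + 1) * (100 * n) + 4 * (6 * L)))) (Ends.block (K := 6 * L) ?_ ?_)) ?_ fun _ h => h
  · obtain ⟨h1, h3, h4, h5, h6, h10, h11, h12⟩ := hs
    have l1 := hlen S (by omega)
    have l2 := hlenle N (by omega)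
    have l3 := hlenle (N + 1) (by omega)
    have l4 := hlenle m (by omega)
    simp only [CostsLe, Instr.cost, Instr.effect, State.setReg, Function.update_apply,
      ↓reduceIte, Nat.reduceEqDiff, and_true, h3, h5, h6, h12, len_one]
    omega
  · set s₁ := effects q [.copy 20 3, .add 21 5 12, .sub 22 21 6] s with hs₁
    have hss : SameLow s s₁ := by
      simp only [hs₁, effects, Instr.effect]
      repeat' first | exact SameLow.refl s | refine SameLow.setReg ?_ (by norm_num) _
    have hr := hs.of_sameLow hss
    refine Ends.seq (Ends.mono (modRatio_ends (x := S) (a := N + 1) (b := N + 1 - m) (f := f) hq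
      hr.r10 hr.r11 ?_ ?_ ?_ hS.le (by omega) (by omega) (by omega) hf) le_rfl ?_)
    · simp [hs₁, effects, Instr.effect, State.setReg, hs.r3]
    · simp [hs₁, effects, Instr.effect, State.setReg, hs.r5, hs.r12]
    · simp [hs₁, effects, Instr.effect, State.setReg, hs.r5, hs.r6, hs.r12]
    · rintro t ⟨hst, hy, hmod⟩
      have hrt := hr.of_sameLow hst
      have hmt : t.mem = s.mem := hst.1.trans hss.1
      obtain ⟨y, h20⟩ : ∃ y, t.reg 20 = y := ⟨_, rfl⟩
      rw [h20] at hy hmod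
      refine Ends.seq (Ends.instr ?_ ?_)
      · have := hlen y (by omega)
        simp only [Instr.cost, h20]
        omega
      · refine Ends.seq (Ends.mono (readDigits_ends (d := d) (n := n) (N := N) (m := m) hq
          ?_ ?_ ?_ ?_ ?_ hN (by omega) ?_ hd) le_rfl ?_)
        · simp [Instr.effect, State.setReg, hrt.r1]
        · simp [Instr.effect, State.setReg, hrt.r4]
        · simp [Instr.effect, State.setReg, hrt.r5]
        · simp [Instr.effect, State.setReg, hrt.r6]
        · simp [Instr.effect, State.setReg, hrt.r12]
        · simpa [Instr.effect, State.setReg, hmt] using hmem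
        · rintro u ⟨htu, h30⟩
          have hru : DecodeRegs q n L N m y u := by
            refine DecodeRegs.of_sameLow ?_ htu
            obtain ⟨h1, h3, h4, h5, h6, h10, h11, h12⟩ := hrt
            constructor <;> simp [Instr.effect, State.setReg, *]
          obtain ⟨c, hc⟩ : ∃ c, digitsValue q d m = c := ⟨_, rfl⟩
          have hclt : c < q ^ L := by
            rw [← hc]
            exact (digitsValue_lt hd).trans_le (Nat.pow_le_pow_right hq0 (by omega))
          rw [hc] at h30 ⊢
          have hmu : u.mem = s.mem := htu.1.trans hmt
          obtain ⟨h1, h3, h4, h5, h6, h10, h11, h12⟩ := hru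
          refine Ends.block (K := 6 * L) ?_ ⟨?_, y, hy, hmod, ?_⟩
          · have l1 := hlen y (by omega)
            have l2 := hlen c (by omega)
            have l3 := hlen (y + c) (by omega)
            have l4 := hlen ((y + c) / q ^ L) ((Nat.div_le_self _ _).trans_lt (by omega))
            have l5 := hlen ((y + c) / q ^ L * q ^ L)
              ((Nat.div_mul_le_self _ _).trans_lt (by omega))
            have l6 := hlenle L (by omega)
            simp only [CostsLe, Instr.cost, Instr.effect, State.setReg, Function.update_apply,
              ↓reduceIte, Nat.reduceEqDiff, and_true, h3, h10, h30]
            omega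
          · simp [effects, Instr.effect, State.setReg, hmu]
          · constructor <;>
              simp [effects, Instr.effect, State.setReg, sub_div_mul_self, *]
  · nlinarith

theorem decodeOne_ends (hq : 2 ≤ q) (hs : DecodeRegs q n L N (m + 1) S s) (hm : m ≤ N)
    (hN : N < n) (hL : n ≤ L) (hf : L ≤ 2 ^ f) (hS : S < q ^ L) :
    Ends q decodeOne s ((f + 4) * (100 * L)) (fun t =>
      t.mem = s.mem ∧ ∃ y < q ^ L,
        (y : ℤ) * ((q : ℤ) ^ (m + 1) - 1)
          ≡ (S + 1 : ℕ) * ((q : ℤ) ^ (N + 1) - 1) [ZMOD (q : ℤ) ^ L] ∧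
        DecodeRegs q n L N m ((y + q ^ L - 1) % q ^ L) t) := by
  have hlenle : ∀ v, v ≤ 2 * L → len q v ≤ 2 * L := fun v => len_le_of_le hq (by omega)
  have hlen : ∀ v, v < q ^ (2 * L) → len q v ≤ 2 * L := fun v => len_le_of_lt_pow (by omega)
  have hq0 : 0 < q := by omega
  have hpos : 0 < q ^ L := Nat.pow_pos hq0
  have h2L : 2 ≤ q ^ L := hq.trans (Nat.le_self_pow (by omega) q)
  have hpow : 2 * q ^ L ≤ q ^ (2 * L) := by
    rw [two_mul L, pow_add]; exact Nat.mul_le_mul_right _ h2L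
  unfold decodeOne
  refine Ends.mono (Ends.seq (B := 3 * (6 * L)) (B' := (f + 2) * (100 * L) + 6 * (6 * L))
    (Ends.block (K := 6 * L) ?_ ?_)) ?_ fun _ h => h
  · obtain ⟨h1, h3, h4, h5, h6, h10, h11, h12⟩ := hs
    have l1 := hlen S (by omega)
    have l2 := hlenle N (by omega)
    have l4 := hlenle (m + 1) (by omega)
    simp only [CostsLe, Instr.cost, Instr.effect, State.setReg, Function.update_apply,
      ↓reduceIte, Nat.reduceEqDiff, and_true, h3, h5, h6, h12, len_one]
    omega
  · set s₁ := effects q [.add 20 3 12, .add 21 5 12, .copy 22 6] s with hs₁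
    have hss : SameLow s s₁ := by
      simp only [hs₁, effects, Instr.effect]
      repeat' first | exact SameLow.refl s | refine SameLow.setReg ?_ (by norm_num) _
    have hr := hs.of_sameLow hss
    refine Ends.seq (Ends.mono (modRatio_ends (x := S + 1) (a := N + 1) (b := m + 1) (f := f) hq
      hr.r10 hr.r11 ?_ ?_ ?_ hS (by omega) (by omega) (by omega) hf) le_rfl ?_)
    · simp [hs₁, effects, Instr.effect, State.setReg, hs.r3, hs.r12]
    · simp [hs₁, effects, Instr.effect, State.setReg, hs.r5, hs.r12]
    · simp [hs₁, effects, Instr.effect, State.setReg, hs.r6]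
    · rintro t ⟨hst, hy, hmod⟩
      have hrt := hr.of_sameLow hst
      have hmt : t.mem = s.mem := hst.1.trans hss.1
      obtain ⟨y, h20⟩ : ∃ y, t.reg 20 = y := ⟨_, rfl⟩
      rw [h20] at hy hmod
      obtain ⟨h1, h3, h4, h5, h6, h10, h11, h12⟩ := hrt
      refine Ends.block (K := 6 * L) ?_ ⟨?_, y, hy, hmod, ?_⟩
      · have l1 := hlen y (by omega)
        have l2 := hlen (q ^ L) (by omega)
        have l3 := hlen (y + q ^ L) (by omega)
        have l7 := hlen (y + q ^ L - 1) (by omega)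
        have l4 := hlen ((y + q ^ L - 1) / q ^ L) ((Nat.div_le_self _ _).trans_lt (by omega))
        have l5 := hlen ((y + q ^ L - 1) / q ^ L * q ^ L)
          ((Nat.div_mul_le_self _ _).trans_lt (by omega))
        have l6 := hlenle L (by omega)
        have l8 := hlenle (m + 1) (by omega)
        simp only [CostsLe, Instr.cost, Instr.effect, State.setReg, Function.update_apply,
          ↓reduceIte, Nat.reduceEqDiff, and_true, h10, h11, h12, h6, h20, len_one]
        omega
      · simp [effects, Instr.effect, State.setReg, hmt]
      · constructor <;>
          simp [effects, Instr.effect, State.setReg, sub_div_mul_self, *]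
  · nlinarith

theorem decodeRound_ends {Q : State → Prop} {B : ℕ} (hq : 2 ≤ q)
    (hs : DecodeRegs q n L (N + 1) m S s) (hN : N < n) (hL : n ≤ L) (hv : s.mem N ≤ 1)
    (h0 : s.mem N = 0 → ∀ t, t.mem = s.mem → DecodeRegs q n L N m S t → Ends q decodeZero t B Q)
    (h1 : s.mem N = 1 → ∀ t, t.mem = s.mem → DecodeRegs q n L N m S t → Ends q decodeOne t B Q) :
    Ends q decodeRound s (20 * L + B) Q := by
  have hlenle : ∀ v, v ≤ 2 * L → len q v ≤ 2 * L := fun v => len_le_of_le hq (by omega)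
  obtain ⟨e1, e3, e4, e5, e6, e10, e11, e12⟩ := hs
  obtain ⟨v, hvv⟩ : ∃ v, s.mem N = v := ⟨_, rfl⟩
  have l1 := hlenle (N + 1) (by omega)
  have l2 := hlenle N (by omega)
  have l3 := hlenle v (by omega)
  unfold decodeRound
  refine Ends.mono (Ends.seq (B := 2 * (4 * L)) (B' := 4 * L + B) (Ends.block (K := 4 * L) ?_ ?_))
    (by omega) fun _ h => h
  · simp only [CostsLe, Instr.cost, Instr.effect, State.setReg, Function.update_apply,
      ↓reduceIte, and_true, e5, e12, len_one, Nat.add_sub_cancel, hvv]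
    omega
  · have hr : DecodeRegs q n L N m S (effects q [.sub 5 5 12, .load 20 5] s) := by
      constructor <;> simp [effects, Instr.effect, State.setReg, *]
    have hm : (effects q [.sub 5 5 12, .load 20 5] s).mem = s.mem := by
      simp [effects, Instr.effect, State.setReg]
    have h20 : (effects q [.sub 5 5 12, .load 20 5] s).reg 20 = v := by
      simp [effects, Instr.effect, State.setReg, e5, e12, hvv]
    refine Ends.ifLt ?_ ?_ ?_
    · rw [h20, hr.r12, len_one]; omega
    · rw [h20, hr.r12]
      exact fun h => h0 (by omega) _ hm hr
    · rw [h20, hr.r12]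
      exact fun h => h1 (by omega) _ hm hr

end DecodeRound

/-! ### Properties of extended representations -/

/-- The properties of `EXT(X)` that the index and the decoding depend on. -/
structure IsExtended (q : ℕ) {n k : ℕ} (E : Matrix (Fin (k + 1)) (Fin n) ℕ) : Prop where
  vEntry_le_one : ∀ j, vEntry E j ≤ 1
  weight_eq : weight E n = k
  col_lt : ∀ j (r : Fin k), col E j r.succ < q
  col_eq_zero : ∀ j, 1 ≤ j → j ≤ n → ∀ r : Fin k, k ≤ r + weight E (j - 1) → col E j r.succ = 0

section Extended

variable {F : Type*} [Field F] {q n k : ℕ}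

theorem IsRREFOf.exists_strictMono_lead {X : Submodule F (Fin n → F)}
    {A : Matrix (Fin k) (Fin n) F} (h : IsRREFOf X A) :
    ∃ lead : Fin k → Fin n, StrictMono lead ∧ ∀ s, A.IsLeadingEntry s (lead s) := by
  have hne : ∀ s, A s ≠ 0 := fun s => h.linearIndependent.ne_zero s
  choose lead hlead using fun s => Matrix.row_ne_zero_iff_exists_isLeadingEntry.1 (hne s)
  refine ⟨lead, fun r s hrs => ?_, hlead⟩
  by_contra hle
  rw [not_lt] at hle
  exact (hlead s).2 (h.isReducedRowEchelon.isRowEchelon hrs fun c hc =>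
    (hlead r).1 c (hc.trans_le hle))

/-- Column j is at position n - j, so the first j columns are the last j positions. Leading
positions are distinct, hence counting columns with a leading entry amounts to counting rows. -/
theorem weight_EXT (φ : F ≃ Fin q) (X : Submodule F (Fin n → F)) (hX : Module.finrank F X = k)
    {lead : Fin k → Fin n} (hmono : StrictMono lead)
    (hlead : ∀ s, (RE X hX).IsLeadingEntry s (lead s)) {j : ℕ} (hj : j ≤ n) :
    weight (EXT φ X hX) j = (Finset.univ.filter fun s => n ≤ lead s + j).card := by
  have hv : ∀ c : Fin n, (∃ s, (RE X hX).IsLeadingEntry s c) ↔ ∃ s, lead s = c := fun c =>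
    ⟨fun ⟨s, hs⟩ => ⟨s, (hlead s).unique hs⟩, fun ⟨s, hs⟩ => ⟨s, hs ▸ hlead s⟩⟩
  induction j with
  | zero =>
    have : (Finset.univ.filter fun s => n ≤ lead s + 0) = ∅ :=
      Finset.filter_eq_empty_iff.2 fun s _ => by have := (lead s).2; omega
    rw [this]
    simp [weight]
  | succ j ih =>
    have h1 : weight (EXT φ X hX) (j + 1)
        = weight (EXT φ X hX) j + vEntry (EXT φ X hX) (j + 1) := by
      unfold weight
      rw [Finset.sum_Icc_succ_top (by omega)]
    have h2 : (Finset.univ.filter fun s => n ≤ lead s + (j + 1))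
        = (Finset.univ.filter fun s => n ≤ lead s + j) ∪
          (Finset.univ.filter fun s => (lead s : ℕ) = n - (j + 1)) := by
      ext s
      simp only [Finset.mem_filter, Finset.mem_univ, true_and, Finset.mem_union]
      omega
    have h3 : vEntry (EXT φ X hX) (j + 1)
        = (Finset.univ.filter fun s => (lead s : ℕ) = n - (j + 1)).card := by
      have h4 : vEntry (EXT φ X hX) (j + 1)
          = if ∃ s, lead s = (⟨n - (j + 1), by omega⟩ : Fin n) then 1 else 0 := by
        unfold vEntry col EXT
        rw [dif_pos ⟨by omega, hj⟩]
        simp only [Fin.cases_zero, hv]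
      rw [h4]
      split_ifs with h5
      · obtain ⟨s, hs⟩ := h5
        symm
        rw [Finset.card_eq_one]
        refine ⟨s, ?_⟩
        ext r
        simp only [Finset.mem_filter, Finset.mem_univ, true_and, Finset.mem_singleton]
        constructor
        · intro hr
          exact hmono.injective (by rw [hs]; exact Fin.ext hr)
        · rintro rfl
          rw [hs]
      · symm
        rw [Finset.card_eq_zero, Finset.filter_eq_empty_iff]
        exact fun s _ hs => h5 ⟨s, Fin.ext hs⟩
    rw [h1, ih (by omega), h2, h3, Finset.card_union_of_disjoint]
    rw [Finset.disjoint_filter]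
    intro s _ hs
    omega

theorem isExtended_EXT (φ : F ≃ Fin q) (h0 : (φ 0 : ℕ) = 0) (X : Submodule F (Fin n → F))
    (hX : Module.finrank F X = k) : IsExtended q (EXT φ X hX) := by
  obtain ⟨lead, hmono, hlead⟩ := (RE_spec X hX).exists_strictMono_lead
  have hq : 0 < q := (φ 0).pos
  refine ⟨fun j => ?_, ?_, fun j r => ?_, fun j h1 hj r hr => ?_⟩
  · unfold vEntry col
    split_ifs
    · simp only [EXT, Fin.cases_zero]
      split_ifs <;> omega
    · omega
  · rw [weight_EXT φ X hX hmono hlead le_rfl]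
    simp
  · unfold col
    split_ifs
    · exact (φ _).2
    · exact hq
  · have hw := weight_EXT φ X hX hmono hlead (by omega : j - 1 ≤ n)
    -- Otherwise every row counted by w_(j-1) would lie strictly below row r, and w_(j-1) would be
    -- at most k - 1 - r.
    have hlt : n - j < lead r := by
      by_contra hle
      have hsub : (Finset.univ.filter fun s => n ≤ lead s + (j - 1)) ⊆ Finset.Ioi r := by
        intro s hs
        simp only [Finset.mem_filter, Finset.mem_univ, true_and] at hs
        rw [Finset.mem_Ioi]
        by_contra hsr
        have : lead s ≤ lead r := hmono.monotone (not_lt.1 hsr)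
        have : (lead s : ℕ) ≤ lead r := this
        omega
      have := Finset.card_le_card hsub
      rw [← hw, Fin.card_Ioi] at this
      have := r.2
      omega
    unfold col EXT
    rw [dif_pos ⟨h1, hj⟩]
    simp only [Fin.cases_succ]
    rw [(hlead r).1 _ (show (⟨n - j, by omega⟩ : Fin n) < lead r from hlt), h0]

end Extended

/-! ### The index column by column. -/

section IndexTerms

variable {q n k : ℕ} {E : Matrix (Fin (k + 1)) (Fin n) ℕ}

/-- The contribution of column `j` to the index. -/
def indexTerm (q : ℕ) (E : Matrix (Fin (k + 1)) (Fin n) ℕ) (j : ℕ) : ℚ :=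
  ((vEntry E j : ℚ) * (q : ℚ) ^ (k - weight E (j - 1))
      + (1 - (vEntry E j : ℚ)) * ((colValue q E j : ℚ) / (q : ℚ) ^ weight E (j - 1)))
    * gauss q (n - j) (k - weight E (j - 1))

/-- Entry in row `r + 1` of column `j`. -/
def digit (E : Matrix (Fin (k + 1)) (Fin n) ℕ) (j r : ℕ) : ℕ :=
  if h : r < k then col E j (⟨r, h⟩ : Fin k).succ else 0

theorem weight_succ (E : Matrix (Fin (k + 1)) (Fin n) ℕ) (j : ℕ) :
    weight E (j + 1) = weight E j + vEntry E (j + 1) := by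
  unfold weight
  rw [Finset.sum_Icc_succ_top (by omega)]

/-- Each remaining column adds at most one to the weight, which has to reach k. For the decoding
this says m ≤ N. -/
theorem IsExtended.weight_add_le (h : IsExtended q E) {j : ℕ} (hj : j ≤ n) :
    k ≤ weight E j + (n - j) := by
  induction hn : n - j generalizing j with
  | zero =>
    obtain rfl : j = n := by omega
    rw [h.weight_eq, add_zero]
  | succ d ih =>
    have h1 := ih (j := j + 1) (by omega) (by omega)
    rw [weight_succ] at h1
    have := h.vEntry_le_one (j + 1)
    omega

theorem IsExtended.weight_le (h : IsExtended q E) {j : ℕ} (hj : j ≤ n) : weight E j ≤ k := by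
  calc weight E j ≤ weight E n :=
        Finset.sum_le_sum_of_subset (Finset.Icc_subset_Icc_right hj)
    _ = k := h.weight_eq

theorem colValue_eq (q : ℕ) (E : Matrix (Fin (k + 1)) (Fin n) ℕ) (j : ℕ) :
    colValue q E j = digitsValue q (digit E j) k := by
  unfold colValue digitsValue
  rw [← Fin.sum_univ_eq_sum_range (fun r => digit E j r * q ^ (k - 1 - r))]
  refine Finset.sum_congr rfl fun r _ => ?_
  simp [digit]

/-- The reason why {X_j} / q^(w_(j-1)) is an integer: the last w_(j-1) digits of a column without a
leading entry are zero. -/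
theorem digitsValue_eq_mul {d : ℕ → ℕ} {m w : ℕ} (h : ∀ r, m ≤ r → r < m + w → d r = 0) :
    digitsValue q d (m + w) = digitsValue q d m * q ^ w := by
  induction w with
  | zero => simp
  | succ w ih =>
    rw [← add_assoc, digitsValue_succ, ih fun r h1 h2 => h r h1 (by omega),
      h (m + w) (by omega) (by omega), pow_succ]
    ring

theorem IsExtended.indexTerm_of_zero (h : IsExtended q E) (hq : 2 ≤ q) {j m : ℕ} (hj1 : 1 ≤ j)
    (hj : j ≤ n) (hv : vEntry E j = 0) (hm : m + weight E (j - 1) = k) :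
    indexTerm q E j = (digitsValue q (digit E j) m * gaussNat q (n - j) m : ℕ) := by
  have h1 : k - weight E (j - 1) = m := by omega
  have h2 : colValue q E j = digitsValue q (digit E j) m * q ^ weight E (j - 1) := by
    have h3 := digitsValue_eq_mul (q := q) (d := digit E j) (m := m) (w := weight E (j - 1))
      fun r hr hr' => by
        rw [digit, dif_pos (by omega)]
        exact h.col_eq_zero j hj1 hj _ (by simp only; omega)
    rw [hm] at h3
    rw [colValue_eq, h3]
  have hq0 : (q : ℚ) ^ weight E (j - 1) ≠ 0 := pow_ne_zero _ (by positivity)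
  rw [indexTerm, h1, h2, hv, gauss_eq_gaussNat hq]
  push_cast
  field_simp
  ring

theorem IsExtended.indexTerm_of_one (hq : 2 ≤ q) {j m : ℕ}
    (hv : vEntry E j = 1) (hm : m + weight E (j - 1) = k) :
    indexTerm q E j = (q ^ m * gaussNat q (n - j) m : ℕ) := by
  have h1 : k - weight E (j - 1) = m := by omega
  rw [indexTerm, h1, hv, gauss_eq_gaussNat hq]
  push_cast
  ring

theorem indexExt_eq_sum (q : ℕ) (E : Matrix (Fin (k + 1)) (Fin n) ℕ) :
    indexExt q E = ∑ j ∈ Finset.Icc 1 n, indexTerm q E j := rfl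

theorem matrixMem_of_lt (E : Matrix (Fin (k + 1)) (Fin n) ℕ) {r N : ℕ} (hr : r < k + 1)
    (hN : N < n) : matrixMem E (r * n + N) = E ⟨r, hr⟩ ⟨N, hN⟩ := by
  have h1 : r * n + N < n * (k + 1) := by nlinarith
  have h2 : (r * n + N) / n = r := by
    rw [mul_comm, Nat.mul_add_div (by omega), Nat.div_eq_of_lt hN, add_zero]
  have h3 : (r * n + N) % n = N := by
    rw [mul_comm, Nat.mul_add_mod, Nat.mod_eq_of_lt hN]
  rw [matrixMem, dif_pos h1]
  simp only [h2, h3]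

theorem col_sub (E : Matrix (Fin (k + 1)) (Fin n) ℕ) {N : ℕ} (hN : N < n) (r : Fin (k + 1)) :
    col E (n - N) r = E r ⟨N, hN⟩ := by
  rw [col, dif_pos ⟨by omega, by omega⟩]
  congr 2
  omega

end IndexTerms

/-! ### Correctness of the decoding -/

/-- q · q^(a-1) - (q^a - 1) = 1 is a Bézout relation for q, and coprimality passes to its powers. -/
theorem isCoprime_pow_sub_one (q L : ℕ) {a : ℕ} (ha : 1 ≤ a) :
    IsCoprime ((q : ℤ) ^ L) ((q : ℤ) ^ a - 1) := by
  refine IsCoprime.pow_left ⟨(q : ℤ) ^ (a - 1), -1, ?_⟩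
  obtain ⟨a, rfl⟩ := Nat.exists_eq_add_of_le' ha
  rw [Nat.add_sub_cancel]
  ring

/-- If `S` represents `J / A` modulo `q^L`, then `S (q^a - 1) / (q^b - 1)` represents `J / A'` for
`A' = A (q^b - 1) / (q^a - 1)`. -/
theorem modEq_of_ratio {q L a b : ℕ} {A A' S S' J : ℤ} (ha : 1 ≤ a)
    (hA : A * ((q : ℤ) ^ b - 1) = A' * ((q : ℤ) ^ a - 1))
    (hS : S' * ((q : ℤ) ^ b - 1) ≡ S * ((q : ℤ) ^ a - 1) [ZMOD (q : ℤ) ^ L])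
    (hJ : S * A ≡ J [ZMOD (q : ℤ) ^ L]) : S' * A' ≡ J [ZMOD (q : ℤ) ^ L] := by
  -- The claim is first proved after multiplication by q^a - 1, which is then cancelled as a unit
  -- modulo q^L.
  have h1 : S' * A' * ((q : ℤ) ^ a - 1) ≡ J * ((q : ℤ) ^ a - 1) [ZMOD (q : ℤ) ^ L] := by
    have h2 := (hS.mul_right A).trans (show S * ((q : ℤ) ^ a - 1) * A
      ≡ J * ((q : ℤ) ^ a - 1) [ZMOD (q : ℤ) ^ L] from by
        convert hJ.mul_right ((q : ℤ) ^ a - 1) using 1; ring)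
    convert h2 using 1
    linear_combination -S' * hA
  rw [Int.modEq_iff_dvd, ← sub_mul] at h1
  exact Int.modEq_iff_dvd.2 ((isCoprime_pow_sub_one q L ha).dvd_of_dvd_mul_right h1)

/-- The invariant of the decoding: `N` columns are left. -/
structure DecodeInv (q L : ℕ) {n k : ℕ} (E : Matrix (Fin (k + 1)) (Fin n) ℕ) (N m S J : ℕ) :
    Prop where
  weight : m + weight E (n - N) = k
  lt : S < q ^ L
  sum : (J : ℚ) = ∑ j ∈ Finset.Icc 1 (n - N), indexTerm q E j
  -- This keeps J below q^L, so that the final congruence determines J.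
  le : J + gaussNat q N m ≤ gaussNat q n k
  modEq : (S : ℤ) * gaussNat q N m ≡ J [ZMOD (q : ℤ) ^ L]

section DecodeInv

variable {q L n k N m S J : ℕ} {E : Matrix (Fin (k + 1)) (Fin n) ℕ}

/-- `y` represents J / [N; m], so adding c to it adds c [N; m] to J. The bound on J survives because
c < q^m and q^m [N; m] ≤ [N+1; m]. -/
theorem DecodeInv.step_zero (h : IsExtended q E) (hq : 2 ≤ q) (hN : N < n)
    (hI : DecodeInv q L E (N + 1) m S J) (hv : vEntry E (n - N) = 0) {y : ℕ}
    (hy : (y : ℤ) * ((q : ℤ) ^ (N + 1 - m) - 1)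
      ≡ S * ((q : ℤ) ^ (N + 1) - 1) [ZMOD (q : ℤ) ^ L]) (hm : m ≤ N) :
    DecodeInv q L E N m ((y + digitsValue q (digit E (n - N)) m) % q ^ L)
      (J + digitsValue q (digit E (n - N)) m * gaussNat q N m) := by
  obtain ⟨hw, hS, hJ, hle, hmod⟩ := hI
  have e1 : n - N = n - (N + 1) + 1 := by omega
  have e2 : n - N - 1 = n - (N + 1) := by omega
  have e3 : n - (n - N) = N := by omega
  set c := digitsValue q (digit E (n - N)) m with hc
  have hclt : c < q ^ m := digitsValue_lt fun r _ => by
    unfold digit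
    split_ifs
    · exact h.col_lt _ _
    · omega
  refine ⟨?_, Nat.mod_lt _ (Nat.pow_pos (by omega)), ?_, ?_, ?_⟩
  · rw [e1, weight_succ, ← e1, hv, add_zero, hw]
  · rw [e1, Finset.sum_Icc_succ_top (by omega), ← hJ, ← e1,
      h.indexTerm_of_zero hq (by omega) (by omega) hv (by rw [e2]; exact hw), e3]
    push_cast
    rfl
  · refine le_trans ?_ hle
    have hG : c * gaussNat q N m + gaussNat q N m ≤ gaussNat q (N + 1) m := by
      have h1 : c * gaussNat q N m + gaussNat q N m ≤ q ^ m * gaussNat q N m := by nlinarith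
      refine h1.trans ?_
      cases m with
      | zero => simp
      | succ m => rw [gaussNat_succ_succ]; omega
    omega
  · have h1 := modEq_of_ratio (by omega) (gaussNat_succ_mul hq hm) hy hmod
    push_cast
    refine ((Int.mod_modEq _ _).mul_right _).trans ?_
    rw [add_mul]
    exact h1.add_right _

/-- J + q^(m+1) [N; m+1] = (J + [N+1; m+1]) - [N; m]: one unit is added before the change of
denominator and one removed after it. -/
theorem DecodeInv.step_one (hq : 2 ≤ q) (hN : N < n)
    (hI : DecodeInv q L E (N + 1) (m + 1) S J) (hv : vEntry E (n - N) = 1) {y : ℕ}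
    (hy : (y : ℤ) * ((q : ℤ) ^ (m + 1) - 1)
      ≡ (S + 1 : ℕ) * ((q : ℤ) ^ (N + 1) - 1) [ZMOD (q : ℤ) ^ L]) (hm : m ≤ N) :
    DecodeInv q L E N m ((y + q ^ L - 1) % q ^ L)
      (J + q ^ (m + 1) * gaussNat q N (m + 1)) := by
  obtain ⟨hw, hS, hJ, hle, hmod⟩ := hI
  have e1 : n - N = n - (N + 1) + 1 := by omega
  have e2 : n - N - 1 = n - (N + 1) := by omega
  have e3 : n - (n - N) = N := by omega
  have hpos : 0 < q ^ L := Nat.pow_pos (by omega)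
  refine ⟨?_, Nat.mod_lt _ hpos, ?_, ?_, ?_⟩
  · rw [e1, weight_succ, ← e1, hv]
    omega
  · rw [e1, Finset.sum_Icc_succ_top (by omega), ← hJ, ← e1,
      IsExtended.indexTerm_of_one hq hv (by rw [e2]; exact hw), e3]
    push_cast
    rfl
  · refine le_trans ?_ hle
    rw [gaussNat_succ_succ]
    omega
  · have h1 : ((S + 1 : ℕ) : ℤ) * gaussNat q (N + 1) (m + 1)
        ≡ J + gaussNat q (N + 1) (m + 1) [ZMOD (q : ℤ) ^ L] := by
      push_cast
      rw [add_mul, one_mul]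
      exact hmod.add_right _
    have h2 := modEq_of_ratio (by omega) (gaussNat_succ_succ_mul hq hm) hy h1
    have h3 : ((((y + q ^ L - 1) % q ^ L : ℕ) : ℕ) : ℤ) ≡ y - 1 [ZMOD (q : ℤ) ^ L] := by
      rw [Int.natCast_mod]
      have h4 : ((y + q ^ L - 1 : ℕ) : ℤ) = (y - 1) + (q : ℤ) ^ L := by
        rw [Nat.cast_sub (by omega)]; push_cast; ring
      rw [h4]
      push_cast
      refine (Int.mod_modEq _ _).trans ?_
      simp [Int.ModEq]
    refine (h3.mul_right _).trans ?_
    rw [sub_mul, one_mul]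
    refine (h2.sub_right _).trans ?_
    rw [gaussNat_succ_succ]
    push_cast
    ring_nf
    rfl

end DecodeInv

theorem le_two_mul_mul_sub {n k : ℕ} (hk : 0 < k) (hkn : k < n) : n ≤ 2 * (k * (n - k)) := by
  obtain ⟨d, rfl⟩ := Nat.exists_eq_add_of_lt hkn
  have : k + d + 1 - k = d + 1 := by omega
  rw [this]
  nlinarith

/-- 32 k (n - k) is the larger of the two working lengths, so 2 log₂ n + 7 doublings suffice in both
programs. -/
theorem mul_sub_le_two_pow {n k : ℕ} (hkn : k < n) :
    32 * (k * (n - k)) ≤ 2 ^ (2 * Nat.log 2 n + 7) := by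
  have h1 : n ≤ 2 ^ (Nat.log 2 n + 1) := (Nat.lt_pow_succ_log_self (by norm_num) n).le
  have h2 : k * (n - k) ≤ n * n := Nat.mul_le_mul hkn.le (Nat.sub_le _ _)
  have h3 : 2 ^ (2 * Nat.log 2 n + 7) = 32 * (2 ^ (Nat.log 2 n + 1) * 2 ^ (Nat.log 2 n + 1)) := by
    ring
  rw [h3]
  exact Nat.mul_le_mul_left _ (h2.trans (Nat.mul_le_mul h1 h1))

section Decode

variable {q n k : ℕ} {E : Matrix (Fin (k + 1)) (Fin n) ℕ}

theorem matrixMem_zero_row (E : Matrix (Fin (k + 1)) (Fin n) ℕ) {N : ℕ} (hN : N < n) :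
    matrixMem E N = vEntry E (n - N) := by
  have := matrixMem_of_lt E (Nat.succ_pos k) hN
  rw [zero_mul, zero_add] at this
  rw [this, vEntry, col_sub E hN]
  rfl

theorem matrixMem_succ_row (E : Matrix (Fin (k + 1)) (Fin n) ℕ) {N r : ℕ} (hN : N < n)
    (hr : r < k) : matrixMem E ((r + 1) * n + N) = digit E (n - N) r := by
  rw [matrixMem_of_lt E (by omega) hN, digit, dif_pos hr, col_sub E hN]
  rfl

theorem decodeLoop_ends {L f : ℕ} (hq : 2 ≤ q) (hE : IsExtended q E) (hk : 0 < k) (hkn : k < n)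
    (hL : n ≤ L) (hf : L ≤ 2 ^ f) (hD : 2 * (k * (n - k)) ≤ L) {s : State}
    (hs : DecodeRegs q n L n k 0 s) (hmem : s.mem = matrixMem E) :
    Ends q (.whileLt 4 5 decodeRound) s
      (n * ((f + 5) * (100 * L)) + (n - k) * ((k + 1) * (100 * n)) + 2 * L)
      (fun t => (t.reg 3 : ℚ) = indexExt q E) := by
  -- N - m counts the columns without a leading entry still to come. Only these are charged for
  -- reading digits, which gives (n - k)(k + 1) n instead of n k n.
  refine Ends.whileLt (fun B t => ∃ N m S J, DecodeRegs q n L N m S t ∧ t.mem = matrixMem E ∧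
    DecodeInv q L E N m S J ∧ N ≤ n ∧
    N * ((f + 5) * (100 * L)) + (N - m) * ((k + 1) * (100 * n)) + 2 * L ≤ B) ?_ ?_ _ s ?_
  · rintro B t ⟨N, m, S, J, hr, hm, hI, hN, hB⟩ hlt
    rw [hr.r4, hr.r5] at hlt ⊢
    obtain rfl : N = 0 := by omega
    refine ⟨by rw [len_zero]; omega, ?_⟩
    obtain ⟨hw, hS, hJ, hle, hmod⟩ := hI
    rw [Nat.sub_zero, hE.weight_eq] at hw
    obtain rfl : m = 0 := by omega
    have h1 : J < q ^ L := by
      have := (gaussNat_le_pow hq hkn.le).trans (Nat.pow_le_pow_right (by omega) hD)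
      rw [gaussNat_zero] at hle
      omega
    rw [gaussNat_zero, Nat.cast_one, mul_one] at hmod
    have h2 : S ≡ J [MOD q ^ L] := (Int.natCast_modEq_iff).1 (by exact_mod_cast hmod)
    have h3 : S = J := Nat.ModEq.eq_of_lt_of_lt h2 hS h1
    rw [hr.r3, h3, hJ, Nat.sub_zero, indexExt_eq_sum]
  · rintro B t ⟨N, m, S, J, hr, hm, hI, hN, hB⟩ hlt
    rw [hr.r4, hr.r5] at hlt ⊢
    obtain ⟨N, rfl⟩ : ∃ N', N = N' + 1 := ⟨N - 1, by omega⟩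
    have hNn : N < n := hN
    have hmk : m ≤ k := by have := hI.weight; omega
    have hmN : m ≤ N + 1 := by
      have h1 := hE.weight_add_le (j := n - (N + 1)) (by omega)
      have h2 := hI.weight
      omega
    have hl : len q (N + 1) ≤ L := len_le_of_le hq (by omega) (by omega)
    have hv : t.mem N = vEntry E (n - N) := by rw [hm, matrixMem_zero_row E hNn]
    have hv1 := hE.vEntry_le_one (n - N)
    have hws := weight_succ E (n - (N + 1))
    rw [show n - (N + 1) + 1 = n - N by omega] at hws
    have hwI := hI.weight
    have hwa := hE.weight_add_le (j := n - N) (by omega)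
    have hwl := hE.weight_le (j := n - N) (by omega)
    rw [len_zero]
    rcases Nat.lt_or_ge 0 (vEntry E (n - N)) with h | h
    · obtain ⟨m, rfl⟩ : ∃ m', m = m' + 1 := ⟨m - 1, by omega⟩
      refine ⟨20 * L + (f + 4) * (100 * L), N * ((f + 5) * (100 * L))
        + (N - m) * ((k + 1) * (100 * n)) + 2 * L, ?_, ?_⟩
      · have : N + 1 - (m + 1) = N - m := by omega
        rw [this] at hB
        refine le_trans ?_ hB
        nlinarith
      · refine decodeRound_ends hq hr hNn hL (by omega) (by omega) ?_
        intro _ u hu hur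
        refine Ends.mono (decodeOne_ends hq hur (by omega) hNn hL hf hI.lt) le_rfl ?_
        rintro x ⟨hx, y, -, hy, hxr⟩
        exact ⟨N, m, _, _, hxr, hx.trans (hu.trans hm),
          hI.step_one hq hNn (by omega) hy (by omega), by omega, le_rfl⟩
    · refine ⟨20 * L + ((f + 4) * (100 * L) + (m + 1) * (100 * n)), N * ((f + 5) * (100 * L))
        + (N - m) * ((k + 1) * (100 * n)) + 2 * L, ?_, ?_⟩
      · have : N + 1 - m = N - m + 1 := by omega
        rw [this] at hB
        refine le_trans ?_ hB
        have : (m + 1) * (100 * n) ≤ (k + 1) * (100 * n) := Nat.mul_le_mul_right _ (by omega)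
        nlinarith
      · refine decodeRound_ends hq hr hNn hL (by omega) ?_ (by omega)
        intro _ u hu hur
        refine Ends.mono (decodeZero_ends (d := digit E (n - N)) hq hur (by omega) hNn hL hf hI.lt
          ?_ ?_) le_rfl ?_
        · intro r hrm
          rw [hu, hm, matrixMem_succ_row E hNn (by omega)]
        · intro r hrm
          unfold digit
          split_ifs
          · exact hE.col_lt _ _
          · omega
        · rintro x ⟨hx, y, -, hy, hxr⟩
          exact ⟨N, m, _, _, hxr, hx.trans (hu.trans hm),
            hI.step_zero hE hq hNn (by omega) hy (by omega), by omega, le_rfl⟩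
  · refine ⟨n, k, 0, 0, hs, hmem, ⟨?_, ?_, ?_, ?_, ?_⟩, le_rfl, le_rfl⟩
    · simp [weight]
    · exact Nat.pow_pos (by omega)
    · simp
    · simp
    · simp [Int.ModEq]

theorem decodeProg_ends (hq : 2 ≤ q) (hE : IsExtended q E) (hk : 0 < k) (hkn : k < n) :
    Ends q decodeProg (decodeInput q E) (20000 * (n * (k * (n - k)) * (Nat.log 2 n + 1)))
      (fun t => (t.reg 3 : ℚ) = indexExt q E) := by
  obtain ⟨D, hD⟩ : ∃ D, k * (n - k) = D := ⟨_, rfl⟩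
  have hnD : n ≤ 2 * D := hD ▸ le_two_mul_mul_sub hk hkn
  have hf := mul_sub_le_two_pow hkn
  rw [hD] at hf
  have hlen : ∀ v, v ≤ 8 * D → len q v ≤ 8 * D := fun v => len_le_of_le hq (by omega)
  have hpow : D + D + (D + D) + (D + D + (D + D)) = 8 * D := by omega
  unfold decodeProg
  refine Ends.mono (Ends.seq (B := 9 * (20 * (8 * D))) (Ends.block (K := 20 * (8 * D)) ?_
    (decodeLoop_ends (L := 8 * D) (f := 2 * Nat.log 2 n + 7) hq hE hk hkn (by omega) (by omega)
      (by omega) ?_ ?_))) ?_ fun _ h => h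
  · have l1 := hlen n (by omega)
    have l2 := hlen k (by omega)
    have l3 : len q k * len q (n - k) ≤ D := by
      rw [← hD]
      exact Nat.mul_le_mul (len_le_of_le hq hk le_rfl) (len_le_of_le hq (by omega) le_rfl)
    have l4 := hlen D (by omega)
    have l5 := hlen (D + D) (by omega)
    have l6 := hlen (D + D + (D + D)) (by omega)
    have l7 := hlen (8 * D) le_rfl
    simp only [CostsLe, Instr.cost, Instr.effect, State.setReg, Function.update_apply,
      ↓reduceIte, Nat.reduceEqDiff, and_true, decodeInput, inputReg, len_one, hD, hpow]
    omega
  · constructor <;> simp [effects, Instr.effect, State.setReg, decodeInput, inputReg, hD]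
    · omega
    · rw [hpow]
  · simp [effects, Instr.effect, State.setReg, decodeInput]
  · rw [hD]
    have h1 : (n - k) * ((k + 1) * (100 * n)) ≤ 200 * (n * D) := by
      rw [← hD]
      have : (n - k) * (k + 1) ≤ (n - k) * (2 * k) := Nat.mul_le_mul_left _ (by omega)
      nlinarith
    have h2 : D ≤ n * D := Nat.le_mul_of_pos_left D (by omega)
    obtain ⟨lg, hlg⟩ : ∃ lg, Nat.log 2 n = lg := ⟨_, rfl⟩
    rw [hlg]
    nlinarith [Nat.zero_le (n * D * lg)]

end Decode

/-! ### The bound of the theorem -/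

/-- `n k (n - k) (log₂ n + 1)` digit operations are within the bound of the theorem. -/
theorem exists_const_mul_log_le (K : ℕ) : ∃ C : ℝ, ∀ n k c : ℕ, 3 ≤ n → k < n →
    c ≤ K * (n * (k * (n - k)) * (Nat.log 2 n + 1)) →
    (c : ℝ) ≤ C * (n * k * (n - k) * Real.log n * Real.log (Real.log n)) := by
  have hlog3 : 1 < Real.log 3 := by
    rw [Real.lt_log_iff_exp_lt (by norm_num)]
    exact Real.exp_one_lt_d9.trans (by norm_num)
  -- Since n ≥ 3, log log n is at least this positive number, which can therefore be absorbed into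
  -- the constant.
  have hδ : 0 < Real.log (Real.log 3) := Real.log_pos hlog3
  refine ⟨K * 3 / Real.log (Real.log 3), fun n k c hn hkn hc => ?_⟩
  have hn' : (3 : ℝ) ≤ n := by exact_mod_cast hn
  have h1 : Real.log 3 ≤ Real.log n := Real.log_le_log (by norm_num) hn'
  have h2 : Real.log (Real.log 3) ≤ Real.log (Real.log n) := Real.log_le_log (by linarith) h1
  -- log₂ n ≤ log n / log 2 < 1.5 log n, and 1 < log n.
  have h3 : (Nat.log 2 n : ℝ) + 1 ≤ 3 * Real.log n := by
    have h4 : (Nat.log 2 n : ℝ) * Real.log 2 ≤ Real.log n := by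
      rw [← Real.log_pow]
      refine Real.log_le_log (by positivity) ?_
      exact_mod_cast Nat.pow_log_le_self 2 (by omega)
    have h5 := Real.log_two_gt_d9
    have h6 : (0 : ℝ) ≤ Nat.log 2 n := by positivity
    nlinarith
  have h4 : (c : ℝ) ≤ K * (n * (k * (n - k)) * (Nat.log 2 n + 1)) := by
    have : (c : ℝ) ≤ ((K * (n * (k * (n - k)) * (Nat.log 2 n + 1)) : ℕ) : ℝ) := by
      exact_mod_cast hc
    rw [← Nat.cast_sub hkn.le]
    exact_mod_cast this
  have hk0 : (0 : ℝ) ≤ n - k := by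
    have : (k : ℝ) ≤ n := by exact_mod_cast hkn.le
    linarith
  have hA : (0 : ℝ) ≤ n * (k * (n - k)) := by positivity
  calc (c : ℝ) ≤ K * (n * (k * (n - k)) * (Nat.log 2 n + 1)) := h4
    _ ≤ K * (n * (k * (n - k)) * (3 * Real.log n)) := by gcongr
    _ = K * 3 / Real.log (Real.log 3) * (n * k * (n - k) * Real.log n * Real.log (Real.log 3)) := by
      field_simp
    _ ≤ _ := by
      have : (0 : ℝ) ≤ Real.log n := by linarith
      gcongr

/-! ### The steps of Encoding Algorithm A in natural numbers -/

section AlgA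

variable {q n k i₀ N m i : ℕ}

theorem algA_sub (q k i₀ : ℕ) (hN : N < n) :
    algA q n k i₀ (n - N) = algARound q n k (n - N) (algA q n k i₀ (n - (N + 1))) := by
  rw [show n - N = n - (N + 1) + 1 by omega]
  rfl

theorem algA_of_one (hq : 2 ≤ q) (hN : N < n)
    (hw : (algA q n k i₀ (n - (N + 1))).w + m = k) (hm : 0 < m)
    (hi : (algA q n k i₀ (n - (N + 1))).i = i) (h : q ^ m * gaussNat q N m ≤ i) :
    algA q n k i₀ (n - N)
      = { v := 1, x := q ^ (k - m), w := k - m + 1, i := (i - q ^ m * gaussNat q N m : ℕ) } := by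
  have h1 : (algA q n k i₀ (n - (N + 1))).w = k - m := by omega
  have h2 : k - (k - m) = m := by omega
  have h3 : n - (n - N) = N := by omega
  rw [algA_sub q k i₀ hN, algARound, hi, h1, h2, h3, gauss_eq_gaussNat hq, if_neg (by omega),
    if_pos (by exact_mod_cast h)]
  congr 1
  push_cast [h]
  rfl

theorem algA_of_zero (hq : 2 ≤ q) (hN : N < n)
    (hw : (algA q n k i₀ (n - (N + 1))).w + m = k) (hm : 0 < m)
    (hi : (algA q n k i₀ (n - (N + 1))).i = i) (h : i < q ^ m * gaussNat q N m) :
    algA q n k i₀ (n - N)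
      = { v := 0, x := i / gaussNat q N m * q ^ (k - m), w := k - m,
          i := (i % gaussNat q N m : ℕ) } := by
  have h1 : (algA q n k i₀ (n - (N + 1))).w = k - m := by omega
  have h2 : k - (k - m) = m := by omega
  have h3 : n - (n - N) = N := by omega
  rw [algA_sub q k i₀ hN, algARound, hi, h1, h2, h3, gauss_eq_gaussNat hq, if_neg (by omega),
    if_neg (by rw [not_le]; exact_mod_cast h), Nat.floor_div_eq_div]
  congr 1
  rw [← sub_div_mul_self, Nat.cast_sub (Nat.div_mul_le_self _ _)]
  push_cast
  rfl

/-- The program stops once the weight is k; by this lemma the untouched zeros in the memory are then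
the right entries. -/
theorem algA_of_weight_eq {j j' : ℕ} (hw : (algA q n k i₀ j).w = k) (hj : j < j') :
    (algA q n k i₀ j').v = 0 ∧ (algA q n k i₀ j').x = 0 ∧ (algA q n k i₀ j').w = k := by
  induction j', hj using Nat.le_induction with
  | base => simp [algA, algARound, hw]
  | succ j' _ ih => simp [algA, algARound, ih.2.2]

/-- Entry of the output of Encoding Algorithm A, with row and column as natural numbers. -/
def algEntry (q n k i₀ r c : ℕ) : ℕ :=
  if r = 0 then (algA q n k i₀ (n - c)).v else (algA q n k i₀ (n - c)).x / q ^ (k - r) % q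

theorem algAOutput_eq (r : Fin (k + 1)) (c : Fin n) :
    algAOutput q n k i₀ r c = algEntry q n k i₀ r c := by
  unfold algAOutput algEntry
  refine Fin.cases ?_ (fun s => ?_) r
  · simp
  · simp only [Fin.cases_succ, Fin.val_succ, Nat.add_eq_zero_iff, one_ne_zero, and_false, if_false]
    rw [Nat.sub_sub, add_comm 1]

/-- Row r holds the digit of weight q^(k-r). The factor q^(k-m) puts the last digit of c into row m
and zeros below it. -/
theorem mul_pow_div_pow_mod (hq : 2 ≤ q) (hm : m ≤ k) {c r : ℕ} (hrk : r ≤ k) :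
    c * q ^ (k - m) / q ^ (k - r) % q = if r ≤ m then c / q ^ (m - r) % q else 0 := by
  have hq0 : 0 < q := by omega
  split_ifs with h
  · rw [show k - r = (m - r) + (k - m) by omega, pow_add,
      Nat.mul_div_mul_right _ _ (Nat.pow_pos hq0)]
  · rw [show k - m = (r - m - 1) + 1 + (k - r) by omega, pow_add, ← mul_assoc,
      Nat.mul_div_cancel _ (Nat.pow_pos hq0), pow_succ, ← mul_assoc, Nat.mul_mod_left]

theorem algEntry_of_zero (hq : 2 ≤ q) (hm : m ≤ k) {c r w : ℕ} {j : ℚ} (hrk : r ≤ k)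
    (h : algA q n k i₀ (n - N) = { v := 0, x := c * q ^ (k - m), w := w, i := j }) :
    algEntry q n k i₀ r N = if 1 ≤ r ∧ r ≤ m then c / q ^ (m - r) % q else 0 := by
  rw [algEntry, h]
  rcases Nat.eq_zero_or_pos r with rfl | hr
  · simp
  · rw [if_neg hr.ne', mul_pow_div_pow_mod hq hm hrk]
    simp only [show 1 ≤ r from hr, true_and]

theorem algEntry_of_one (hq : 2 ≤ q) (hm : m ≤ k) (hm1 : 1 ≤ m) {r w : ℕ} {j : ℚ} (hrk : r ≤ k)
    (h : algA q n k i₀ (n - N) = { v := 1, x := q ^ (k - m), w := w, i := j }) :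
    algEntry q n k i₀ r N = if r = 0 ∨ r = m then 1 else 0 := by
  rw [algEntry, h]
  rcases Nat.eq_zero_or_pos r with rfl | hr
  · simp
  · have h1 := mul_pow_div_pow_mod hq hm (c := 1) hrk
    rw [one_mul] at h1
    rw [if_neg hr.ne', h1]
    by_cases h2 : r = m
    · subst h2
      simp [Nat.mod_eq_of_lt (show 1 < q from hq)]
    · rw [if_neg (show ¬ (r = 0 ∨ r = m) by omega)]
      split_ifs with h3
      · rw [Nat.div_eq_of_lt (Nat.one_lt_pow (by omega) (by omega)), Nat.zero_mod]
      · rfl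

end AlgA

/-! ### Fixed-point arithmetic -/

/-- If `x` approximates `I / A` from above with error `e / A`, and `y` is
`x (q^a - 1) / (q^b - 1)` rounded up with error at most `4 L`, then `y` approximates `I / A'` for
`A' = A (q^b - 1) / (q^a - 1)`. -/
theorem approx_of_ratio {q L a b A A' x y I e M : ℕ} (hq : 2 ≤ q) (ha : 1 ≤ a)
    (hA : (A : ℤ) * ((q : ℤ) ^ b - 1) = A' * ((q : ℤ) ^ a - 1))
    (h1 : (x : ℤ) * ((q : ℤ) ^ a - 1) ≤ y * ((q : ℤ) ^ b - 1))
    (h2 : (y : ℤ) * ((q : ℤ) ^ b - 1) ≤ x * ((q : ℤ) ^ a - 1) + 4 * L * ((q : ℤ) ^ b - 1))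
    (hM : A' ≤ M) (hl : I ≤ x * A) (hu : x * A ≤ I + e) :
    I ≤ y * A' ∧ y * A' ≤ I + (e + 4 * L * M) := by
  have hα : (0 : ℤ) < (q : ℤ) ^ a - 1 := by
    have : (1 : ℤ) < (q : ℤ) ^ a := one_lt_pow₀ (by exact_mod_cast hq) (by omega)
    omega
  have hA0 : (0 : ℤ) ≤ A := by positivity
  -- y A' (q^a - 1) = y A (q^b - 1), so this is `h1` multiplied by A; the other estimate comes from
  -- `h2` in the same way.
  have e1 : (x : ℤ) * A ≤ y * A' := by
    refine le_of_mul_le_mul_right (a := (q : ℤ) ^ a - 1) ?_ hα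
    have := mul_le_mul_of_nonneg_right h1 hA0
    linear_combination this + y * hA
  have e2 : (y : ℤ) * A' ≤ x * A + 4 * L * A' := by
    refine le_of_mul_le_mul_right (a := (q : ℤ) ^ a - 1) ?_ hα
    have := mul_le_mul_of_nonneg_right h2 hA0
    linear_combination this + (4 * L - y) * hA
  have e3 : 4 * L * A' ≤ 4 * L * M := Nat.mul_le_mul_left _ hM
  norm_cast at e1 e2
  omega

/-- If c = ⌊T/R⌋ exceeded i/G, then c G ≥ i + 1 and (i + 1) R ≤ T G ≤ i R + e with e < R. The
opposite inequality is immediate, as T/R approximates from above. -/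
theorem div_eq_of_approx {T G i R e : ℕ} (hG : 0 < G) (he : e < R) (hl : i * R ≤ T * G)
    (hu : T * G ≤ i * R + e) : T / R = i / G := by
  have hR : 0 < R := by omega
  apply le_antisymm
  · rw [Nat.le_div_iff_mul_le hG]
    by_contra h
    have h1 : i + 1 ≤ T / R * G := by omega
    have h2 : T / R * R ≤ T := Nat.div_mul_le_self _ _
    nlinarith [Nat.mul_le_mul_right R h1, Nat.mul_le_mul_right G h2]
  · rw [Nat.le_div_iff_mul_le hR]
    refine Nat.le_of_mul_le_mul_right ?_ hG
    have h2 : i / G * G ≤ i := Nat.div_mul_le_self _ _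
    nlinarith [Nat.mul_le_mul_right R h2]

/-- The invariant of the encoding: with `N` columns left which hold `m` leading entries, `T / q^P`
approximates the quotient of the rest `i` and the Gaussian coefficient from above. -/
structure EncodeInv (q P U n k i₀ N m T i : ℕ) : Prop where
  weight : (algA q n k i₀ (n - N)).w + m = k
  rest : (algA q n k i₀ (n - N)).i = i
  lt : i < gaussNat q N m
  lower : i * q ^ P ≤ T * gaussNat q N m
  -- k roundings come from the initial division, and at most two from each column already written.
  upper : T * gaussNat q N m ≤ i * q ^ P + (k + 2 * (n - N)) * U

section EncodeInv

variable {q P U n k i₀ N m T i : ℕ}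

theorem EncodeInv.le (h : EncodeInv q P U n k i₀ N m T i) : m ≤ N := by
  by_contra hlt
  have := h.lt
  rw [gaussNat_eq_zero q (by omega)] at this
  omega

theorem EncodeInv.error_lt (hU : (k + 2 * n) * U < q ^ P) (N : ℕ) :
    (k + 2 * (n - N)) * U < q ^ P :=
  (Nat.mul_le_mul_right U (by omega)).trans_lt hU

theorem EncodeInv.lt_pow (h : EncodeInv q P U n k i₀ N m T i) (hU : (k + 2 * n) * U < q ^ P) :
    T < q ^ P := by
  have h1 := EncodeInv.error_lt hU N
  have h2 := h.upper
  have h3 := h.lt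
  by_contra hle
  rw [not_lt] at hle
  nlinarith [Nat.mul_le_mul_right (q ^ P) h3, Nat.mul_le_mul_right (gaussNat q N m) hle]

/-- All remaining columns carry leading entries, and the old and the new coefficient are both 1, so
T and i stay. The general step would divide by q^0 - 1 here. -/
theorem EncodeInv.step_full (h : EncodeInv q P U n k i₀ (N + 1) (m + 1) T i) (hq : 2 ≤ q)
    (hN : N < n) (hNm : N < m + 1) :
    EncodeInv q P U n k i₀ N m T i ∧ ∀ r ≤ k,
      algEntry q n k i₀ r N = if r = 0 ∨ r = m + 1 then 1 else 0 := by
  have hle := h.le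
  obtain ⟨hw, hi, hlt, hl, hu⟩ := h
  obtain rfl : N = m := by omega
  have hA := algA_of_one (N := N) hq hN hw (by omega) hi
    (by rw [gaussNat_eq_zero q (by omega)]; simp)
  rw [gaussNat_self] at hlt hl hu
  refine ⟨⟨?_, ?_, ?_, ?_, ?_⟩, fun r hr => algEntry_of_one hq (by omega) (by omega) hr hA⟩
  · rw [hA]; simp only; omega
  · rw [hA, gaussNat_eq_zero q (by omega : N < N + 1)]; simp
  · rwa [gaussNat_self]
  · rwa [gaussNat_self]
  · rw [gaussNat_self]
    exact hu.trans (Nat.add_le_add_left (Nat.mul_le_mul_right _ (by omega)) _)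

/-- The approximation after the multiplication by the ratio of two Gaussian coefficients. -/
structure EncodeMid (q P U n k i₀ N m T i : ℕ) : Prop where
  weight : (algA q n k i₀ (n - (N + 1))).w + m = k
  rest : (algA q n k i₀ (n - (N + 1))).i = i
  lt : i < gaussNat q (N + 1) m
  lower : i * q ^ P ≤ T * gaussNat q N m
  upper : T * gaussNat q N m ≤ i * q ^ P + (k + 2 * (n - (N + 1)) + 1) * U

theorem EncodeInv.mid {L : ℕ} (h : EncodeInv q P (4 * L * q ^ (2 * (k * (n - k)))) n k i₀
      (N + 1) m T i)
    (hq : 2 ≤ q) (hm : m ≤ N) (hmn : N + k ≤ n + m) {y : ℕ}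
    (h1 : (T : ℤ) * ((q : ℤ) ^ (N + 1) - 1) ≤ y * ((q : ℤ) ^ (N + 1 - m) - 1))
    (h2 : (y : ℤ) * ((q : ℤ) ^ (N + 1 - m) - 1)
      ≤ T * ((q : ℤ) ^ (N + 1) - 1) + 4 * L * ((q : ℤ) ^ (N + 1 - m) - 1)) :
    EncodeMid q P (4 * L * q ^ (2 * (k * (n - k)))) n k i₀ N m y i := by
  obtain ⟨hw, hi, hlt, hl, hu⟩ := h
  obtain ⟨e1, e2⟩ := approx_of_ratio hq (by omega) (gaussNat_succ_mul hq hm) h1 h2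
    (gaussNat_le_pow_of_le hq hm (by omega : m ≤ k) hmn) hl hu
  exact ⟨hw, hi, hlt, e1, e2.trans_eq (by ring)⟩

theorem EncodeMid.div_eq (h : EncodeMid q P U n k i₀ N m T i) (hU : (k + 2 * n) * U < q ^ P)
    (hm : m ≤ N) (hN : N < n) : T / q ^ P = i / gaussNat q N m :=
  div_eq_of_approx (gaussNat_pos hm)
    ((Nat.mul_le_mul_right U (by omega)).trans_lt hU) h.lower h.upper

theorem EncodeMid.le_pow (h : EncodeMid q P U n k i₀ N m T i) (hU : (k + 2 * n) * U < q ^ P)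
    (hm : m ≤ N) (hN : N < n) : T ≤ gaussNat q (N + 1) m * q ^ P := by
  have h1 : (k + 2 * (n - (N + 1)) + 1) * U < q ^ P :=
    (Nat.mul_le_mul_right U (by omega)).trans_lt hU
  have h2 := h.upper
  have h3 := Nat.mul_le_mul_right (q ^ P) h.lt
  have h4 := Nat.le_mul_of_pos_right T (gaussNat_pos (q := q) hm)
  rw [Nat.succ_mul] at h3
  omega

/-- The integer part of T / q^P is the exact quotient c, so taking c q^P from T and c G from i
leaves the error T G - i q^P unchanged. -/
theorem EncodeMid.step_zero (h : EncodeMid q P U n k i₀ N m T i) (hq : 2 ≤ q)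
    (hU : (k + 2 * n) * U < q ^ P) (hm : m ≤ N) (hm0 : 0 < m) (hN : N < n)
    (hc : T / q ^ P < q ^ m) :
    EncodeInv q P U n k i₀ N m (T - T / q ^ P * q ^ P) (i % gaussNat q N m) ∧ ∀ r ≤ k,
      algEntry q n k i₀ r N
        = if 1 ≤ r ∧ r ≤ m then T / q ^ P / q ^ (m - r) % q else 0 := by
  have hdiv := h.div_eq hU hm hN
  obtain ⟨hw, hi, hlt, hl, hu⟩ := h
  have hG := gaussNat_pos (q := q) hm
  rw [hdiv] at hc ⊢
  have hA := algA_of_zero hq hN hw hm0 hi ((Nat.div_lt_iff_lt_mul hG).1 hc)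
  have hdm := Nat.div_add_mod' i (gaussNat q N m)
  set c := i / gaussNat q N m with hcdef
  have hcT : c * q ^ P ≤ T := by
    rw [← hdiv]; exact Nat.div_mul_le_self _ _
  obtain ⟨T', rfl⟩ := Nat.exists_eq_add_of_le hcT
  rw [Nat.add_sub_cancel_left]
  refine ⟨⟨?_, ?_, Nat.mod_lt _ hG, ?_, ?_⟩, fun r hr => algEntry_of_zero hq (by omega) hr hA⟩
  · rw [hA]; simp only; omega
  · rw [hA]
  · rw [← hdm] at hl
    nlinarith
  · rw [← hdm] at hu
    have : (k + 2 * (n - (N + 1)) + 1) * U ≤ (k + 2 * (n - N)) * U :=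
      Nat.mul_le_mul_right _ (by omega)
    nlinarith

/-- Comparing the exact quotient with q^(m+1) is the test of Algorithm A. The coefficient then
passes from [N; m+1] to [N; m], which is the second rounding of the round; Pascal's rule puts the
new rest below [N; m]. -/
theorem EncodeMid.step_one {L : ℕ}
    (h : EncodeMid q P (4 * L * q ^ (2 * (k * (n - k)))) n k i₀ N (m + 1) T i) (hq : 2 ≤ q)
    (hU : (k + 2 * n) * (4 * L * q ^ (2 * (k * (n - k)))) < q ^ P) (hm : m + 1 ≤ N) (hN : N < n)
    (hmn : N + k ≤ n + m) (hc : q ^ (m + 1) ≤ T / q ^ P) {y : ℕ}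
    (h1 : ((T - q ^ (m + 1) * q ^ P : ℕ) : ℤ) * ((q : ℤ) ^ (N - m) - 1)
      ≤ y * ((q : ℤ) ^ (m + 1) - 1))
    (h2 : (y : ℤ) * ((q : ℤ) ^ (m + 1) - 1)
      ≤ (T - q ^ (m + 1) * q ^ P : ℕ) * ((q : ℤ) ^ (N - m) - 1)
        + 4 * L * ((q : ℤ) ^ (m + 1) - 1)) :
    EncodeInv q P (4 * L * q ^ (2 * (k * (n - k)))) n k i₀ N m y
        (i - q ^ (m + 1) * gaussNat q N (m + 1)) ∧ ∀ r ≤ k,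
      algEntry q n k i₀ r N = if r = 0 ∨ r = m + 1 then 1 else 0 := by
  have hdiv := h.div_eq hU hm hN
  obtain ⟨hw, hi, hlt, hl, hu⟩ := h
  have hG := gaussNat_pos (q := q) hm
  have hcT : q ^ (m + 1) * q ^ P ≤ T :=
    (Nat.mul_le_mul_right _ hc).trans (Nat.div_mul_le_self _ _)
  rw [hdiv, Nat.le_div_iff_mul_le hG] at hc
  have hA := algA_of_one hq hN hw (by omega) hi hc
  obtain ⟨T', rfl⟩ := Nat.exists_eq_add_of_le hcT
  obtain ⟨i', hi'⟩ := Nat.exists_eq_add_of_le hc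
  rw [Nat.add_sub_cancel_left] at h1 h2
  rw [hi', Nat.add_sub_cancel_left] at hA ⊢
  rw [hi'] at hl hu hlt
  have e1 : i' * q ^ P ≤ T' * gaussNat q N (m + 1) := by nlinarith
  have e2 : T' * gaussNat q N (m + 1) ≤ i' * q ^ P
      + (k + 2 * (n - (N + 1)) + 1) * (4 * L * q ^ (2 * (k * (n - k)))) := by nlinarith
  obtain ⟨e3, e4⟩ := approx_of_ratio hq (by omega) (gaussNat_mul_succ hq (by omega : m ≤ N)) h1 h2
    (gaussNat_le_pow_of_le hq (by omega : m ≤ N) (by omega : m ≤ k) hmn) e1 e2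
  refine ⟨⟨?_, ?_, ?_, e3, e4.trans_eq ?_⟩,
    fun r hr => algEntry_of_one hq (by omega) (by omega) hr hA⟩
  · rw [hA]; simp only; omega
  · rw [hA]
  · rw [gaussNat_succ_succ] at hlt
    omega
  · rw [show n - N = n - (N + 1) + 1 by omega]
    ring

end EncodeInv

/-! ### The encoding program -/

/-- The registers between the rounds of the encoding. -/
structure EncodeRegs (q n L P N m T : ℕ) (t : State) : Prop where
  r1 : t.reg 1 = n
  r3 : t.reg 3 = T
  r4 : t.reg 4 = 0
  r5 : t.reg 5 = N
  r6 : t.reg 6 = m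
  r7 : t.reg 7 = m * n
  r8 : t.reg 8 = P
  r10 : t.reg 10 = L
  r12 : t.reg 12 = 1

theorem EncodeRegs.of_reg_eq {q n L P N m T : ℕ} {s t : State} (h : EncodeRegs q n L P N m T s)
    (hs : ∀ r < 20, t.reg r = s.reg r) : EncodeRegs q n L P N m T t := by
  obtain ⟨h1, h3, h4, h5, h6, h7, h8, h10, h12⟩ := h
  constructor <;> rw [hs _ (by norm_num)] <;> assumption

/-- Write a column with a leading entry. -/
def markOne : Prog :=
  block (.store 5 12) [.add 33 7 5, .store 33 12, .sub 6 6 12, .sub 7 7 1]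

/-- Write the digits of register `30` upwards into the column at position `N`, from row `m` on. -/
def writeDigits : Prog :=
  .seq (.instr (.add 31 7 5))
    (.whileLt 4 30 (block (.shr 33 30 12) [.shl 34 33 12, .sub 34 30 34, .store 31 34,
      .copy 30 33, .sub 31 31 1]))

theorem mul_add_eq_mul_add_iff {n r r' c c' : ℕ} (hc : c < n) (hc' : c' < n) :
    r * n + c = r' * n + c' ↔ r = r' ∧ c = c' := by
  constructor
  · intro h
    have h1 : r = r' := by
      have h2 := congrArg (· / n) h
      simpa [mul_comm _ n, Nat.mul_add_div (by omega : 0 < n), Nat.div_eq_of_lt hc,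
        Nat.div_eq_of_lt hc'] using h2
    subst h1
    exact ⟨rfl, by omega⟩
  · rintro ⟨rfl, rfl⟩
    rfl

/-! ### Writing a column. -/

section Writing

variable {q n L P N m T : ℕ} {s : State}

theorem markOne_ends (hq : 2 ≤ q) (hs : EncodeRegs q n L P N (m + 1) T s) (hN : N < n)
    (hm : m + 1 < n) (hL : n ≤ L) :
    Ends q markOne s (20 * L) (fun t => EncodeRegs q n L P N m T t ∧ ∀ r c, c < n →
      t.mem (r * n + c) = if c = N ∧ (r = 0 ∨ r = m + 1) then 1 else s.mem (r * n + c)) := by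
  have hlen : ∀ v, v ≤ n * n → len q v ≤ 2 * n := fun v => len_le_of_le_sq hq (by omega)
  obtain ⟨h1, h3, h4, h5, h6, h7, h8, h10, h12⟩ := hs
  have e1 : (m + 1) * n + N ≤ n * n := by nlinarith
  have e2 : n ≤ n * n := Nat.le_mul_self n
  unfold markOne
  refine Ends.mono (Ends.block (K := 4 * n) ?_ ⟨?_, ?_⟩)
    (by simp only [List.length_cons, List.length_nil]; omega) fun _ h => h
  · have l1 := hlen N (by omega)
    have l2 := hlen ((m + 1) * n) (by omega)
    have l3 := hlen ((m + 1) * n + N) e1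
    have l4 := hlen n e2
    have l5 := hlen (m + 1) (by omega)
    simp only [CostsLe, Instr.cost, Instr.effect, State.setReg, Function.update_apply,
      ↓reduceIte, Nat.reduceEqDiff, and_true, h1, h5, h6, h7, h12, len_one]
    omega
  · constructor <;> simp [effects, Instr.effect, State.setReg, *]
    rw [Nat.succ_mul, Nat.add_sub_cancel]
  · intro r c hc
    have e3 : r * n + c = N ↔ r = 0 ∧ c = N := by
      have := mul_add_eq_mul_add_iff (r := r) (r' := 0) hc hN
      rwa [zero_mul, zero_add] at this
    simp only [effects, Instr.effect, State.setReg, Function.update_apply,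
      ↓reduceIte, Nat.reduceEqDiff, h5, h7, h12, mul_add_eq_mul_add_iff hc hN, e3]
    split_ifs <;> first | rfl | omega

/-- The loop stops as soon as the remaining number is 0, so leading zero digits are never written;
`hmem` guarantees that they are already there. -/
theorem writeDigits_ends {c : ℕ} (hq : 2 ≤ q) (hs : EncodeRegs q n L P N m T s) (hN : N < n)
    (hm : m < n) (h30 : s.reg 30 = c) (hc : c < q ^ m)
    (hmem : ∀ r, 1 ≤ r → r ≤ m → s.mem (r * n + N) = 0) :
    Ends q writeDigits s ((m + 1) * (100 * n)) (fun t => EncodeRegs q n L P N m T t ∧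
      ∀ r c', c' < n → t.mem (r * n + c')
        = if c' = N ∧ 1 ≤ r ∧ r ≤ m then c / q ^ (m - r) % q else s.mem (r * n + c')) := by
  have hlen : ∀ v, v ≤ n * n → len q v ≤ 2 * n := fun v => len_le_of_le_sq hq (by omega)
  have e1 : m * n + N ≤ n * n := by nlinarith
  have e2 : n ≤ n * n := Nat.le_mul_self n
  have hlc : ∀ v, v ≤ c → len q v ≤ 2 * n := fun v hv =>
    len_le_of_lt_pow (by omega) ((hv.trans_lt hc).trans_le
      (Nat.pow_le_pow_right (by omega) (by omega)))
  unfold writeDigits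
  refine Ends.mono (Ends.seq (B := 4 * n) (B' := m * (60 * n + 4 * n) + 4 * n)
    (Ends.instr ?_ ?_)) (by nlinarith) fun _ h => h
  · have l1 := hlen N (by omega)
    have l2 := hlen (m * n) (by omega)
    simp only [Instr.cost, hs.r5, hs.r7]
    omega
  · refine Ends.whileLt_fuel (K := 60 * n) (K' := 4 * n) (fun g t => EncodeRegs q n L P N m T t ∧
      ∃ i, i + g = m ∧ t.reg 30 = c / q ^ i ∧ t.reg 31 = g * n + N ∧
        ∀ r c', c' < n → t.mem (r * n + c')
          = if c' = N ∧ g < r ∧ r ≤ m then c / q ^ (m - r) % q else s.mem (r * n + c'))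
      ?_ ?_ ?_ m _ ?_ le_rfl
    · rintro g t ⟨hr, i, hi, h30, h31, ht⟩
      have := hlc (c / q ^ i) (Nat.div_le_self _ _)
      rw [h30, hr.r4, len_zero]
      omega
    · rintro g t ⟨hr, i, hi, h30, h31, ht⟩ hlt
      rw [h30, hr.r4] at hlt
      refine ⟨hr, fun r c' hc' => ?_⟩
      rw [ht r c' hc']
      by_cases h1 : c' = N ∧ 1 ≤ r ∧ r ≤ m
      · rw [if_pos h1]
        split_ifs with h2
        · rfl
        · obtain ⟨rfl, h1, h1'⟩ := h1
          rw [hmem r h1 h1', show m - r = i + (m - r - i) by omega, pow_add,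
            ← Nat.div_div_eq_div_mul, show c / q ^ i = 0 by omega, Nat.zero_div, Nat.zero_mod]
      · rw [if_neg h1, if_neg (by omega)]
    · rintro g t ⟨hr, i, hi, h30, h31, ht⟩ hlt
      rw [h30, hr.r4] at hlt
      obtain ⟨g, rfl⟩ : ∃ g', g = g' + 1 := by
        refine Nat.exists_eq_succ_of_ne_zero fun h0 => ?_
        rw [show i = m by omega, Nat.div_eq_of_lt hc] at hlt
        omega
      obtain ⟨h1, h3, h4, h5, h6, h7, h8, h10, h12⟩ := hr
      refine ⟨g, rfl, Ends.mono (Ends.block (K := 10 * n) ?_ ?_)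
        (by simp only [List.length_cons, List.length_nil]; omega) fun _ h => h⟩
      · have d1 : c / q ^ i ≤ c := Nat.div_le_self _ _
        have d2 : c / q ^ i / q ≤ c := (Nat.div_le_self _ _).trans d1
        have l1 := hlc _ d1
        have l2 := hlc _ d2
        have l3 := hlc (c / q ^ i / q * q) ((Nat.div_mul_le_self _ _).trans d1)
        have l4 := hlc (c / q ^ i % q) ((Nat.mod_le _ _).trans d1)
        have l5 := hlen ((g + 1) * n + N) (by nlinarith)
        have l6 := hlen n e2
        simp only [CostsLe, Instr.cost, Instr.effect, State.setReg, Function.update_apply,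
          ↓reduceIte, Nat.reduceEqDiff, and_true, h1, h12, h30, h31, len_one, pow_one,
          sub_div_mul_self]
        omega
      · refine ⟨?_, i + 1, by omega, ?_, ?_, ?_⟩
        · constructor <;> simp [effects, Instr.effect, State.setReg, *]
        · simp only [effects, Instr.effect, State.setReg, Function.update_apply,
            ↓reduceIte, Nat.reduceEqDiff, h12, h30, pow_one]
          rw [Nat.div_div_eq_div_mul, pow_succ]
        · simp only [effects, Instr.effect, State.setReg, Function.update_apply,
            ↓reduceIte, Nat.reduceEqDiff, h1, h31]
          rw [Nat.succ_mul]
          omega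
        · intro r c' hc'
          simp only [effects, Instr.effect, State.setReg, Function.update_apply,
            ↓reduceIte, Nat.reduceEqDiff, h12, h30, h31, pow_one, sub_div_mul_self,
            mul_add_eq_mul_add_iff hc' hN, ht r c' hc']
          by_cases h : r = g + 1 ∧ c' = N
          · rw [if_pos h, if_pos (by omega), show m - r = i by omega]
          · rw [if_neg h]
            congr 1
            simp only [eq_iff_iff]
            omega
    · refine ⟨?_, 0, by omega, ?_, ?_, ?_⟩
      · exact hs.of_reg_eq fun r hr => by
          simp [Instr.effect, State.setReg, show r ≠ 31 by omega]
      · simp [Instr.effect, State.setReg, h30]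
      · simp [Instr.effect, State.setReg, hs.r5, hs.r7]
      · intro r c' hc'
        rw [if_neg (by omega)]
        rfl

end Writing

/-- Column without a leading entry, whose number is in register `30`. -/
def encodeZero : Prog :=
  .seq (block (.shl 32 30 8) [.sub 3 20 32]) writeDigits

/-- Column with a leading entry; `q^m` is in register `31`. -/
def encodeOne : Prog :=
  .seq (block (.shl 32 31 8) [.sub 20 20 32, .sub 21 5 6, .add 21 21 12, .copy 22 6]) <|
  .seq ceilRatio <|
  .seq (.instr (.copy 3 20)) markOne

/-- One round of the encoding. -/
def encodeRound : Prog :=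
  .seq (.instr (.sub 5 5 12)) <|
  -- With fewer other columns left than leading entries, this entry is forced, and the ratio below
  -- would have the divisor q^0 - 1.
  .ifLt 5 6 markOne <|
  .seq (block (.copy 20 3) [.add 21 5 12, .sub 22 21 6]) <|
  .seq ceilRatio <|
  .seq (block (.shr 30 20 8) [.shl 31 12 6]) <|
  .ifLt 30 31 encodeZero encodeOne

/-- Divide register `3` by the Gaussian coefficient. -/
def divideByGauss : Prog :=
  .whileLt 14 2 <|
  .seq (block (.copy 20 3) [.add 21 14 12, .add 22 13 21]) <|
  .seq ceilRatio <|
  block (.copy 3 20) [.add 14 14 12]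

/-- The encoding program. -/
def encodeProg : Prog :=
  -- P = 16 k (n - k) and L = 2 P; the shift of register `3` turns i into the fixed-point number i
  -- q^P.
  .seq (block (.const 12 1) [.sub 13 1 2, .mul 10 2 13, .add 10 10 10, .add 10 10 10,
      .add 10 10 10, .add 10 10 10, .copy 8 10, .add 10 10 10, .shl 3 3 8]) <|
  .seq divideByGauss <|
  .seq (block (.copy 5 1) [.copy 6 2, .mul 7 2 1]) <|
  .whileLt 4 6 encodeRound

section EncodeRound

variable {q n L P N m T f : ℕ} {s : State}

theorem encodeZero_ends {y c : ℕ} (hq : 2 ≤ q) (hs : EncodeRegs q n L P N m T s) (hN : N < n)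
    (hm : m < n) (hL : n ≤ L) (hP : P ≤ L) (h20 : s.reg 20 = y) (h30 : s.reg 30 = c)
    (hcy : c * q ^ P ≤ y) (hy : y < q ^ L)
    (hc : c < q ^ m) (hmem : ∀ r, 1 ≤ r → r ≤ m → s.mem (r * n + N) = 0) :
    Ends q encodeZero s (20 * L + (m + 1) * (100 * n)) (fun t =>
      EncodeRegs q n L P N m (y - c * q ^ P) t ∧
      ∀ r c', c' < n → t.mem (r * n + c')
        = if c' = N ∧ 1 ≤ r ∧ r ≤ m then c / q ^ (m - r) % q else s.mem (r * n + c')) := by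
  have hlen : ∀ v, v < q ^ L → len q v ≤ L := fun v => len_le_of_lt_pow (by omega)
  have hcl : c ≤ c * q ^ P := Nat.le_mul_of_pos_right c (Nat.pow_pos (by omega))
  unfold encodeZero
  refine Ends.mono (Ends.seq (B := 2 * (4 * L)) (Ends.block (K := 4 * L) ?_
    (Ends.mono (writeDigits_ends (L := L) (P := P) (T := y - c * q ^ P) (c := c) hq ?_ hN hm ?_
      hc ?_) le_rfl ?_))) (by omega) fun _ h => h
  · have l1 := hlen c (by omega)
    have l2 := hlen y hy
    have l3 := hlen (c * q ^ P) (by omega)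
    have l4 : len q P ≤ L := len_le_of_le hq (by omega) hP
    simp only [CostsLe, Instr.cost, Instr.effect, State.setReg, Function.update_apply,
      ↓reduceIte, Nat.reduceEqDiff, and_true, hs.r8, h20, h30]
    omega
  · obtain ⟨h1, h3, h4, h5, h6, h7, h8, h10, h12⟩ := hs
    constructor <;> simp [effects, Instr.effect, State.setReg, *]
  · simp [effects, Instr.effect, State.setReg, h30]
  · simpa [effects, Instr.effect, State.setReg] using hmem
  · rintro t ⟨ht, hmt⟩
    refine ⟨ht, fun r c' hc' => ?_⟩
    rw [hmt r c' hc']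
    rfl

theorem encodeOne_ends {y : ℕ} (hq : 2 ≤ q) (hs : EncodeRegs q n L P N (m + 1) T s) (hN : N < n)
    (hm : m + 1 < n) (hmN : m + 1 ≤ N) (hL : n ≤ L) (hP : P ≤ L) (hf : L ≤ 2 ^ f)
    (h20 : s.reg 20 = y) (h31 : s.reg 31 = q ^ (m + 1)) (hcy : q ^ (m + 1) * q ^ P ≤ y)
    (hy : y * q ^ n < q ^ L) :
    Ends q encodeOne s ((f + 4) * (100 * L)) (fun t => ∃ z : ℕ,
      ((y - q ^ (m + 1) * q ^ P : ℕ) : ℤ) * ((q : ℤ) ^ (N - m) - 1)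
        ≤ z * ((q : ℤ) ^ (m + 1) - 1) ∧
      (z : ℤ) * ((q : ℤ) ^ (m + 1) - 1)
        ≤ (y - q ^ (m + 1) * q ^ P : ℕ) * ((q : ℤ) ^ (N - m) - 1)
          + 4 * L * ((q : ℤ) ^ (m + 1) - 1) ∧
      EncodeRegs q n L P N m z t ∧
      ∀ r c', c' < n → t.mem (r * n + c')
        = if c' = N ∧ (r = 0 ∨ r = m + 1) then 1 else s.mem (r * n + c')) := by
  have hq0 : 0 < q := by omega
  have hlen : ∀ v, v < q ^ L → len q v ≤ L := fun v => len_le_of_lt_pow (by omega)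
  have hlenle : ∀ v, v ≤ L → len q v ≤ L := fun v => len_le_of_le hq (by omega)
  have hcl : q ^ (m + 1) ≤ q ^ (m + 1) * q ^ P := Nat.le_mul_of_pos_right _ (Nat.pow_pos hq0)
  have hyL : y < q ^ L := (Nat.le_mul_of_pos_right y (Nat.pow_pos hq0)).trans_lt hy
  unfold encodeOne
  set s₁ := effects q [.shl 32 31 8, .sub 20 20 32, .sub 21 5 6, .add 21 21 12, .copy 22 6] s
    with hs₁
  have hss : SameLow s s₁ := by
    simp only [hs₁, effects, Instr.effect]
    repeat' first | exact SameLow.refl s | refine SameLow.setReg ?_ (by norm_num) _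
  have hr := hs.of_reg_eq hss.2
  refine Ends.mono (Ends.seq (B := 5 * (4 * L)) (B' := (f + 2) * (100 * L) + (6 * L + 20 * L))
    (Ends.block (K := 4 * L) ?_ (Ends.seq (Ends.mono (ceilRatio_ends
      (x := y - q ^ (m + 1) * q ^ P) (a := N - m) (b := m + 1) (f := f) (s := s₁) hq
      hr.r10 hr.r12 ?_ ?_ ?_ ?_ (by omega) (by omega) (by omega) hf) le_rfl ?_)))) ?_
      fun _ h => h
  · have l1 := hlen y hyL
    have l2 := hlen (q ^ (m + 1)) (by omega)
    have l3 := hlen (q ^ (m + 1) * q ^ P) (by omega)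
    have l4 := hlenle P hP
    have l5 := hlenle N (by omega)
    have l6 := hlenle (m + 1) (by omega)
    have l7 := hlenle (N - (m + 1)) (by omega)
    simp only [CostsLe, Instr.cost, Instr.effect, State.setReg, Function.update_apply,
      ↓reduceIte, Nat.reduceEqDiff, and_true, hs.r8, hs.r5, hs.r6, hs.r12, h20, h31, len_one]
    omega
  · simp [hs₁, effects, Instr.effect, State.setReg, hs.r8, h20, h31]
  · simp [hs₁, effects, Instr.effect, State.setReg, hs.r5, hs.r6, hs.r12]
    omega
  · simp [hs₁, effects, Instr.effect, State.setReg, hs.r6]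
  · exact (Nat.mul_le_mul (Nat.sub_le _ _) (Nat.pow_le_pow_right hq0 (by omega))).trans_lt hy
  · rintro t ⟨hst, hz1, hz2⟩
    have hrt := hr.of_reg_eq hst.2
    have hmt : t.mem = s.mem := hst.1.trans hss.1
    obtain ⟨z, h20⟩ : ∃ z, t.reg 20 = z := ⟨_, rfl⟩
    rw [h20] at hz1 hz2
    refine Ends.seq (Ends.instr ?_ (Ends.mono (markOne_ends (L := L) (P := P) (T := z) hq ?_ hN hm
      hL) le_rfl ?_))
    · have hzb : z < q ^ (6 * L) := by
        have hβ : (1 : ℤ) ≤ (q : ℤ) ^ (m + 1) - 1 := by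
          have : (1 : ℤ) < (q : ℤ) ^ (m + 1) := one_lt_pow₀ (by exact_mod_cast hq) (by omega)
          omega
        obtain ⟨x, hx⟩ : ∃ x, y - q ^ (m + 1) * q ^ P = x := ⟨_, rfl⟩
        rw [hx] at hz2
        have hxL : x * q ^ (N - m) < q ^ L := by
          rw [← hx]
          exact (Nat.mul_le_mul (Nat.sub_le _ _)
            (Nat.pow_le_pow_right hq0 (by omega))).trans_lt hy
        have hz3 : (z : ℤ) < (q : ℤ) ^ L + 4 * L := by
          have hxZ : (x : ℤ) * (q : ℤ) ^ (N - m) < (q : ℤ) ^ L := by exact_mod_cast hxL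
          by_contra hle
          rw [not_lt] at hle
          have e1 := mul_le_mul_of_nonneg_right hle (by omega : 0 ≤ (q : ℤ) ^ (m + 1) - 1)
          have e2 : (q : ℤ) ^ L ≤ (q : ℤ) ^ L * ((q : ℤ) ^ (m + 1) - 1) :=
            le_mul_of_one_le_right (by positivity) hβ
          have e3 : (0 : ℤ) ≤ x := by positivity
          nlinarith
        have e4 : L < q ^ L := lt_pow_of_le hq le_rfl
        have e5 : q ^ (6 * L) = q ^ L * q ^ (5 * L) := by rw [← pow_add]; congr 1; omega
        have e6 : 2 ^ 5 ≤ q ^ (5 * L) :=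
          (Nat.pow_le_pow_left hq 5).trans (Nat.pow_le_pow_right hq0 (by omega))
        have e7 : z < q ^ L + 4 * L := by exact_mod_cast hz3
        rw [e5]
        nlinarith
      simp only [Instr.cost, h20]
      exact len_le_of_lt_pow (by omega) hzb
    · obtain ⟨h1, h3, h4, h5, h6, h7, h8, h10, h12⟩ := hrt
      constructor <;> simp [Instr.effect, State.setReg, *]
    · rintro u ⟨hu, hmu⟩
      refine ⟨z, hz1, hz2, hu, fun r c' hc' => ?_⟩
      rw [hmu r c' hc', ← hmt]
      rfl
  · nlinarith

end EncodeRound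

/-! ### Correctness of the encoding -/

/-- The memory between the rounds of the encoding: the columns from position `N` on are written. -/
def EncodeMem (q n k i₀ N : ℕ) (t : State) : Prop :=
  ∀ r c, r ≤ k → c < n → t.mem (r * n + c) = if N ≤ c then algEntry q n k i₀ r c else 0

theorem EncodeMem.step {q n k i₀ N : ℕ} {s t : State} {p : ℕ → Prop} [DecidablePred p] {d : ℕ → ℕ}
    (h : EncodeMem q n k i₀ (N + 1) s)
    (ht : ∀ r c, c < n → t.mem (r * n + c) = if c = N ∧ p r then d r else s.mem (r * n + c))
    (hd : ∀ r ≤ k, algEntry q n k i₀ r N = if p r then d r else 0) :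
    EncodeMem q n k i₀ N t := by
  intro r c hr hc
  rw [ht r c hc, h r c hr hc]
  rcases lt_trichotomy c N with h1 | rfl | h1
  · rw [if_neg (by omega), if_neg (by omega), if_neg (by omega)]
  · rw [hd r hr]
    simp
  · rw [if_neg (by omega), if_pos (by omega), if_pos (by omega)]

section EncodeLoop

variable {q n k i₀ L P f N m T i B D : ℕ} {s : State} {Q : State → Prop}

/-- A round of the encoding at a position where a leading entry is possible but not forced. -/
theorem encodeRound_of_le (hq : 2 ≤ q) (hD : k * (n - k) = D)
    (hs : EncodeRegs q n L P (N + 1) m T s)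
    (hI : EncodeInv q P (4 * L * q ^ (2 * D)) n k i₀ (N + 1) m T i)
    (hN : N < n) (hmN : m ≤ N) (hmn : N + 1 + k ≤ n + m)
    (hU : (k + 2 * n) * (4 * L * q ^ (2 * D)) < q ^ P)
    (hL : P + 2 * D + n < L) (hf : L ≤ 2 ^ f)
    (hcont : ∀ t y, EncodeRegs q n L P N m T t → t.mem = s.mem → t.reg 20 = y →
      t.reg 30 = y / q ^ P → t.reg 31 = q ^ m → y * q ^ n < q ^ L →
      EncodeMid q P (4 * L * q ^ (2 * D)) n k i₀ N m y i →
      Ends q (.ifLt 30 31 encodeZero encodeOne) t B Q) :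
    Ends q encodeRound s ((f + 4) * (100 * L) + B) Q := by
  have hq0 : 0 < q := by omega
  have hmk : m ≤ k := by have := hI.weight; omega
  have hTP := hI.lt_pow hU
  have hlen : ∀ v, v < q ^ L → len q v ≤ L := fun v => len_le_of_lt_pow (by omega)
  have hlenle : ∀ v, v ≤ L → len q v ≤ L := fun v => len_le_of_le hq (by omega)
  have hTL : T < q ^ L := hTP.trans_le (Nat.pow_le_pow_right hq0 (by omega))
  have lN := hlenle N (by omega)
  have lN1 := hlenle (N + 1) (by omega)
  have lm := hlenle m (by omega)
  unfold encodeRound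
  refine Ends.mono (Ends.seq (B := 2 * L) (B' := 2 * L + (3 * (2 * L) + ((f + 2) * (100 * L) +
    (2 * (4 * L) + B)))) (Ends.instr ?_ (Ends.ifLt ?_ ?_ ?_))) (by nlinarith) fun _ h => h
  · simp only [Instr.cost, hs.r5, hs.r12, len_one]
    omega
  · simp [Instr.effect, State.setReg, hs.r5, hs.r6, hs.r12]
    omega
  · intro h
    simp [Instr.effect, State.setReg, hs.r5, hs.r6, hs.r12] at h
    omega
  · intro _
    have hs' : EncodeRegs q n L P N m T ((Instr.sub 5 5 12).effect q s) := by
      obtain ⟨h1, h3, h4, h5, h6, h7, h8, h10, h12⟩ := hs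
      constructor <;> simp [Instr.effect, State.setReg, *]
    have hmem' : ((Instr.sub 5 5 12).effect q s).mem = s.mem := rfl
    generalize (Instr.sub 5 5 12).effect q s = s' at hs' hmem'
    set s₁ := effects q [.copy 20 3, .add 21 5 12, .sub 22 21 6] s' with hs₁
    have hss : SameLow s' s₁ := by
      simp only [hs₁, effects, Instr.effect]
      repeat' first | exact SameLow.refl s' | refine SameLow.setReg ?_ (by norm_num) _
    have hr := hs'.of_reg_eq hss.2
    refine Ends.seq (Ends.block (K := 2 * L) ?_ (Ends.seq (Ends.mono (ceilRatio_ends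
      (x := T) (a := N + 1) (b := N + 1 - m) (f := f) (s := s₁) hq
      hr.r10 hr.r12 ?_ ?_ ?_ ?_ (by omega) (by omega) (by omega) hf) le_rfl ?_)))
    · have l1 := hlen T hTL
      simp only [CostsLe, Instr.cost, Instr.effect, State.setReg, Function.update_apply,
        ↓reduceIte, Nat.reduceEqDiff, and_true, hs'.r3, hs'.r5, hs'.r6, hs'.r12, len_one]
      omega
    · simp [hs₁, effects, Instr.effect, State.setReg, hs'.r3]
    · simp [hs₁, effects, Instr.effect, State.setReg, hs'.r5, hs'.r12]
    · simp [hs₁, effects, Instr.effect, State.setReg, hs'.r5, hs'.r6, hs'.r12]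
    · calc T * q ^ (N + 1) < q ^ P * q ^ (N + 1) := Nat.mul_lt_mul_of_pos_right hTP
            (Nat.pow_pos hq0)
        _ = q ^ (P + (N + 1)) := (pow_add _ _ _).symm
        _ ≤ q ^ L := Nat.pow_le_pow_right hq0 (by omega)
    · rintro t ⟨hst, hy1, hy2⟩
      have hrt := hr.of_reg_eq hst.2
      have hmt : t.mem = s.mem := (hst.1.trans hss.1).trans hmem'
      obtain ⟨y, h20⟩ : ∃ y, t.reg 20 = y := ⟨_, rfl⟩
      rw [h20] at hy1 hy2
      have hM : EncodeMid q P (4 * L * q ^ (2 * D)) n k i₀ N m y i := by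
        subst hD
        exact hI.mid hq hmN (by omega) hy1 hy2
      have hyn : y * q ^ n < q ^ L := by
        have h1 := gaussNat_le_pow_of_le hq (by omega : m ≤ N + 1) hmk hmn
        rw [hD] at h1
        calc y * q ^ n ≤ q ^ (2 * D) * q ^ P * q ^ n := Nat.mul_le_mul_right _
              ((hM.le_pow hU hmN hN).trans (Nat.mul_le_mul_right _ h1))
          _ = q ^ (2 * D + P + n) := by rw [pow_add, pow_add]
          _ < q ^ L := Nat.pow_lt_pow_right hq (by omega)
      have hyL : y < q ^ L := (Nat.le_mul_of_pos_right y (Nat.pow_pos hq0)).trans_lt hyn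
      refine Ends.seq (Ends.block (K := 4 * L) ?_ (hcont _ y ?_ ?_ ?_ ?_ ?_ hyn hM))
      · have l1 := hlen y hyL
        have l2 := hlenle P (by omega)
        simp only [CostsLe, Instr.cost, Instr.effect, State.setReg, Function.update_apply,
          ↓reduceIte, Nat.reduceEqDiff, and_true, h20, hrt.r6, hrt.r8, hrt.r12, len_one]
        omega
      · exact hrt.of_reg_eq fun r hr => by
          simp [effects, Instr.effect, State.setReg,
            show r ≠ 30 by omega, show r ≠ 31 by omega]
      · simp [effects, Instr.effect, State.setReg, hmt]
      · simp [effects, Instr.effect, State.setReg, h20]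
      · simp [effects, Instr.effect, State.setReg, h20, hrt.r8]
      · simp [effects, Instr.effect, State.setReg, hrt.r6, hrt.r12]

theorem encodeRound_full (hq : 2 ≤ q) (hs : EncodeRegs q n L P (N + 1) (m + 1) T s) (hN : N < n)
    (hm : m + 1 < n) (hNm : N < m + 1) (hL : n ≤ L) :
    Ends q encodeRound s (30 * L) (fun t => EncodeRegs q n L P N m T t ∧ ∀ r c, c < n →
      t.mem (r * n + c) = if c = N ∧ (r = 0 ∨ r = m + 1) then 1 else s.mem (r * n + c)) := by
  have hlenle : ∀ v, v ≤ L → len q v ≤ L := fun v => len_le_of_le hq (by omega)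
  have lN := hlenle N (by omega)
  have lN1 := hlenle (N + 1) (by omega)
  have lm := hlenle (m + 1) (by omega)
  unfold encodeRound
  refine Ends.mono (Ends.seq (B := 2 * L) (B' := 2 * L + 20 * L) (Ends.instr ?_
    (Ends.ifLt ?_ ?_ ?_))) (by omega) fun _ h => h
  · simp only [Instr.cost, hs.r5, hs.r12, len_one]
    omega
  · simp [Instr.effect, State.setReg, hs.r5, hs.r6, hs.r12]
    omega
  · intro _
    refine markOne_ends hq ?_ hN hm hL
    obtain ⟨h1, h3, h4, h5, h6, h7, h8, h10, h12⟩ := hs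
    constructor <;> simp [Instr.effect, State.setReg, *]
  · intro h
    simp [Instr.effect, State.setReg, hs.r5, hs.r6, hs.r12] at h
    omega

set_option maxHeartbeats 1000000 in
theorem encodeLoop_ends (hq : 2 ≤ q) (hkn : k < n) (hD : k * (n - k) = D)
    (hU : (k + 2 * n) * (4 * L * q ^ (2 * D)) < q ^ P)
    (hL : P + 2 * D + n < L) (hf : L ≤ 2 ^ f)
    (hs : EncodeRegs q n L P n k T s)
    (hI : EncodeInv q P (4 * L * q ^ (2 * D)) n k i₀ n k T i)
    (hmem : ∀ a, s.mem a = 0) :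
    Ends q (.whileLt 4 6 encodeRound) s
      (n * ((2 * f + 10) * (100 * L)) + (n - k) * ((k + 1) * (100 * n)) + 2 * L)
      (EncodeMem q n k i₀ 0) := by
  have hlenle : ∀ v, v ≤ L → len q v ≤ L := fun v => len_le_of_le hq (by omega)
  refine Ends.whileLt (fun B t => ∃ N m T i, EncodeRegs q n L P N m T t ∧
    EncodeInv q P (4 * L * q ^ (2 * D)) n k i₀ N m T i ∧ EncodeMem q n k i₀ N t ∧ N ≤ n ∧
    -- Equivalently N - m ≤ n - k, as needed for the uniform bound on the coefficients.
    N + k ≤ n + m ∧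
    N * ((2 * f + 10) * (100 * L)) + (N - m) * ((k + 1) * (100 * n)) + 2 * L ≤ B) ?_ ?_ _ s ?_
  · rintro B t ⟨N, m, T, i, hr, hI, hM, hN, hmn, hB⟩ hlt
    rw [hr.r4, hr.r6] at hlt ⊢
    obtain rfl : m = 0 := by omega
    refine ⟨by rw [len_zero]; omega, fun r c hrk hc => ?_⟩
    rw [hM r c hrk hc, if_pos (Nat.zero_le c)]
    split_ifs with h
    · rfl
    · obtain ⟨h1, h2, -⟩ := algA_of_weight_eq hI.weight (by omega : n - N < n - c)
      simp [algEntry, h1, h2]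
  · rintro B t ⟨N, m, T, i, hr, hI, hM, hN, hmn, hB⟩ hlt
    rw [hr.r4, hr.r6] at hlt ⊢
    have hmN := hI.le
    have hmk : m ≤ k := by have := hI.weight; omega
    obtain ⟨N, rfl⟩ : ∃ N', N = N' + 1 := ⟨N - 1, by omega⟩
    obtain ⟨m, rfl⟩ : ∃ m', m = m' + 1 := ⟨m - 1, by omega⟩
    have hNn : N < n := hN
    have lm := hlenle (m + 1) (by omega)
    rw [len_zero]
    have hone : N + 1 - (m + 1) = N - m := by omega
    by_cases hNm : N < m + 1
    · refine ⟨30 * L, N * ((2 * f + 10) * (100 * L)) + (N - m) * ((k + 1) * (100 * n)) + 2 * L,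
        ?_, Ends.mono (encodeRound_full hq hr hNn (by omega) hNm (by omega)) le_rfl ?_⟩
      · rw [hone] at hB
        nlinarith
      · rintro u ⟨hu, hmu⟩
        obtain ⟨h1, h2⟩ := hI.step_full hq hNn hNm
        exact ⟨N, m, T, i, hu, h1, hM.step hmu h2, by omega, by omega, le_rfl⟩
    · rw [not_lt] at hNm
      have hG := gaussNat_pos (q := q) hNm
      by_cases hc : i / gaussNat q N (m + 1) < q ^ (m + 1)
      · refine ⟨(f + 4) * (100 * L) + (2 * L + (20 * L + (m + 1 + 1) * (100 * n))),
          N * ((2 * f + 10) * (100 * L)) + (N - (m + 1)) * ((k + 1) * (100 * n)) + 2 * L, ?_,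
          encodeRound_of_le hq hD hr hI hNn hNm hmn hU hL hf ?_⟩
        · rw [show N + 1 - (m + 1) = N - (m + 1) + 1 by omega] at hB
          have : (m + 1 + 1) * (100 * n) ≤ (k + 1) * (100 * n) :=
            Nat.mul_le_mul_right _ (by omega)
          nlinarith
        · intro u y hu hmu h20 h30 h31 hyn hMid
          rw [← hMid.div_eq hU hNm hNn] at hc
          have hyL : y < q ^ L :=
            (Nat.le_mul_of_pos_right y (Nat.pow_pos (by omega))).trans_lt hyn
          refine Ends.ifLt ?_ ?_ ?_
          · have l1 : len q (y / q ^ P) ≤ L :=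
              len_le_of_lt_pow (by omega) ((Nat.div_le_self _ _).trans_lt hyL)
            have l2 : len q (q ^ (m + 1)) ≤ L :=
              len_le_of_lt_pow (by omega) (Nat.pow_lt_pow_right hq (by omega))
            rw [h30, h31]
            omega
          · intro _
            refine Ends.mono (encodeZero_ends hq hu hNn (by omega) (by omega) (by omega) h20 h30
              (Nat.div_mul_le_self _ _) hyL hc ?_) le_rfl ?_
            · intro r hr1 hr2
              rw [hmu, hM r N (by omega) hNn, if_neg (by omega)]
            · rintro v ⟨hv, hmv⟩
              obtain ⟨h1, h2⟩ := hMid.step_zero hq hU hNm (by omega) hNn hc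
              rw [hmu] at hmv
              exact ⟨N, m + 1, _, _, hv, h1, hM.step hmv h2, by omega, by omega, le_rfl⟩
          · rw [h30, h31]
            exact fun h => absurd hc h
      · refine ⟨(f + 4) * (100 * L) + (2 * L + (f + 4) * (100 * L)),
          N * ((2 * f + 10) * (100 * L)) + (N - m) * ((k + 1) * (100 * n)) + 2 * L, ?_,
          encodeRound_of_le hq hD hr hI hNn hNm hmn hU hL hf ?_⟩
        · rw [hone] at hB
          nlinarith
        · intro u y hu hmu h20 h30 h31 hyn hMid
          rw [← hMid.div_eq hU hNm hNn] at hc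
          have hyL : y < q ^ L :=
            (Nat.le_mul_of_pos_right y (Nat.pow_pos (by omega))).trans_lt hyn
          refine Ends.ifLt ?_ ?_ ?_
          · have l1 : len q (y / q ^ P) ≤ L :=
              len_le_of_lt_pow (by omega) ((Nat.div_le_self _ _).trans_lt hyL)
            have l2 : len q (q ^ (m + 1)) ≤ L :=
              len_le_of_lt_pow (by omega) (Nat.pow_lt_pow_right hq (by omega))
            rw [h30, h31]
            omega
          · rw [h30, h31]
            exact fun h => absurd h hc
          · intro _
            rw [not_lt] at hc
            refine Ends.mono (encodeOne_ends hq hu hNn (by omega) hNm (by omega) (by omega) hf h20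
              h31 ((Nat.mul_le_mul_right _ hc).trans (Nat.div_mul_le_self _ _)) hyn) le_rfl ?_
            rintro v ⟨z, hz1, hz2, hv, hmv⟩
            subst hD
            obtain ⟨h1, h2⟩ := hMid.step_one hq hU hNm hNn (by omega) hc hz1 hz2
            rw [hmu] at hmv
            exact ⟨N, m, z, _, hv, h1, hM.step hmv h2, by omega, by omega, le_rfl⟩
  · refine ⟨n, k, T, i, hs, hI, fun r c hr hc => ?_, le_rfl, le_rfl, le_rfl⟩
    rw [hmem, if_neg (by omega)]

set_option maxHeartbeats 1000000 in
-- The coefficients [n-k+j; j] lead from 1 at j = 0 to [n; k] at j = k by one ratio each. The k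
-- roundings give the error k U with which the main loop starts.
theorem divideByGauss_ends (hq : 2 ≤ q) (hk : 0 < k) (hkn : k < n) (hD : k * (n - k) = D)
    (hU : (k + 2 * n) * (4 * L * q ^ (2 * D)) < q ^ P)
    (hL : P + 2 * D + n < L) (hf : L ≤ 2 ^ f)
    (h2 : s.reg 2 = k) (h3 : s.reg 3 = i * q ^ P) (h10 : s.reg 10 = L) (h12 : s.reg 12 = 1)
    (h13 : s.reg 13 = n - k) (h14 : s.reg 14 = 0) (hi : i < q ^ (2 * D)) :
    Ends q divideByGauss s (k * ((f + 4) * (100 * L)) + 2 * L) (fun t => t.mem = s.mem ∧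
      (∀ r < 20, r ≠ 3 → r ≠ 14 → t.reg r = s.reg r) ∧
      i * q ^ P ≤ t.reg 3 * gaussNat q n k ∧
      t.reg 3 * gaussNat q n k ≤ i * q ^ P + k * (4 * L * q ^ (2 * D))) := by
  have hq0 : 0 < q := by omega
  have hlenle : ∀ v, v ≤ L → len q v ≤ L := fun v => len_le_of_le hq (by omega)
  unfold divideByGauss
  refine Ends.whileLt_fuel (K := (f + 4) * (100 * L) - 2 * L) (K' := 2 * L) (fun g t =>
    t.mem = s.mem ∧ (∀ r < 20, r ≠ 3 → r ≠ 14 → t.reg r = s.reg r) ∧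
    ∃ j x, j + g = k ∧ t.reg 14 = j ∧ t.reg 3 = x ∧
      i * q ^ P ≤ x * gaussNat q (n - k + j) j ∧
      x * gaussNat q (n - k + j) j ≤ i * q ^ P + j * (4 * L * q ^ (2 * D))) ?_ ?_ ?_ k s ?_ ?_
  · rintro g t ⟨hm, hr, j, x, hj, h14', h3', hl, hu⟩
    have l1 := hlenle j (by omega)
    have l2 := hlenle k (by omega)
    rw [h14', hr 2 (by norm_num) (by norm_num) (by norm_num), h2]
    omega
  · rintro g t ⟨hm, hr, j, x, hj, h14', h3', hl, hu⟩ hlt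
    rw [h14', hr 2 (by norm_num) (by norm_num) (by norm_num), h2] at hlt
    obtain rfl : j = k := by omega
    rw [Nat.sub_add_cancel hkn.le] at hl hu
    rw [h3']
    exact ⟨hm, hr, hl, hu⟩
  · rintro g t ⟨hm, hr, j, x, hj, h14', h3', hl, hu⟩ hlt
    rw [h14', hr 2 (by norm_num) (by norm_num) (by norm_num), h2] at hlt
    obtain ⟨g, rfl⟩ : ∃ g', g = g' + 1 := ⟨g - 1, by omega⟩
    have h10' : t.reg 10 = L := (hr 10 (by norm_num) (by norm_num) (by norm_num)).trans h10
    have h12' : t.reg 12 = 1 := (hr 12 (by norm_num) (by norm_num) (by norm_num)).trans h12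
    have h13' : t.reg 13 = n - k := (hr 13 (by norm_num) (by norm_num) (by norm_num)).trans h13
    have hx : x < q ^ (2 * D + P) := by
      have e1 : j * (4 * L * q ^ (2 * D)) < q ^ P :=
        (Nat.mul_le_mul_right _ (by omega)).trans_lt hU
      have e2 := Nat.le_mul_of_pos_right x (gaussNat_pos (q := q) (by omega : j ≤ n - k + j))
      rw [pow_add]
      have e3 := Nat.mul_le_mul_right (q ^ P) (Nat.succ_le_of_lt hi)
      rw [Nat.succ_mul] at e3
      omega
    have hxn : x * q ^ n < q ^ L := by
      calc x * q ^ n < q ^ (2 * D + P) * q ^ n :=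
            Nat.mul_lt_mul_of_pos_right hx (Nat.pow_pos hq0)
        _ = q ^ (2 * D + P + n) := (pow_add _ _ _).symm
        _ ≤ q ^ L := Nat.pow_le_pow_right hq0 (by omega)
    have hxL : x < q ^ L := (Nat.le_mul_of_pos_right x (Nat.pow_pos hq0)).trans_lt hxn
    set s₁ := effects q [.copy 20 3, .add 21 14 12, .add 22 13 21] t with hs₁
    have hss : SameLow t s₁ := by
      simp only [hs₁, effects, Instr.effect]
      repeat' first | exact SameLow.refl t | refine SameLow.setReg ?_ (by norm_num) _
    refine ⟨g, rfl, Ends.mono (Ends.seq (B := 3 * (2 * L)) (B' := (f + 2) * (100 * L)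
      + 2 * (20 * L)) (Ends.block (K := 2 * L) ?_ (Ends.seq (Ends.mono (ceilRatio_ends
      (x := x) (a := j + 1) (b := n - k + (j + 1)) (f := f) (s := s₁) (L := L) hq
      ?_ ?_ ?_ ?_ ?_ ?_ (by omega) (by omega) (by omega) hf) le_rfl ?_)))) ?_ fun _ h => h⟩
    · have l1 := len_le_of_lt_pow (by omega) hxL
      have l2 := hlenle j (by omega)
      have l3 := hlenle (n - k) (by omega)
      have l4 := hlenle (j + 1) (by omega)
      simp only [CostsLe, Instr.cost, Instr.effect, State.setReg, Function.update_apply,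
        ↓reduceIte, Nat.reduceEqDiff, and_true, h3', h14', h12', h13', len_one]
      omega
    · rw [hss.2 10 (by norm_num), h10']
    · rw [hss.2 12 (by norm_num), h12']
    · simp [hs₁, effects, Instr.effect, State.setReg, h3']
    · simp [hs₁, effects, Instr.effect, State.setReg, h14', h12']
    · simp [hs₁, effects, Instr.effect, State.setReg, h14', h12', h13']
    · exact (Nat.mul_le_mul_left x (Nat.pow_le_pow_right hq0 (by omega))).trans_lt hxn
    · rintro u ⟨hst, hy1, hy2⟩
      have hlow := hss.trans hst
      obtain ⟨y, h20⟩ : ∃ y, u.reg 20 = y := ⟨_, rfl⟩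
      rw [h20] at hy1 hy2
      have h14u : u.reg 14 = j := (hlow.2 14 (by norm_num)).trans h14'
      have h12u : u.reg 12 = 1 := (hlow.2 12 (by norm_num)).trans h12'
      obtain ⟨e1, e2⟩ := approx_of_ratio hq (by omega)
        (gaussNat_succ_succ_mul hq (by omega : j ≤ n - k + j)).symm hy1 hy2
        (gaussNat_le_pow_of_le (n := n) (k := k) hq (by omega : j + 1 ≤ n - k + j + 1)
          (by omega) (by omega)) hl hu
      have hyL : y < q ^ (6 * L) := by
        have e3 : j * (4 * L * q ^ (2 * D)) + 4 * L * q ^ (2 * D) < q ^ P := by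
          rw [← Nat.succ_mul]
          exact (Nat.mul_le_mul_right _ (by omega)).trans_lt hU
        have e4 := Nat.le_mul_of_pos_right y
          (gaussNat_pos (q := q) (by omega : j + 1 ≤ n - k + j + 1))
        rw [hD] at e2
        have e5 : y < q ^ (2 * D + P) := by
          rw [pow_add]
          have e6 := Nat.mul_le_mul_right (q ^ P) (Nat.succ_le_of_lt hi)
          rw [Nat.succ_mul] at e6
          omega
        exact e5.trans_le (Nat.pow_le_pow_right hq0 (by omega))
      refine Ends.block (K := 20 * L) ?_ ⟨?_, ?_, j + 1, y, by omega, ?_, ?_, ?_, ?_⟩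
      · have l1 := len_le_of_lt_pow (by omega) hyL
        have l2 := hlenle j (by omega)
        simp only [CostsLe, Instr.cost, Instr.effect, State.setReg, Function.update_apply,
          ↓reduceIte, Nat.reduceEqDiff, and_true, h20, h14u, h12u, len_one]
        omega
      · simp only [effects, Instr.effect, State.setReg]
        exact hlow.1.trans hm
      · intro r hr20 hr3 hr14
        simp only [effects, Instr.effect, State.setReg, Function.update_apply, hr3, hr14, if_false]
        exact (hlow.2 r hr20).trans (hr r hr20 hr3 hr14)
      · simp [effects, Instr.effect, State.setReg, h14u, h12u]
      · simp [effects, Instr.effect, State.setReg, h20]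
      · exact e1
      · refine e2.trans_eq ?_
        rw [hD]
        ring
    · have : (f + 4) * (100 * L) = (f + 2) * (100 * L) + 200 * L := by ring
      omega
  · exact ⟨rfl, fun _ _ _ _ => rfl, 0, _, by omega, h14, h3, by simp, by simp⟩
  · have : 2 * L ≤ (f + 4) * (100 * L) := by nlinarith
    rw [Nat.sub_add_cancel this]

end EncodeLoop

set_option maxHeartbeats 1000000 in
theorem encodeProg_ends {q n k i : ℕ} (hq : 2 ≤ q) (hn : 3 ≤ n) (hk : 0 < k) (hkn : k < n)
    (hi : i < gaussNat q n k) :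
    Ends q encodeProg (encodeInput q n k i)
      (300000 * (n * (k * (n - k)) * (Nat.log 2 n + 1))) (EncodeMem q n k i 0) := by
  obtain ⟨D, hD⟩ : ∃ D, k * (n - k) = D := ⟨_, rfl⟩
  have hnD : n ≤ 2 * D := hD ▸ le_two_mul_mul_sub hk hkn
  have hf := mul_sub_le_two_pow hkn
  have hq0 : 0 < q := by omega
  have hiD : i < q ^ (2 * D) := hi.trans_le (hD ▸ gaussNat_le_pow hq hkn.le)
  rw [hD] at hf ⊢
  -- Since k + 2 n ≤ 6 D, the factor in front of q^(2D) is at most 2^10 D² ≤ q^(7D), which leaves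
  -- ample room below q^(16D).
  have hU : (k + 2 * n) * (4 * (32 * D) * q ^ (2 * D)) < q ^ (16 * D) := by
    have e1 : D < q ^ D := lt_pow_of_le hq le_rfl
    have e2 : 2 ^ 10 ≤ q ^ (5 * D) :=
      (Nat.pow_le_pow_left hq 10).trans (Nat.pow_le_pow_right hq0 (by omega))
    have e3 : (k + 2 * n) * (4 * (32 * D)) ≤ 2 ^ 10 * (D * D) := by nlinarith
    calc (k + 2 * n) * (4 * (32 * D) * q ^ (2 * D))
        = (k + 2 * n) * (4 * (32 * D)) * q ^ (2 * D) := (mul_assoc _ _ _).symm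
      _ ≤ q ^ (5 * D) * (q ^ D * q ^ D) * q ^ (2 * D) := by
          refine Nat.mul_le_mul_right _ (e3.trans (Nat.mul_le_mul e2 (Nat.mul_le_mul e1.le e1.le)))
      _ = q ^ (9 * D) := by rw [← pow_add, ← pow_add, ← pow_add]; congr 1; ring
      _ < q ^ (16 * D) := Nat.pow_lt_pow_right hq (by omega)
  have hlen : ∀ v, v ≤ 32 * D → len q v ≤ 32 * D := fun v => len_le_of_le hq (by omega)
  unfold encodeProg
  set s₁ := effects q [.const 12 1, .sub 13 1 2, .mul 10 2 13, .add 10 10 10, .add 10 10 10,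
      .add 10 10 10, .add 10 10 10, .copy 8 10, .add 10 10 10, .shl 3 3 8]
    (encodeInput q n k i) with hs₁
  have p16 : D + D + (D + D) + (D + D + (D + D)) + (D + D + (D + D) + (D + D + (D + D)))
    = 16 * D := by omega
  have p32 : 16 * D + 16 * D = 32 * D := by omega
  refine Ends.mono (Ends.seq (B := 10 * (128 * D)) (B' := k * ((2 * Nat.log 2 n + 7 + 4)
    * (100 * (32 * D))) + 2 * (32 * D) + (3 * (128 * (n * D)) + (n * ((2 * (2 * Nat.log 2 n + 7)
    + 10) * (100 * (32 * D))) + (n - k) * ((k + 1) * (100 * n)) + 2 * (32 * D))))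
    (Ends.block (K := 128 * D) ?_
    (Ends.seq (Ends.mono (divideByGauss_ends (s := s₁) (i := i) (L := 32 * D) (P := 16 * D)
      (f := 2 * Nat.log 2 n + 7) hq hk hkn hD hU (by omega) hf ?_ ?_ ?_ ?_ ?_ ?_ hiD) le_rfl
      ?_)))) ?_ fun _ h => h
  · have l1 := hlen n (by omega)
    have l2 := hlen k (by omega)
    have l3 : len q k * len q (n - k) ≤ D := by
      rw [← hD]
      exact Nat.mul_le_mul (len_le_of_le hq hk le_rfl) (len_le_of_le hq (by omega) le_rfl)
    have l4 := hlen D (by omega)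
    have l5 := hlen (D + D) (by omega)
    have l6 := hlen (D + D + (D + D)) (by omega)
    have l7 := hlen (D + D + (D + D) + (D + D + (D + D))) (by omega)
    have l8 := hlen (16 * D) (by omega)
    have l9 : len q i ≤ 2 * D := len_le_of_lt_pow (by omega) hiD
    simp only [CostsLe, Instr.cost, Instr.effect, State.setReg, Function.update_apply,
      ↓reduceIte, Nat.reduceEqDiff, and_true, encodeInput, inputReg, len_one, hD, p16]
    omega
  · simp [hs₁, effects, Instr.effect, State.setReg, encodeInput, inputReg]
  · simp [hs₁, effects, Instr.effect, State.setReg, encodeInput, inputReg, hD, p16]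
  · simp [hs₁, effects, Instr.effect, State.setReg, encodeInput, inputReg, hD, p16, p32]
  · simp [hs₁, effects, Instr.effect, State.setReg, encodeInput, inputReg]
  · simp [hs₁, effects, Instr.effect, State.setReg, encodeInput, inputReg]
  · simp [hs₁, effects, Instr.effect, State.setReg, encodeInput, inputReg]
  · rintro t ⟨hmt, hr, hl, hu⟩
    have h1 : t.reg 1 = n := (hr 1 (by norm_num) (by norm_num) (by norm_num)).trans
      (by simp [hs₁, effects, Instr.effect, State.setReg, encodeInput, inputReg])
    have h2 : t.reg 2 = k := (hr 2 (by norm_num) (by norm_num) (by norm_num)).trans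
      (by simp [hs₁, effects, Instr.effect, State.setReg, encodeInput, inputReg])
    have h4 : t.reg 4 = 0 := (hr 4 (by norm_num) (by norm_num) (by norm_num)).trans
      (by simp [hs₁, effects, Instr.effect, State.setReg, encodeInput, inputReg])
    have h8 : t.reg 8 = 16 * D := (hr 8 (by norm_num) (by norm_num) (by norm_num)).trans
      (by simp [hs₁, effects, Instr.effect, State.setReg, encodeInput, inputReg, hD, p16])
    have h10 : t.reg 10 = 32 * D := (hr 10 (by norm_num) (by norm_num) (by norm_num)).trans
      (by simp [hs₁, effects, Instr.effect, State.setReg, encodeInput, inputReg, hD, p16, p32])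
    have h12 : t.reg 12 = 1 := (hr 12 (by norm_num) (by norm_num) (by norm_num)).trans
      (by simp [hs₁, effects, Instr.effect, State.setReg, encodeInput, inputReg])
    have hm0 : ∀ a, t.mem a = 0 := fun a => by
      rw [hmt]
      simp [hs₁, effects, Instr.effect, State.setReg, encodeInput]
    obtain ⟨T, h3⟩ : ∃ T, t.reg 3 = T := ⟨_, rfl⟩
    rw [h3] at hl hu
    refine Ends.seq (Ends.block (K := 128 * (n * D)) ?_ (encodeLoop_ends (D := D) (T := T) (i := i)
      (L := 32 * D) (P := 16 * D) hq hkn hD hU (by omega) hf ?_ ⟨?_, ?_, hi, hl, ?_⟩ ?_))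
    · have l1 : len q n ≤ n := len_le_of_le hq (by omega) le_rfl
      have l2 : len q k ≤ n := len_le_of_le hq (by omega) hkn.le
      have l3 : len q k * len q n ≤ n * (2 * D) := Nat.mul_le_mul l2 (l1.trans hnD)
      have l4 : D ≤ n * D := Nat.le_mul_of_pos_left D (by omega)
      have l5 : n * (2 * D) = 2 * (n * D) := by ring
      simp only [CostsLe, Instr.cost, Instr.effect, State.setReg, Function.update_apply,
        ↓reduceIte, Nat.reduceEqDiff, and_true, h1, h2]
      omega
    · constructor <;> simp [effects, Instr.effect, State.setReg, h1, h2, h3, h4, h8, h10, h12]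
    · simp [algA]
    · simp [algA]
    · simpa using hu
    · intro a
      simp [effects, Instr.effect, State.setReg, hm0]
  · have h1 : (n - k) * ((k + 1) * (100 * n)) ≤ 200 * (n * D) := by
      rw [← hD]
      have : (n - k) * (k + 1) ≤ (n - k) * (2 * k) := Nat.mul_le_mul_left _ (by omega)
      nlinarith
    have h2 : D ≤ n * D := Nat.le_mul_of_pos_left D (by omega)
    obtain ⟨lg, hlg⟩ : ∃ lg, Nat.log 2 n = lg := ⟨_, rfl⟩
    rw [hlg]
    have h3 : k * ((2 * lg + 7 + 4) * (100 * (32 * D)))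
        ≤ n * ((2 * lg + 7 + 4) * (100 * (32 * D))) := Nat.mul_le_mul_right _ hkn.le
    nlinarith [Nat.zero_le (n * D * lg)]

end GrassmannCoding

/-! ### The theorem. -/

theorem mainTheorem5 :
    -- decoding: computing the index of a subspace from its extended representation
    (∃ (P : Prog) (C : ℝ), ∀ (q : ℕ) (F : Type*) [Field F] (φ : F ≃ Fin q),
      (φ 0 : ℕ) = 0 → (φ 1 : ℕ) = 1 →
      ∀ n k : ℕ, 3 ≤ n → 0 < k → k < n →
      ∀ (X : Submodule F (Fin n → F)) (hX : Module.finrank F X = k),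
        ∃ (t : State) (c : ℕ), Runs q P (decodeInput q (EXT φ X hX)) t c ∧
          (t.reg 3 : ℚ) = indexExt q (EXT φ X hX) ∧
          (c : ℝ) ≤ C * (n * k * (n - k) * Real.log n * Real.log (Real.log n))) ∧
    -- encoding: computing the output of Encoding Algorithm A from the index
    (∃ (P : Prog) (C : ℝ), ∀ q : ℕ, IsPrimePow q →
      ∀ n k : ℕ, 3 ≤ n → 0 < k → k < n →
      ∀ i : ℕ, (i : ℚ) < gauss q n k →
        ∃ (t : State) (c : ℕ), Runs q P (encodeInput q n k i) t c ∧
          (∀ (r : Fin (k + 1)) (c' : Fin n), t.mem (r * n + c') = algAOutput q n k i r c') ∧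
          (c : ℝ) ≤ C * (n * k * (n - k) * Real.log n * Real.log (Real.log n))) := by
  refine ⟨?_, ?_⟩
  · obtain ⟨C, hC⟩ := exists_const_mul_log_le 20000
    refine ⟨decodeProg, C, fun q F _ φ h0 h1 n k hn hk hkn X hX => ?_⟩
    have hq : 2 ≤ q := by
      have := (φ 1).2
      omega
    obtain ⟨t, c, h2, h3, h4⟩ := decodeProg_ends hq (isExtended_EXT φ h0 X hX) hk hkn
    exact ⟨t, c, h2, h4, hC n k c hn hkn h3⟩
  · obtain ⟨C, hC⟩ := exists_const_mul_log_le 300000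
    refine ⟨encodeProg, C, fun q hq n k hn hk hkn i hi => ?_⟩
    have hq2 : 2 ≤ q := hq.two_le
    rw [gauss_eq_gaussNat hq2] at hi
    obtain ⟨t, c, h2, h3, h4⟩ := encodeProg_ends hq2 hn hk hkn (by exact_mod_cast hi)
    refine ⟨t, c, h2, fun r c' => ?_, hC n k c hn hkn h3⟩
    rw [h4 r c' (by omega) c'.2, if_pos (Nat.zero_le _), algAOutput_eq]
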